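/- Let $G$ be an infinite tree with a distinguished root vertex, such that the degrees of the vertices of $G$ are bounded by a common finite constant and every vertex has at least two offspring (the offspring of $v$ are the vertices $w$ other than the root such that $v$ is the first vertex after $w$ on the simple path from $w$ to the root). Let each edge of $G$ carry an independent Poisson process of rate one on $[0,\infty)$. The random stirring process on $G$ driven by these Poisson processes is the process $(\sigma_t)_{t \geq 0}$ of permutations of the vertex set that starts at the identity, for which $t \mapsto \sigma_t(v)$ is right-continuous and piecewise constant for each vertex $v$, and in which, at each point $t$ of the Poisson process of an edge $\{x,y\}$, the transposition of $x$ and $y$ is performed, that is, a particle located at $x$ just before time $t$ is at $y$ at time $t$, and vice versa. The random stirring model with parameter $T$ is the law of $\sigma_T$. Then there exists $T_0 \in (0,\infty)$, depending only on $G$, such that, for every $T \geq T_0$, almost surely the stirring process is well defined (there is exactly one such process $(\sigma_t)_{t\ge 0}$) and the permutation $\sigma_T$ has at least one infinite cycle. -/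

import Mathlib

open MeasureTheory ProbabilityTheory Filter Topology
open scoped NNReal ENNReal

/-- `N` is a Poisson point process (a random subset of `S`) with intensity measure `m`: the number
of points in a measurable set `A` of finite intensity is a Poisson variable with mean `m A`, and
the numbers of points in finitely many pairwise disjoint such sets are independent. Numbers of
points are counted in `ℕ∞`, so that an infinite set of points has no finite count. -/
structure IsPoissonPointProcess {S Ω : Type*} [MeasurableSpace S] [MeasurableSpace Ω]
    (m : Measure S) (μ : Measure Ω) (N : Ω → Set S) : Prop where
  hasLaw_count : ∀ A : Set S, MeasurableSet A → m A ≠ ∞ →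
    HasLaw (fun ω ↦ (N ω ∩ A).encard)
      ((poissonMeasure (m A).toNNReal).map (Nat.cast : ℕ → ℕ∞)) μ
  iIndepFun_count : ∀ (n : ℕ) (A : Fin n → Set S), (∀ i, MeasurableSet (A i)) →
    (∀ i, m (A i) ≠ ∞) → Pairwise (fun i j ↦ Disjoint (A i) (A j)) →
    iIndepFun (fun i ω ↦ (N ω ∩ A i).encard) μ

namespace SimpleGraph

variable {V : Type*}

/-- The edge set of a graph is given its discrete σ-algebra. -/
instance instMeasurableSpaceEdgeSet (G : SimpleGraph V) : MeasurableSpace G.edgeSet := ⊤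

/-- The product of counting measure on the edges and Lebesgue measure on `[0, ∞)`. -/
noncomputable def barIntensity (G : SimpleGraph V) : Measure (G.edgeSet × ℝ≥0) :=
  (Measure.count : Measure G.edgeSet).prod ((volume : Measure ℝ).comap NNReal.toReal)

/-- Each edge of `G` independently carries a Poisson process of rate one on `[0, ∞)`;
`(e, t) ∈ bars ω` means that `t` is a point of the process of the edge `e`. -/
def IsPoissonBars (G : SimpleGraph V) {Ω : Type*} [MeasurableSpace Ω] (μ : Measure Ω)
    (bars : Ω → Set (G.edgeSet × ℝ≥0)) : Prop :=
  IsPoissonPointProcess G.barIntensity μ bars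

/-- The bar set `B` has a bar at time `t` on an edge joining `x` and `y`. -/
def HasBar (G : SimpleGraph V) (B : Set (G.edgeSet × ℝ≥0)) (t : ℝ≥0) (x y : V) : Prop :=
  ∃ h : G.Adj x y, ((⟨s(x, y), h⟩ : G.edgeSet), t) ∈ B

/-- The effect on a particle at `x` of the transpositions performed at time `t`: it crosses the bar
at `x` if there is one, and stays put if there is none. -/
def StirStep (G : SimpleGraph V) (B : Set (G.edgeSet × ℝ≥0)) (t : ℝ≥0) (x y : V) : Prop :=
  G.HasBar B t x y ∨ (y = x ∧ ∀ z, ¬ G.HasBar B t x z)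

/-- `σ` is the stirring process driven by the bars `B`: it starts at the identity, and
the position `σ t v` at time `t` of the particle started at `v` is a right-continuous function
of `t` (for the discrete topology on the vertices) which is updated at each time `t` by
applying to its value just before `t` the transposition of the edge of each bar at time `t`. -/
structure IsStirring (G : SimpleGraph V) (B : Set (G.edgeSet × ℝ≥0))
    (σ : ℝ≥0 → Equiv.Perm V) : Prop where
  zero : σ 0 = 1
  right_continuous : ∀ v t, ∀ᶠ s in 𝓝[>] t, σ s v = σ t v
  update : ∀ v t, ∀ᶠ s in 𝓝[<] t, G.StirStep B t (σ s v) (σ t v)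

/-- The offspring of `v` in a tree with root `φ`: the vertices `w ≠ φ` such that `v` is the first
vertex after `w` on the simple path from `w` to `φ`. -/
def offspring (G : SimpleGraph V) (φ v : V) : Set V :=
  {w | w ≠ φ ∧ ∃ p : G.Walk w φ, p.IsPath ∧ p.snd = v}

end SimpleGraph

/-- Some cycle (orbit) of the permutation `f` is infinite. -/
def Equiv.Perm.HasInfiniteCycle {V : Type*} (f : Equiv.Perm V) : Prop :=
  ∃ v, {w | f.SameCycle v w}.Infinite

/-!
A particle that starts at `v` at time `0` is at `σ_T v` at time `T`; if it then starts afresh at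
time `0` from there, and so on, it follows the cycle of `σ_T` through `v`. The cycles are thus the
traces of a walk, the *meander*, on the vertices times a circle of length `T`, which crosses every
bar that it meets. A vertex whose meander reaches arbitrarily great depths lies on an infinite
cycle (`SimpleGraph.IsStirring.infinite_sameCycle`), so it suffices that with high probability, for
every `n`, some vertex of a fixed depth `m` has a meander that reaches the depth `n`.

*Discretisation.* The circle is divided into `M` slots, the elements of `ZMod M`, and a bit
`(z, j)` tells whether there is a bar in the slot `j` on the edge from `z` to its parent. As `M`
grows, the probability that two bars in a finite part of the tree share a slot tends to `0`
(`measureReal_not_separated_le`), and without such coincidences the particles follow the discrete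
meander (`Separated.exists_le_depth`). The trial at a vertex `c` of depth `m` starts at `c` in the
slot `0` with the bit of `c` in the slot `-1` declared to be `true`. The discrete meander is
reversible, so it can only close up by passing through that bar to the parent of `c`. The trial
fails if the meander leaves the subtree of `c` before it reaches the depth `n`. Trials at the
vertices of depth `m` depend on disjoint sets of bits, and there are at least `2 ^ m` of them. If
each fails with a probability of at most `383 / 384`, all of them fail with a probability of at
most `(383 / 384) ^ 2 ^ m` (`measureReal_forall_fails_le`), and `m` is arbitrary.

*The escape bound.* The heart of the proof is `FailValue.escapeBound`: for large `T` and
large `M`, the meander escapes from an unexplored subtree with a probability of at least `1 / 384`,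
uniformly in the depth `n` that it has to reach. The bits are revealed when the meander looks at
them, and the proof is a strong induction on the distance of `c` from the depth `n`. During the
first turn through the circle all bits that the meander looks at strictly below `c` are new. It is
therefore a lazy random walk whose steps go to each adjacent vertex with equal probability, hence
away from the root with a probability of at least `2 / 3`; simultaneous bars end the trial without
failure.
The weights `Status.weight` are submartingales which show that each of `L` given levels has a
probability bounded below to be passed during the first turn, that is, the meander moves on from the
first vertex `u` that it visits there to a child `w` and stays below `w`. Another child `u'` of `u`
then has an unexplored subtree. With a probability of at least `1 / 8` the edge between `u` and `w`
has no bar in the `H + 1` slots that precede the first visit to `u` (`window`). If so, whenever the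
meander returns to `u`, there are `H` slots in which it meets no known bar at `u` but may cross to
`u'` and, by the induction hypothesis, escape from there. Each such escape opportunity (`Rescue`)
reduces the probability of failure by a factor `1 - a`, where `a` does not depend on `n`
(`Setting.guardedBound`). If `L` is large, the opportunities of a good first turn together reduce it
by a factor `1 / 2`, which closes the induction with the same constant `1 / 384`. It is here that
`T` has to be large (`exists_params`): the first turn must be long enough to pass many levels.

*Existence and uniqueness.* On a time interval of length at most `1 / (2 D)`, where `D` bounds the
number of children, the set of descendants reached from a vertex by edges with bars is almost surely
finite (`ae_openBelow_finite`). Hence every vertex lies in a finite set that no bar connects to the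
rest of the tree (`exists_enclosed`), in which finitely many transpositions are to be composed
(`exists_isStirring_of_enclosed`). Processes on successive time intervals are glued together
(`exists_isStirring_of_forall_slot`). Uniqueness holds because almost surely no two bars at a vertex
are simultaneous (`ae_noClash`).
-/

/-! ### Rooted trees with bounded branching -/

/-- A rooted tree in which every vertex has at least two and at most `D` children, encoded by its
parent map, its depth function and its finite sets of children. The parent of the root is a junk
value that is never used: the children of `v` are the vertices `w` with `par w = v` that are one
level deeper than `v`. -/
structure BranchTree (α : Type*) (D : ℕ) where
  /-- The parent of a vertex. -/
  par : α → α
  /-- The distance to the root. -/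
  depth : α → ℕ
  /-- The children of a vertex. -/
  ch : α → Finset α
  mem_ch : ∀ v w, w ∈ ch v ↔ par w = v ∧ depth w = depth v + 1
  two_le_card_ch : ∀ v, 2 ≤ (ch v).card
  card_ch_le : ∀ v, (ch v).card ≤ D

namespace BranchTree

variable {α : Type*} {D : ℕ} (t : BranchTree α D)

/-- `t.Below c v`: the vertex `v` is `c` or a descendant of `c`. -/
inductive Below (c : α) : α → Prop
  | refl : Below c c
  | child {v w : α} : Below c v → w ∈ t.ch v → Below c w

variable {t}

theorem depth_of_mem_ch {v w : α} (h : w ∈ t.ch v) : t.depth w = t.depth v + 1 :=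
  ((t.mem_ch v w).1 h).2

theorem par_of_mem_ch {v w : α} (h : w ∈ t.ch v) : t.par w = v := ((t.mem_ch v w).1 h).1

theorem below_of_mem_ch {v w : α} (h : w ∈ t.ch v) : t.Below v w := Below.child Below.refl h

theorem Below.depth_le {c v : α} (h : t.Below c v) : t.depth c ≤ t.depth v := by
  induction h with
  | refl => exact le_rfl
  | child _ hw ih => have := depth_of_mem_ch hw; omega

theorem Below.trans {a b c : α} (h : t.Below a b) (h' : t.Below b c) : t.Below a c := by
  induction h' with
  | refl => exact h
  | child _ hw ih => exact ih.child hw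

theorem Below.eq_or_par {c v : α} (h : t.Below c v) :
    v = c ∨ (t.Below c (t.par v) ∧ v ∈ t.ch (t.par v)) := by
  cases h with
  | refl => exact Or.inl rfl
  | child h hw => right; rw [par_of_mem_ch hw]; exact ⟨h, hw⟩

theorem Below.below_of_depth_le {a b v : α} (ha : t.Below a v) (hb : t.Below b v)
    (hab : t.depth a ≤ t.depth b) : t.Below a b := by
  induction hb with
  | refl => exact ha
  | child h hw ih =>
    rcases ha.eq_or_par with rfl | ⟨ha', -⟩
    · have := h.depth_le; have := depth_of_mem_ch hw; omega
    · rw [par_of_mem_ch hw] at ha'; exact ih ha'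

theorem Below.eq_of_depth_le {c v : α} (h : t.Below c v) (hd : t.depth v ≤ t.depth c) : v = c := by
  cases h with
  | refl => rfl
  | child h hw => have := h.depth_le; have := depth_of_mem_ch hw; omega

theorem Below.eq_of_depth_eq {a b v : α} (ha : t.Below a v) (hb : t.Below b v)
    (hab : t.depth a = t.depth b) : a = b :=
  ((ha.below_of_depth_le hb hab.le).eq_of_depth_le hab.ge).symm

theorem Below.depth_lt {c v : α} (h : t.Below c v) (hne : v ≠ c) : t.depth c < t.depth v :=
  lt_of_not_ge fun h' => hne (h.eq_of_depth_le h')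

theorem not_mem_ch_self (v : α) : v ∉ t.ch v := fun h => by
  have := depth_of_mem_ch h; omega

variable [DecidableEq α]

variable (t) in
/-- The edges at `v`, each named by its lower endpoint: the vertex `v` itself stands for the edge
to the parent of `v`, and the children of `v` for the edges to them. -/
def edges (v : α) : Finset α := insert v (t.ch v)

variable (t) in
/-- The other endpoint of the edge `z` at `v`. -/
def other (v z : α) : α := if z = v then t.par v else z

theorem mem_edges {v z : α} : z ∈ t.edges v ↔ z = v ∨ z ∈ t.ch v := Finset.mem_insert

theorem card_edges (v : α) : (t.edges v).card = (t.ch v).card + 1 :=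
  Finset.card_insert_of_notMem (not_mem_ch_self v)

theorem other_self (v : α) : t.other v v = t.par v := if_pos rfl

theorem other_of_mem_ch {v z : α} (h : z ∈ t.ch v) : t.other v z = z :=
  if_neg fun h' => not_mem_ch_self v (h' ▸ h)

theorem Below.of_mem_edges {c v z : α} (h : t.Below c v) (hz : z ∈ t.edges v) : t.Below c z := by
  rcases mem_edges.1 hz with rfl | hz
  · exact h
  · exact h.child hz

/-- A step along an edge leaves the subtree of `c` only through the edge from `c` to its parent. -/
theorem Below.other {c v z : α} (h : t.Below c v) (hz : z ∈ t.edges v)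
    (hne : z = v → v ≠ c) : t.Below c (t.other v z) := by
  rcases mem_edges.1 hz with rfl | hz'
  · rw [other_self]
    exact (h.eq_or_par.resolve_left (hne rfl)).1
  · rw [other_of_mem_ch hz']; exact h.child hz'

theorem depth_le_of_mem_edges {v z : α} (h : z ∈ t.edges v) : t.depth z ≤ t.depth v + 1 := by
  rcases mem_edges.1 h with rfl | h
  · omega
  · exact (depth_of_mem_ch h).le

theorem le_depth_of_mem_edges {v z : α} (h : z ∈ t.edges v) : t.depth v ≤ t.depth z := by
  rcases mem_edges.1 h with rfl | h
  · omega
  · have := depth_of_mem_ch h; omega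

end BranchTree

/-! ### Revealing independent bits one at a time -/

section Reveal

variable {β : Type*} [DecidableEq β]

/-- `F` is a conditional expectation given partially known independent bits, each of which is
`true` with probability `p`: for a bit `b` satisfying `P` that is not yet known, `F ρ` is the
average of the values of `F` after `b` is revealed. -/
def IsAveraging (p : ℝ) (P : β → Prop) (F : (β → Option Bool) → ℝ) : Prop :=
  ∀ ρ b, P b → ρ b = none → F ρ = p * F (Function.update ρ b (some true)) +
    (1 - p) * F (Function.update ρ b (some false))

/-- The partial assignment `ρ` after the bits in `U` have been revealed to be given by `g`. -/
def reveal (ρ : β → Option Bool) (U : Finset β) (g : β → Bool) : β → Option Bool :=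
  fun b => if b ∈ U then some (g b) else ρ b

@[simp]
theorem reveal_empty (ρ : β → Option Bool) (g : β → Bool) : reveal ρ ∅ g = ρ := by
  funext b; simp [reveal]

theorem reveal_update {ρ : β → Option Bool} {U : Finset β} {b : β} (hb : b ∉ U) (g : β → Bool)
    (v : Bool) : reveal (Function.update ρ b (some v)) U g =
      reveal ρ (insert b U) (Function.update g b v) := by
  funext x
  by_cases hx : x = b
  · subst hx; simp [reveal, hb]
  · simp [reveal, hx]

variable {p : ℝ} {P : β → Prop} {F : (β → Option Bool) → ℝ}

theorem IsAveraging.le_of_reveal_le (hF : IsAveraging p P F) (hp : 0 ≤ p) (hp1 : p ≤ 1)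
    {U : Finset β} {ρ : β → Option Bool} (hU : ∀ b ∈ U, P b) (hρ : ∀ b ∈ U, ρ b = none) {B : ℝ}
    (h : ∀ g, F (reveal ρ U g) ≤ B) : F ρ ≤ B := by
  induction U using Finset.induction_on generalizing ρ with
  | empty => simpa using h (fun _ => true)
  | insert b U hb ih =>
    rw [hF ρ b (hU b (by simp)) (hρ b (by simp))]
    have key : ∀ v, F (Function.update ρ b (some v)) ≤ B := fun v => by
      refine ih (fun x hx => hU x (by simp [hx])) (fun x hx => ?_) fun g => ?_
      · rw [Function.update_of_ne (ne_of_mem_of_not_mem hx hb)]; exact hρ x (by simp [hx])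
      · rw [reveal_update hb]; exact h _
    nlinarith [key true, key false]

/-- The bits in `U` are all `false` with probability `(1 - p) ^ U.card`. -/
theorem IsAveraging.le_of_reveal_false (hF : IsAveraging p P F) (hp : 0 ≤ p) (hp1 : p ≤ 1)
    {U : Finset β} {ρ : β → Option Bool} (hU : ∀ b ∈ U, P b) (hρ : ∀ b ∈ U, ρ b = none) {x y : ℝ}
    (hx : F (reveal ρ U fun _ => false) ≤ x)
    (hy : ∀ g, (∃ b ∈ U, g b = true) → F (reveal ρ U g) ≤ y) :
    F ρ ≤ (1 - p) ^ U.card * x + (1 - (1 - p) ^ U.card) * y := by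
  induction U using Finset.induction_on generalizing ρ with
  | empty => simpa using hx
  | insert b U hb ih =>
    rw [hF ρ b (hU b (by simp)) (hρ b (by simp))]
    have hne : ∀ v, ∀ x ∈ U, Function.update ρ b (some v) x = none := fun v x hx => by
      rw [Function.update_of_ne (ne_of_mem_of_not_mem hx hb)]; exact hρ x (by simp [hx])
    have h1 : F (Function.update ρ b (some true)) ≤ y := by
      refine hF.le_of_reveal_le hp hp1 (fun x hx => hU x (by simp [hx])) (hne true) fun g => ?_
      rw [reveal_update hb]; exact hy _ ⟨b, by simp, by simp⟩
    have h2 := ih (fun x hx => hU x (by simp [hx])) (hne false)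
      (by
        rw [reveal_update hb]
        convert hx using 3
        exact Function.update_eq_self_iff.2 rfl)
      (fun g ⟨c, hc, hg⟩ => by
        rw [reveal_update hb]
        exact hy _ ⟨c, by simp [hc], by rwa [Function.update_of_ne (ne_of_mem_of_not_mem hc hb)]⟩)
    rw [Finset.card_insert_of_notMem hb, pow_succ]
    have := mul_le_mul_of_nonneg_left h2 (sub_nonneg.2 hp1)
    have := mul_le_mul_of_nonneg_left h1 hp
    linarith

/-- A one-step bound in which only the outcomes with at most one `true` bit contribute. -/
theorem IsAveraging.le_of_reveal_one (hF : IsAveraging p P F) (hp : 0 ≤ p) (hp1 : p ≤ 1)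
    {U : Finset β} {ρ : β → Option Bool} (hU : ∀ b ∈ U, P b) (hρ : ∀ b ∈ U, ρ b = none)
    {x₀ : ℝ} {x : β → ℝ} (h₀ : F (reveal ρ U fun _ => false) ≤ x₀)
    (h₁ : ∀ b ∈ U, F (reveal ρ U fun c => decide (c = b)) ≤ x b)
    (h₂ : ∀ g, (∃ b ∈ U, ∃ c ∈ U, b ≠ c ∧ g b = true ∧ g c = true) → F (reveal ρ U g) ≤ 0) :
    F ρ ≤ (1 - p) ^ U.card * x₀ + ∑ b ∈ U, p * (1 - p) ^ (U.card - 1) * x b := by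
  induction U using Finset.induction_on generalizing ρ with
  | empty => simpa using h₀
  | insert b U hb ih =>
    rw [hF ρ b (hU b (by simp)) (hρ b (by simp))]
    have hne : ∀ v, ∀ x ∈ U, Function.update ρ b (some v) x = none := fun v x hx => by
      rw [Function.update_of_ne (ne_of_mem_of_not_mem hx hb)]; exact hρ x (by simp [hx])
    have hbne : ∀ x ∈ U, x ≠ b := fun x hx => ne_of_mem_of_not_mem hx hb
    have hU' : ∀ x ∈ U, P x := fun x hx => hU x (by simp [hx])
    have h1 : F (Function.update ρ b (some true)) ≤
        (1 - p) ^ U.card * x b + (1 - (1 - p) ^ U.card) * 0 := by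
      refine hF.le_of_reveal_false hp hp1 hU' (hne true) ?_ fun g ⟨c, hc, hg⟩ => ?_
      · rw [reveal_update hb]
        convert h₁ b (by simp) using 3
        funext c
        by_cases h : c = b
        · subst h; simp
        · simp [h]
      · rw [reveal_update hb]
        exact h₂ _ ⟨b, by simp, c, by simp [hc], (hbne c hc).symm, by simp, by
          rwa [Function.update_of_ne (hbne c hc)]⟩
    have h2 := ih hU' (hne false)
      (by
        rw [reveal_update hb]
        convert h₀ using 3
        exact Function.update_eq_self_iff.2 rfl)
      (fun c hc => by
        rw [reveal_update hb]
        convert h₁ c (by simp [hc]) using 3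
        refine Function.update_eq_self_iff.2 ?_
        simp [(hbne c hc).symm])
      (fun g ⟨c, hc, e, he, hce, hgc, hge⟩ => by
        rw [reveal_update hb]
        exact h₂ _ ⟨c, by simp [hc], e, by simp [he], hce, by
          rwa [Function.update_of_ne (hbne c hc)], by rwa [Function.update_of_ne (hbne e he)]⟩)
    rw [Finset.card_insert_of_notMem hb, Finset.sum_insert hb, pow_succ, Nat.add_sub_cancel]
    have e1 := mul_le_mul_of_nonneg_left h2 (sub_nonneg.2 hp1)
    have e2 := mul_le_mul_of_nonneg_left h1 hp
    have e3 : (1 - p) * ∑ c ∈ U, p * (1 - p) ^ (U.card - 1) * x c =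
        ∑ c ∈ U, p * (1 - p) ^ U.card * x c := by
      rw [Finset.mul_sum]
      refine Finset.sum_congr rfl fun c hc => ?_
      obtain ⟨m, hm⟩ : ∃ m, U.card = m + 1 :=
        Nat.exists_eq_succ_of_ne_zero (Finset.card_ne_zero_of_mem hc)
      rw [hm, Nat.add_sub_cancel, pow_succ]; ring
    linarith

end Reveal

/-! ### The discrete meander and its failure probabilities -/

theorem reveal_congr {β : Type*} [DecidableEq β] {ρ : β → Option Bool} {U : Finset β}
    {g g' : β → Bool} (h : ∀ b ∈ U, g b = g' b) : reveal ρ U g = reveal ρ U g' := by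
  funext b
  by_cases hb : b ∈ U
  · simp [reveal, hb, h b hb]
  · simp [reveal, hb]

theorem eq_some_false_of_ne {o : Option Bool} (h : o ≠ none) (h' : o ≠ some true) :
    o = some false := by
  rcases o with _ | _ | _
  · exact absurd rfl h
  · rfl
  · exact absurd rfl h'

namespace BranchTree

variable {α : Type*} {D : ℕ} [DecidableEq α] {t : BranchTree α D}
  {S : Type*} [DecidableEq S]

/-- The rules that govern the conditional probability `V N ρ v j`, given the partial information
`ρ` about the bits, that the meander at the vertex `v` at the beginning of the time slot `j` leaves
the subtree of `top` within its next `N` steps, before it reaches the depth `n` and before it meets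
two simultaneous bars. The bit `(z, j)` tells whether the edge from `z` to its parent carries a bar
in the slot `j`, where the slots are the elements of `S` and the slot after `j` is `j + 1`. Each bit
is `true` with probability `p`. -/
structure FailValue [AddCommGroupWithOne S] (t : BranchTree α D) (p : ℝ) (n : ℕ) (top : α)
    (V : ℕ → (α × S → Option Bool) → α → S → ℝ) : Prop where
  nonneg : ∀ N ρ v j, 0 ≤ V N ρ v j
  le_one : ∀ N ρ v j, V N ρ v j ≤ 1
  averaging : ∀ N v j, IsAveraging p (fun b => t.Below top b.1 ∧ t.depth b.1 ≤ n)
    (fun ρ => V N ρ v j)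
  deep : ∀ N ρ v j, t.Below top v → n ≤ t.depth v → V N ρ v j ≤ 0
  zero : ∀ ρ v j, t.Below top v → V 0 ρ v j ≤ 0
  stay : ∀ N ρ v j, t.Below top v → t.depth v < n → (∀ z ∈ t.edges v, ρ (z, j) = some false) →
    V (N + 1) ρ v j ≤ V N ρ v (j + 1)
  cross : ∀ N ρ v j, t.Below top v → t.depth v < n → ∀ z ∈ t.edges v, ρ (z, j) = some true →
    (∀ z' ∈ t.edges v, z' ≠ z → ρ (z', j) = some false) →
    V (N + 1) ρ v j ≤ V N ρ (t.other v z) (j + 1)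
  clash : ∀ N ρ v j, t.Below top v → t.depth v < n → ∀ z ∈ t.edges v, ∀ z' ∈ t.edges v, z ≠ z' →
    ρ (z, j) = some true → ρ (z', j) = some true → V (N + 1) ρ v j ≤ 0

/-- The edges at `v` whose bits in the slot `j` are not yet known. -/
def unseen (t : BranchTree α D) (ρ : α × S → Option Bool) (v : α) (j : S) : Finset α :=
  (t.edges v).filter fun z => ρ (z, j) = none

/-- The information after the bits in the slot `j` of all edges at `v` have been revealed; those
that were not known before are given by `g`. -/
def look (t : BranchTree α D) (ρ : α × S → Option Bool) (v : α) (j : S) (g : α → Bool) :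
    α × S → Option Bool :=
  reveal ρ (t.unseen ρ v j ×ˢ ({j} : Finset S)) fun b => g b.1

variable {ρ : α × S → Option Bool} {v z : α} {j : S} {g : α → Bool}

theorem look_eq_of_ne_none {b : α × S} (h : ρ b ≠ none) : t.look ρ v j g b = ρ b := by
  refine if_neg fun hb => h ?_
  obtain ⟨h1, h2⟩ := Finset.mem_product.1 hb
  rw [Finset.mem_singleton] at h2
  have := (Finset.mem_filter.1 h1).2
  rwa [← h2] at this

theorem look_eq_of_notMem {b : α × S} (h : b.1 ∉ t.edges v) :
    t.look ρ v j g b = ρ b :=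
  if_neg fun hb => h (Finset.mem_filter.1 (Finset.mem_product.1 hb).1).1

theorem look_eq_of_ne_slot {b : α × S} (h : b.2 ≠ j) :
    t.look ρ v j g b = ρ b :=
  if_neg fun hb => h (Finset.mem_singleton.1 (Finset.mem_product.1 hb).2)

theorem look_eq_of_eq_none (hz : z ∈ t.edges v) (h : ρ (z, j) = none) :
    t.look ρ v j g (z, j) = some (g z) :=
  if_pos (Finset.mem_product.2 ⟨Finset.mem_filter.2 ⟨hz, h⟩, Finset.mem_singleton.2 rfl⟩)

theorem look_ne_none (hz : z ∈ t.edges v) : t.look ρ v j g (z, j) ≠ none := by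
  by_cases h : ρ (z, j) = none
  · rw [look_eq_of_eq_none hz h]; simp
  · rwa [look_eq_of_ne_none h]

/-- Looking from `v` reveals nothing about a bit unless it belongs to an edge at `v` in the slot
`j`. -/
theorem mem_edges_of_look_ne {b : α × S} (h : t.look ρ v j g b ≠ ρ b) :
    b.1 ∈ t.edges v ∧ b.2 = j := by
  refine ⟨?_, ?_⟩ <;> by_contra h'
  · exact h (look_eq_of_notMem h')
  · exact h (look_eq_of_ne_slot h')

variable {p : ℝ} {n : ℕ} {top : α} {V : ℕ → (α × S → Option Bool) → α → S → ℝ}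

namespace FailValue

variable [AddCommGroupWithOne S]

omit [DecidableEq S] [AddCommGroupWithOne S] in
theorem averaging_unseen (hv : t.Below top v) (hd : t.depth v < n) :
    ∀ b ∈ t.unseen ρ v j ×ˢ ({j} : Finset S), (t.Below top b.1 ∧ t.depth b.1 ≤ n) ∧ ρ b = none := by
  intro b hb
  obtain ⟨h1, h2⟩ := Finset.mem_product.1 hb
  rw [Finset.mem_singleton] at h2
  obtain ⟨h3, h4⟩ := Finset.mem_filter.1 h1
  refine ⟨⟨hv.of_mem_edges h3, ?_⟩, ?_⟩
  · have := depth_le_of_mem_edges h3; omega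
  · rwa [← h2] at h4

/-- One step of the meander, when no bar at its vertex is known in the present slot. -/
theorem step_le (hV : FailValue t p n top V) (hp : 0 ≤ p) (hp1 : p ≤ 1) (hv : t.Below top v)
    (hd : t.depth v < n) (hρ : ∀ z ∈ t.edges v, ρ (z, j) ≠ some true) {N : ℕ} {x₀ : ℝ} {x : α → ℝ}
    (h₀ : V N (t.look ρ v j fun _ => false) v (j + 1) ≤ x₀)
    (h₁ : ∀ z ∈ t.unseen ρ v j,
      V N (t.look ρ v j fun c => decide (c = z)) (t.other v z) (j + 1) ≤ x z) :
    V (N + 1) ρ v j ≤ (1 - p) ^ (t.unseen ρ v j).card * x₀ +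
      ∑ z ∈ t.unseen ρ v j, p * (1 - p) ^ ((t.unseen ρ v j).card - 1) * x z := by
  have hU := averaging_unseen (ρ := ρ) (j := j) hv hd
  have key := (hV.averaging (N + 1) v j).le_of_reveal_one hp hp1
    (U := t.unseen ρ v j ×ˢ ({j} : Finset S)) (ρ := ρ) (fun b hb => (hU b hb).1)
    (fun b hb => (hU b hb).2)
    (x₀ := x₀) (x := fun b => x b.1) ?_ ?_ ?_
  · simpa [Finset.sum_product] using key
  · refine (hV.stay N _ v j hv hd fun z hz => ?_).trans h₀
    change t.look ρ v j (fun _ => false) (z, j) = _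
    by_cases h : ρ (z, j) = none
    · exact look_eq_of_eq_none hz h
    · rw [look_eq_of_ne_none h]
      exact eq_some_false_of_ne h (hρ z hz)
  · intro b hb
    obtain ⟨z, i⟩ := b
    obtain ⟨hz, hi⟩ := Finset.mem_product.1 hb
    rw [Finset.mem_singleton] at hi
    change i = j at hi
    subst hi
    have hz' := Finset.mem_filter.1 hz
    have e : reveal ρ (t.unseen ρ v i ×ˢ ({i} : Finset S)) (fun c => decide (c = (z, i))) =
        t.look ρ v i fun c => decide (c = z) := by
      refine reveal_congr fun b hb => ?_
      have := (Finset.mem_product.1 hb).2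
      rw [Finset.mem_singleton] at this
      simp [Prod.ext_iff, this]
    rw [e]
    refine (hV.cross N _ v i hv hd z hz'.1 ?_ fun z' hz1 hne => ?_).trans (h₁ z hz)
    · rw [look_eq_of_eq_none hz'.1 hz'.2]; simp
    · by_cases h : ρ (z', i) = none
      · rw [look_eq_of_eq_none hz1 h]; simp [hne]
      · rw [look_eq_of_ne_none h]
        exact eq_some_false_of_ne h (hρ z' hz1)
  · rintro g ⟨⟨z, i⟩, hb, ⟨z', i'⟩, hc, hne, hgb, hgc⟩
    have hi := Finset.mem_singleton.1 (Finset.mem_product.1 hb).2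
    have hi' := Finset.mem_singleton.1 (Finset.mem_product.1 hc).2
    change i = j at hi
    change i' = j at hi'
    subst hi; subst hi'
    refine hV.clash N _ v i' hv hd z (Finset.mem_filter.1 (Finset.mem_product.1 hb).1).1 z'
      (Finset.mem_filter.1 (Finset.mem_product.1 hc).1).1 (fun h => hne (by rw [h])) ?_ ?_
    · simp only [reveal, if_pos hb, hgb]
    · simp only [reveal, if_pos hc, hgc]

/-- A bound on the failure probability that holds after a step of the meander, whatever that step
is, holds before it. -/
theorem le_of_step_le (hV : FailValue t p n top V) (hp : 0 ≤ p) (hp1 : p ≤ 1)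
    (hv : t.Below top v) (hd : t.depth v < n) {N : ℕ} {B : ℝ} (hB : 0 ≤ B)
    (h₀ : ∀ g, (∀ z ∈ t.edges v, t.look ρ v j g (z, j) = some false) →
      V N (t.look ρ v j g) v (j + 1) ≤ B)
    (h₁ : ∀ g, ∀ z ∈ t.edges v, t.look ρ v j g (z, j) = some true →
      (∀ z' ∈ t.edges v, z' ≠ z → t.look ρ v j g (z', j) = some false) →
      V N (t.look ρ v j g) (t.other v z) (j + 1) ≤ B) :
    V (N + 1) ρ v j ≤ B := by
  have hU := averaging_unseen (ρ := ρ) (j := j) hv hd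
  refine (hV.averaging (N + 1) v j).le_of_reveal_le hp hp1
    (U := t.unseen ρ v j ×ˢ ({j} : Finset S)) (ρ := ρ) (fun b hb => (hU b hb).1)
    (fun b hb => (hU b hb).2)
    fun g => ?_
  have e : reveal ρ (t.unseen ρ v j ×ˢ ({j} : Finset S)) g = t.look ρ v j fun z => g (z, j) := by
    refine reveal_congr fun b hb => ?_
    have := (Finset.mem_product.1 hb).2
    rw [Finset.mem_singleton] at this
    rw [← this]
  rw [e]
  set g' : α → Bool := fun z => g (z, j)
  have hbool : ∀ z ∈ t.edges v, t.look ρ v j g' (z, j) ≠ some true →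
      t.look ρ v j g' (z, j) = some false := fun z hz hne =>
    eq_some_false_of_ne (look_ne_none hz) hne
  by_cases h : ∃ z ∈ t.edges v, t.look ρ v j g' (z, j) = some true
  · obtain ⟨z, hz, hzt⟩ := h
    by_cases h' : ∃ z' ∈ t.edges v, z' ≠ z ∧ t.look ρ v j g' (z', j) = some true
    · obtain ⟨z', hz', hne, hzt'⟩ := h'
      exact (hV.clash N _ v j hv hd z' hz' z hz hne hzt' hzt).trans hB
    · push Not at h'
      have h'' := fun z' hz' hne => hbool z' hz' (h' z' hz' hne)
      exact (hV.cross N _ v j hv hd z hz hzt h'').trans (h₁ g' z hz hzt h'')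
  · push Not at h
    have h'' := fun z hz => hbool z hz (h z hz)
    exact (hV.stay N _ v j hv hd h'').trans (h₀ g' h'')

end FailValue

end BranchTree

/-! ### Escape opportunities along the path to the meander -/

namespace BranchTree

variable {α : Type*} {D : ℕ} [DecidableEq α] {t : BranchTree α D}
  {S : Type*} [DecidableEq S] [AddCommGroupWithOne S]

/-- The meander, which is in the subtree of the child `w` of `u`, has an escape opportunity at `u`:
another child `u'` of `u` has a completely unexplored subtree and, whenever the meander returns
from `w` to `u`, no known bar at `u` is in its way for the next `H` slots, during which a bar
leading to `u'` may appear. -/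
structure Rescue (t : BranchTree α D) (H : ℕ) (ρ : α × S → Option Bool) (u w u' : α) : Prop where
  mem : w ∈ t.ch u
  mem' : u' ∈ t.ch u
  ne : u' ≠ w
  fresh : ∀ z, t.Below u' z → z ≠ u' → ∀ j, ρ (z, j) = none
  off : ∀ j, ρ (u', j) ≠ some true
  gap : ∀ j, ρ (w, j) = some false ∨ ∀ k : ℕ, 1 ≤ k → k ≤ H →
    ρ (u', j + k) = none ∧ ∀ z ∈ t.edges u, ρ (z, j + k) ≠ some true

/-- The path from `c` to `v` passes through the escape opportunities listed in `l`, the one that is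
closest to `v` first. -/
def Guarded (t : BranchTree α D) (H : ℕ) (ρ : α × S → Option Bool) (c : α) :
    List (α × α × α) → α → Prop
  | [], v => t.Below c v
  | (u, w, u') :: l, v => t.Rescue H ρ u w u' ∧ t.Below w v ∧ Guarded t H ρ c l u

variable {H : ℕ} {ρ ρ' : α × S → Option Bool} {c u w u' v z : α} {j : S} {g : α → Bool}
  {l : List (α × α × α)}

omit [DecidableEq S] [AddCommGroupWithOne S] in
/-- Vertices strictly below `w` are far from `u` and from the subtree of a sibling of `w`. -/
theorem not_mem_of_strictBelow (hw : w ∈ t.ch u) (hu' : u' ∈ t.ch u) (hne : u' ≠ w)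
    (hz : t.Below w z) (hzw : z ≠ w) : z ∉ t.edges u ∧ ¬ t.Below u' z := by
  have h1 := depth_of_mem_ch hw
  have h2 := depth_of_mem_ch hu'
  have h3 := hz.depth_lt hzw
  refine ⟨fun h => ?_, fun h => hne (h.eq_of_depth_eq hz (by omega))⟩
  have := depth_le_of_mem_edges h
  omega

omit [DecidableEq S] in
theorem Rescue.congr (h : t.Rescue H ρ u w u')
    (hρ : ∀ b, ρ' b ≠ ρ b → b.1 ∉ t.edges u ∧ ¬ t.Below u' b.1) : t.Rescue H ρ' u w u' := by
  have hE : ∀ z ∈ t.edges u, ∀ j, ρ' (z, j) = ρ (z, j) := fun z hz j => by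
    by_contra h'; exact (hρ _ h').1 hz
  have hB : ∀ z, t.Below u' z → ∀ j, ρ' (z, j) = ρ (z, j) := fun z hz j => by
    by_contra h'; exact (hρ _ h').2 hz
  refine ⟨h.mem, h.mem', h.ne, fun z hz hne j => ?_, fun j => ?_, fun j => ?_⟩
  · rw [hB z hz]; exact h.fresh z hz hne j
  · rw [hB u' .refl]; exact h.off j
  · rw [hE w (mem_edges.2 (Or.inr h.mem))]
    refine (h.gap j).imp id fun h' k h1 hk => ?_
    rw [hB u' .refl]
    refine ⟨(h' k h1 hk).1, fun z hz => ?_⟩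
    rw [hE z hz]
    exact (h' k h1 hk).2 z hz

omit [DecidableEq S] in
theorem Guarded.below (h : t.Guarded H ρ c l v) : t.Below c v := by
  induction l generalizing v with
  | nil => exact h
  | cons x l ih =>
    obtain ⟨u, w, u'⟩ := x
    exact (ih h.2.2).trans ((below_of_mem_ch h.1.mem).trans h.2.1)

omit [DecidableEq S] in
theorem Guarded.trans (h : t.Guarded H ρ c l u) (hv : t.Below u v) : t.Guarded H ρ c l v := by
  cases l with
  | nil => exact Below.trans h hv
  | cons x l =>
    obtain ⟨u, w, u'⟩ := x
    exact ⟨h.1, h.2.1.trans hv, h.2.2⟩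

omit [DecidableEq S] in
/-- New information on edges strictly below the current vertex does not matter. -/
theorem Guarded.congr (h : t.Guarded H ρ c l u)
    (hρ : ∀ b, ρ' b ≠ ρ b → t.Below u b.1 ∧ b.1 ≠ u) : t.Guarded H ρ' c l u := by
  induction l generalizing u with
  | nil => exact h
  | cons x l ih =>
    obtain ⟨u₂, w, u'⟩ := x
    obtain ⟨h1, h2, h3⟩ := h
    have hs : ∀ b, ρ' b ≠ ρ b → t.Below w b.1 ∧ b.1 ≠ w := fun b hb => by
      obtain ⟨h4, h5⟩ := hρ b hb
      refine ⟨h2.trans h4, fun h6 => ?_⟩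
      have e1 := h4.depth_lt h5
      have e2 := h2.depth_le
      rw [h6] at e1; omega
    refine ⟨h1.congr fun b hb => ?_, h2, ih h3 fun b hb => ?_⟩
    · exact not_mem_of_strictBelow h1.mem h1.mem' h1.ne (hs b hb).1 (hs b hb).2
    · refine ⟨(below_of_mem_ch h1.mem).trans (hs b hb).1, fun h6 => ?_⟩
      have e1 := (hs b hb).1.depth_le
      have e2 := depth_of_mem_ch h1.mem
      rw [h6] at e1; omega

/-- An escape opportunity persists until the meander returns through the edge `w`. -/
theorem Rescue.look (h : t.Rescue H ρ u w u') (hv : t.Below w v)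
    (hw : v = w → t.look ρ v j g (w, j) ≠ some true) : t.Rescue H (t.look ρ v j g) u w u' := by
  have hch : ∀ b, t.look ρ v j g b ≠ ρ b → ¬ t.Below u' b.1 ∧ (b.1 ∈ t.edges u → b = (w, j) ∧
      v = w) := fun b hb => by
    obtain ⟨h1, h2⟩ := mem_edges_of_look_ne hb
    have h3 := hv.of_mem_edges h1
    have e1 := depth_of_mem_ch h.mem
    have e2 := depth_of_mem_ch h.mem'
    refine ⟨fun h4 => h.ne (h4.eq_of_depth_eq h3 (by omega)), fun h4 => ?_⟩
    have h5 : b.1 = w := by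
      by_contra h5
      exact (not_mem_of_strictBelow h.mem h.mem' h.ne h3 h5).1 h4
    refine ⟨Prod.ext h5 h2, ?_⟩
    refine hv.eq_of_depth_le ?_
    have := le_depth_of_mem_edges h1
    rwa [h5] at this
  have hB : ∀ z, t.Below u' z → ∀ i, t.look ρ v j g (z, i) = ρ (z, i) := fun z hz i => by
    by_contra h'; exact (hch _ h').1 hz
  refine ⟨h.mem, h.mem', h.ne, fun z hz hne i => ?_, fun i => ?_, fun i => ?_⟩
  · rw [hB z hz]; exact h.fresh z hz hne i
  · rw [hB u' .refl]; exact h.off i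
  · refine (h.gap i).imp (fun h' => ?_) fun h' k h1 hk => ?_
    · rw [look_eq_of_ne_none (by rw [h']; simp), h']
    · rw [hB u' .refl]
      refine ⟨(h' k h1 hk).1, fun z hz => ?_⟩
      by_cases hzz : t.look ρ v j g (z, i + k) = ρ (z, i + k)
      · rw [hzz]; exact (h' k h1 hk).2 z hz
      · obtain ⟨h5, h6⟩ := (hch _ hzz).2 hz
        rw [h5]; exact hw h6

theorem Guarded.look_tail (h : t.Guarded H ρ c l u) (hw : w ∈ t.ch u) (hv : t.Below w v) :
    t.Guarded H (t.look ρ v j g) c l u := by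
  refine h.congr fun b hb => ?_
  have h3 := hv.of_mem_edges (mem_edges_of_look_ne hb).1
  refine ⟨(below_of_mem_ch hw).trans h3, fun h6 => ?_⟩
  have e1 := h3.depth_le
  have e2 := depth_of_mem_ch hw
  rw [h6] at e1; omega

theorem Guarded.look (h : t.Guarded H ρ c l v) (hs : t.look ρ v j g (v, j) ≠ some true) :
    t.Guarded H (t.look ρ v j g) c l v := by
  cases l with
  | nil => exact h
  | cons x l =>
    obtain ⟨u, w, u'⟩ := x
    refine ⟨h.1.look h.2.1 ?_, h.2.1, h.2.2.look_tail h.1.mem h.2.1⟩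
    rintro rfl
    exact hs

theorem Guarded.cross {x : α × α × α} (h : t.Guarded H ρ c (x :: l) v) (hz : z ∈ t.edges v)
    (hs : ∀ z' ∈ t.edges v, z' ≠ z → t.look ρ v j g (z', j) = some false)
    (hne : z = v → v ≠ x.2.1) : t.Guarded H (t.look ρ v j g) c (x :: l) (t.other v z) := by
  obtain ⟨u, w, u'⟩ := x
  refine ⟨h.1.look h.2.1 ?_, h.2.1.other hz hne, h.2.2.look_tail h.1.mem h.2.1⟩
  rintro rfl
  rw [hs v (mem_edges.2 (Or.inl rfl)) fun h' => hne h'.symm rfl]; simp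

variable {p : ℝ} {n : ℕ} {top : α} {V : ℕ → (α × S → Option Bool) → α → S → ℝ}

/-- Starting at the root of the subtree of `c`, of which nothing is known except that the parent
edge of `c` carries no known bar other than possibly one just before the start, the meander fails
with probability at most `1 - q` times its failure probability upon leaving the subtree. -/
def EscapeBound (t : BranchTree α D) (V : ℕ → (α × S → Option Bool) → α → S → ℝ) (q : ℝ) (c : α) :
    Prop :=
  ∀ N ρ s y, 0 ≤ y → (∀ z, t.Below c z → z ≠ c → ∀ j, ρ (z, j) = none) →
    (∀ j, ρ (c, j) = some true → j + 1 = s) →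
    (∀ N ρ' j, (∀ b : α × S, ¬ t.Below c b.1 → ρ' b = ρ b) → V N ρ' (t.par c) j ≤ y) →
    V N ρ c s ≤ (1 - q) * y

/-- A lower bound for the probability to escape within `k` slots at an escape opportunity. -/
def rescueProb (D : ℕ) (p q : ℝ) (k : ℕ) : ℝ := q * (k * (p * (1 - p) ^ ((D + 1) * k)))

theorem rescueProb_succ_le (hp : 0 ≤ p) (hp1 : p ≤ 1) {q : ℝ} (hq : 0 ≤ q) (k : ℕ)
    {m : ℕ} (hm : 1 ≤ m) (hmD : m ≤ D + 1) :
    rescueProb D p q (k + 1) ≤ (1 - p) ^ m * rescueProb D p q k + p * (1 - p) ^ (m - 1) * q := by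
  unfold rescueProb
  have h0 : 0 ≤ 1 - p := by linarith
  have h1 : 1 - p ≤ 1 := by linarith
  have e1 : (1 - p) ^ ((D + 1) * (k + 1)) ≤ (1 - p) ^ m * (1 - p) ^ ((D + 1) * k) := by
    rw [← pow_add]
    exact pow_le_pow_of_le_one h0 h1 (by rw [mul_add]; omega)
  have e2 : (1 - p) ^ ((D + 1) * (k + 1)) ≤ (1 - p) ^ (m - 1) :=
    pow_le_pow_of_le_one h0 h1 (by rw [mul_add]; omega)
  have e3 := mul_le_mul_of_nonneg_left e1 (show 0 ≤ q * (k * p) by positivity)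
  have e4 := mul_le_mul_of_nonneg_left e2 (show 0 ≤ q * p by positivity)
  push_cast
  nlinarith

theorem pow_add_mul_le_one (hp : 0 ≤ p) (hp1 : p ≤ 1) (m : ℕ) :
    (1 - p) ^ m + m * (p * (1 - p) ^ (m - 1)) ≤ 1 := by
  induction m with
  | zero => simp
  | succ m ih =>
    have h0 : 0 ≤ (1 - p) ^ m := pow_nonneg (by linarith) m
    have h1 : (1 - p) ^ m ≤ 1 := pow_le_one₀ (by linarith) (by linarith)
    rcases m with _ | m
    · simp
    · simp only [Nat.add_sub_cancel] at ih ⊢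
      push_cast at ih ⊢
      rw [pow_succ] at h0 h1 ih ⊢
      rw [pow_succ]
      nlinarith [mul_le_mul_of_nonneg_left ih (show 0 ≤ 1 - p by linarith)]

section Phase

variable {q a y : ℝ} {M : ℕ} [CharP S M] {ρ₀ : α × S → Option Bool}

/-- The setting in which the escape opportunities inside the subtree of `c` are exploited: escape
bounds hold strictly inside this subtree, and `y` bounds the failure probability once it has been
left, given any information that extends `ρ₀` by bits inside this subtree. -/
structure Setting (t : BranchTree α D) (M H n : ℕ) (p q a y : ℝ) (top c : α)
    (V : ℕ → (α × S → Option Bool) → α → S → ℝ) (ρ₀ : α × S → Option Bool) : Prop where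
  failValue : FailValue t p n top V
  p_nonneg : 0 ≤ p
  p_le_one : p ≤ 1
  q_nonneg : 0 ≤ q
  q_le_one : q ≤ 1
  a_le_one : a ≤ 1
  y_nonneg : 0 ≤ y
  lt : H < M
  a_le : a ≤ rescueProb D p q H
  below : t.Below top c
  escape : ∀ c', t.Below c c' → c' ≠ c → EscapeBound t V q c'
  exit : ∀ N ρ j, (∀ b, ¬ t.Below c b.1 → ρ b = ρ₀ b) → V N ρ (t.par c) j ≤ y

variable {N : ℕ}

omit [DecidableEq S] [AddCommGroupWithOne S] in
theorem agree_look [DecidableEq S] (hag : ∀ b, ¬ t.Below c b.1 → ρ b = ρ₀ b) (hv : t.Below c v) :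
    ∀ b, ¬ t.Below c b.1 → t.look ρ v j g b = ρ₀ b := fun b hb => by
  rw [look_eq_of_notMem fun h => hb (hv.of_mem_edges h)]
  exact hag b hb

omit [DecidableEq S] in
theorem add_natCast_ne (M : ℕ) [CharP S M] (j : S) {k : ℕ} (hk : 1 ≤ k) (hkM : k < M) :
    j + k ≠ j := fun h => by
  have h' : (k : S) = 0 := by simpa using h
  have := Nat.le_of_dvd hk ((CharP.cast_eq_zero_iff S M k).1 h')
  omega

/-- The failure probability after a step of the meander that starts with the escape opportunities
`l` is at most `(1 - a) ^ l.length * y`. -/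
def AfterBound (t : BranchTree α D) (H n : ℕ) (a y : ℝ) (c : α)
    (V : ℕ → (α × S → Option Bool) → α → S → ℝ) (ρ₀ : α × S → Option Bool)
    (l : List (α × α × α)) (N : ℕ) : Prop :=
  ∀ ρ v j g, (∀ b : α × S, ¬ t.Below c b.1 → ρ b = ρ₀ b) → t.Guarded H ρ c l v → t.depth v < n →
    ((∀ z ∈ t.edges v, t.look ρ v j g (z, j) = some false) →
      V N (t.look ρ v j g) v (j + 1) ≤ (1 - a) ^ l.length * y) ∧
    ∀ z ∈ t.edges v, t.look ρ v j g (z, j) = some true →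
      (∀ z' ∈ t.edges v, z' ≠ z → t.look ρ v j g (z', j) = some false) →
      V N (t.look ρ v j g) (t.other v z) (j + 1) ≤ (1 - a) ^ l.length * y

/-- With the escape opportunities `l`, the failure probability is at most
`(1 - a) ^ l.length * y`. -/
def GuardedBound (t : BranchTree α D) (H : ℕ) (a y : ℝ) (c : α)
    (V : ℕ → (α × S → Option Bool) → α → S → ℝ) (ρ₀ : α × S → Option Bool)
    (l : List (α × α × α)) (N : ℕ) : Prop :=
  ∀ ρ v j, (∀ b : α × S, ¬ t.Below c b.1 → ρ b = ρ₀ b) → t.Guarded H ρ c l v →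
    V N ρ v j ≤ (1 - a) ^ l.length * y

omit [CharP S M] in
theorem Setting.bound_nonneg (hS : Setting t M H n p q a y top c V ρ₀) (k : ℕ) :
    0 ≤ (1 - a) ^ k * y :=
  mul_nonneg (pow_nonneg (sub_nonneg.2 hS.a_le_one) _) hS.y_nonneg

/-- The escape attempt at `u`: within the next `k` slots the meander may cross to the unexplored
child `u'` of `u` and escape from there. -/
theorem Setting.rescue_le (hS : Setting t M H n p q a y top c V ρ₀)
    (hA : ∀ N, AfterBound t H n a y c V ρ₀ l N) (hG : ∀ N, GuardedBound t H a y c V ρ₀ l N)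
    {k : ℕ} (hk : k ≤ H)
    (hag : ∀ b, ¬ t.Below c b.1 → ρ b = ρ₀ b) (hu : t.Guarded H ρ c l u) (hu' : u' ∈ t.ch u)
    (hfresh : ∀ z, t.Below u' z → z ≠ u' → ∀ j, ρ (z, j) = none)
    (hoff : ∀ j, ρ (u', j) ≠ some true)
    (hfree : ∀ i : ℕ, i < k → ρ (u', j + i) = none ∧ ∀ z ∈ t.edges u, ρ (z, j + i) ≠ some true) :
    V N ρ u j ≤ (1 - rescueProb D p q k) * ((1 - a) ^ l.length * y) := by
  induction k generalizing N ρ j with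
  | zero => simpa [rescueProb] using hG N ρ u j hag hu
  | succ k ih =>
    have hVf := hS.failValue
    have hp := hS.p_nonneg
    have hp1 := hS.p_le_one
    have hq := hS.q_nonneg
    have hY := hS.bound_nonneg l.length
    set Y := (1 - a) ^ l.length * y with hYdef
    have hub : t.Below c u := hu.below
    have hut : t.Below top u := hS.below.trans hub
    have hU1 : u' ∈ t.unseen ρ u j := by
      refine Finset.mem_filter.2 ⟨mem_edges.2 (Or.inr hu'), ?_⟩
      simpa using (hfree 0 (by omega)).1
    have hcard1 : 1 ≤ (t.unseen ρ u j).card := Finset.card_pos.2 ⟨u', hU1⟩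
    have hcard2 : (t.unseen ρ u j).card ≤ D + 1 := by
      refine (Finset.card_filter_le _ _).trans ?_
      rw [card_edges]
      exact Nat.add_le_add_right (t.card_ch_le u) 1
    have hA1 : 0 ≤ 1 - rescueProb D p q (k + 1) := by
      have e1 : (1 - p) ^ ((D + 1) * (k + 1)) ≤ (1 - p) ^ (k + 1) :=
        pow_le_pow_of_le_one (by linarith) (by linarith) (by nlinarith)
      -- Bernoulli's inequality in the form `m * p * (1 - p) ^ m ≤ 1`
      have e2 : ((k + 1 : ℕ) : ℝ) * p * (1 - p) ^ (k + 1) ≤ 1 := by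
        have b1 := one_add_mul_le_pow (show (-2 : ℝ) ≤ p by linarith) (k + 1)
        have b2 : (1 + p) ^ (k + 1) * (1 - p) ^ (k + 1) ≤ 1 := by
          rw [← mul_pow]
          exact pow_le_one₀ (by nlinarith) (by nlinarith)
        have b3 : 0 ≤ (1 - p) ^ (k + 1) := pow_nonneg (by linarith) _
        nlinarith
      have e3 := mul_le_mul_of_nonneg_left e1
        (show 0 ≤ ((k + 1 : ℕ) : ℝ) * p by positivity)
      have e4 : ((k + 1 : ℕ) : ℝ) * (p * (1 - p) ^ ((D + 1) * (k + 1))) ≤ 1 := by linarith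
      have e5 : 0 ≤ ((k + 1 : ℕ) : ℝ) * (p * (1 - p) ^ ((D + 1) * (k + 1))) :=
        mul_nonneg (by positivity) (mul_nonneg hp (pow_nonneg (by linarith) _))
      unfold rescueProb
      nlinarith [hS.q_le_one]
    rcases le_or_gt n (t.depth u) with hd | hd
    · exact (hVf.deep N ρ u j hut hd).trans (mul_nonneg hA1 hY)
    cases N with
    | zero => exact (hVf.zero ρ u j hut).trans (mul_nonneg hA1 hY)
    | succ N =>
      have hnt : ∀ z ∈ t.edges u, ρ (z, j) ≠ some true := by
        simpa using (hfree 0 (by omega)).2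
      have hfalse : ∀ z ∈ t.edges u, t.look ρ u j (fun _ => false) (z, j) = some false := by
        intro z hz
        by_cases h : ρ (z, j) = none
        · exact look_eq_of_eq_none hz h
        · rw [look_eq_of_ne_none h]; exact eq_some_false_of_ne h (hnt z hz)
      have hsub : ∀ g b, ¬ (b.1 ∈ t.edges u ∧ b.2 = j) → t.look ρ u j g b = ρ b :=
        fun g b hb => by_contra fun h => hb (mem_edges_of_look_ne h)
      have hfr : ∀ g, ∀ z, t.Below u' z → z ≠ u' → ∀ i, t.look ρ u j g (z, i) = none := by
        intro g z hz hne i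
        rw [hsub g _ fun h => ?_]
        · exact hfresh z hz hne i
        · have := depth_le_of_mem_edges h.1
          have := hz.depth_lt hne
          have := depth_of_mem_ch hu'
          simp only at *
          omega
      have hslot : ∀ i : ℕ, i < k → j + 1 + i ≠ j := fun i hi => by
        have := add_natCast_ne M j (k := i + 1) (by omega) (by have := hS.lt; omega)
        push_cast at this
        rwa [add_assoc, add_comm (1 : S)]
      refine (hVf.step_le hp hp1 hut hd hnt
        (x₀ := (1 - rescueProb D p q k) * Y) (x := fun z => if z = u' then (1 - q) * Y else Y)
        ?_ fun z hz => ?_).trans ?_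
      · refine ih (by omega) (agree_look hag hub)
          (hu.look (by rw [hfalse u (mem_edges.2 (Or.inl rfl))]; simp)) (hfr _) (fun i => ?_)
          fun i hi => ?_
        · by_cases h : i = j
          · subst h; rw [hfalse u' (mem_edges.2 (Or.inr hu'))]; simp
          · rw [look_eq_of_ne_slot h]; exact hoff i
        · have e : j + 1 + (i : S) = j + ((i + 1 : ℕ) : S) := by push_cast; abel
          rw [look_eq_of_ne_slot (hslot i hi)]
          simp_rw [look_eq_of_ne_slot (b := (_, j + 1 + (i : S))) (hslot i hi), e]
          exact hfree (i + 1) (by omega)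
      · have hz1 := (Finset.mem_filter.1 hz).1
        have hz2 := (Finset.mem_filter.1 hz).2
        have hzt : t.look ρ u j (fun c => decide (c = z)) (z, j) = some true := by
          rw [look_eq_of_eq_none hz1 hz2]; simp
        have hzf : ∀ z' ∈ t.edges u, z' ≠ z →
            t.look ρ u j (fun c => decide (c = z)) (z', j) = some false := by
          intro z' hz' hne
          by_cases h : ρ (z', j) = none
          · rw [look_eq_of_eq_none hz' h]; simp [hne]
          · rw [look_eq_of_ne_none h]; exact eq_some_false_of_ne h (hnt z' hz')
        by_cases hzu : z = u'
        · subst hzu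
          rw [if_pos rfl, other_of_mem_ch hu']
          refine hS.escape z (hub.child hu') (fun h => ?_) N _ _ _ hY (hfr _) (fun i hi => ?_)
            fun N' ρ' i hρ' => ?_
          · have := hub.depth_le
            have := depth_of_mem_ch hu'
            rw [h] at this; omega
          · by_contra hij
            rw [look_eq_of_ne_slot fun h => hij (by rw [← h])] at hi
            exact hoff i hi
          · rw [par_of_mem_ch hu']
            have hzc : ∀ x, t.Below z x → t.Below u x ∧ x ≠ u := fun x hx =>
              ⟨(below_of_mem_ch hu').trans hx, fun h => by
                have e1 := hx.depth_le
                have e2 := depth_of_mem_ch hu'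
                rw [h] at e1; omega⟩
            have hlook : t.Guarded H (t.look ρ u j fun c => decide (c = z)) c l u :=
              hu.look (by
                rw [hzf u (mem_edges.2 (Or.inl rfl)) (hzc z .refl).2.symm]; simp)
            refine hG N' ρ' u i (fun b hb => ?_) (hlook.congr fun b hb => ?_)
            · rw [hρ' b fun h => hb (hub.trans (hzc _ h).1)]
              exact agree_look hag hub b hb
            · exact hzc _ (by_contra fun h => hb (hρ' b h))
        · rw [if_neg hzu]
          exact (hA N ρ u j _ hag hu hd).2 z hz1 hzt hzf
      · have e := rescueProb_succ_le hp hp1 hq k hcard1 hcard2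
        have e2 : ∑ z ∈ t.unseen ρ u j, p * (1 - p) ^ ((t.unseen ρ u j).card - 1) *
            (if z = u' then (1 - q) * Y else Y) =
            ((t.unseen ρ u j).card * (p * (1 - p) ^ ((t.unseen ρ u j).card - 1)) -
            p * (1 - p) ^ ((t.unseen ρ u j).card - 1) * q) * Y := by
          have e3 : ∀ z, p * (1 - p) ^ ((t.unseen ρ u j).card - 1) *
              (if z = u' then (1 - q) * Y else Y) =
              p * (1 - p) ^ ((t.unseen ρ u j).card - 1) * Y -
              if z = u' then p * (1 - p) ^ ((t.unseen ρ u j).card - 1) * q * Y else 0 := by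
            intro z; split_ifs <;> ring
          simp_rw [e3]
          rw [Finset.sum_sub_distrib, Finset.sum_const, Finset.sum_ite_eq' _ u', if_pos hU1,
            nsmul_eq_mul]
          ring
        rw [e2]
        have e4 := pow_add_mul_le_one hp hp1 (t.unseen ρ u j).card
        have e5 : 0 ≤ p * (1 - p) ^ ((t.unseen ρ u j).card - 1) * q := by positivity
        rw [← mul_assoc, ← add_mul]
        refine mul_le_mul_of_nonneg_right ?_ hY
        linarith

omit [CharP S M] in
theorem Setting.afterBound_nil (hS : Setting t M H n p q a y top c V ρ₀)
    (hG : GuardedBound t H a y c V ρ₀ [] N) : AfterBound t H n a y c V ρ₀ [] N := by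
  intro ρ v j g hag hv hd
  have hv' : t.Below c v := hv
  refine ⟨fun _ => hG _ v _ (agree_look hag hv') hv, fun z hz _ _ => ?_⟩
  by_cases h : z = v ∧ v = c
  · obtain ⟨rfl, rfl⟩ := h
    rw [other_self]
    simpa using hS.exit N _ _ (agree_look hag hv')
  · exact hG _ _ _ (agree_look hag hv') (hv'.other hz fun h1 h2 => h ⟨h1, h2⟩)

theorem Setting.afterBound_cons (hS : Setting t M H n p q a y top c V ρ₀)
    (hA : ∀ N, AfterBound t H n a y c V ρ₀ l N) (hG : ∀ N, GuardedBound t H a y c V ρ₀ l N)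
    {x : α × α × α} (hGx : GuardedBound t H a y c V ρ₀ (x :: l) N) :
    AfterBound t H n a y c V ρ₀ (x :: l) N := by
  intro ρ v j g hag hv hd
  have hv' : t.Below c v := hv.below
  refine ⟨fun hf => ?_, fun z hz hzt hzf => ?_⟩
  · refine hGx _ v _ (agree_look hag hv') (hv.look ?_)
    rw [hf v (mem_edges.2 (Or.inl rfl))]; simp
  obtain ⟨u, w, u'⟩ := x
  by_cases h : z = v ∧ v = w
  · -- the meander returns to `u`
    obtain ⟨rfl, rfl⟩ := h
    obtain ⟨h1, -, h3⟩ := hv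
    rw [other_self, par_of_mem_ch h1.mem]
    have hzu : z ∈ t.edges z := mem_edges.2 (Or.inl rfl)
    have hne : ∀ b, t.look ρ z j g b ≠ ρ b → b.1 ∉ t.edges u ∨ b.1 = z := fun b hb => by
      by_contra! h'
      exact (not_mem_of_strictBelow h1.mem h1.mem' h1.ne
        (Below.refl.of_mem_edges (mem_edges_of_look_ne hb).1) h'.2).1 h'.1
    have hnB : ∀ b, t.look ρ z j g b ≠ ρ b → ¬ t.Below u' b.1 := fun b hb h4 => by
      have e1 := depth_of_mem_ch h1.mem
      have e2 := depth_of_mem_ch h1.mem'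
      exact h1.ne (h4.eq_of_depth_eq
        (Below.refl.of_mem_edges (mem_edges_of_look_ne hb).1) (by omega))
    have hgap := (h1.gap j).resolve_left fun h => by
      rw [look_eq_of_ne_none (by rw [h]; simp), h] at hzt
      simp at hzt
    have hslot : ∀ i : ℕ, i < H → j + 1 + i ≠ j := fun i hi => by
      have := add_natCast_ne M j (k := i + 1) (by omega) (by have := hS.lt; omega)
      push_cast at this
      rwa [add_assoc, add_comm (1 : S)]
    have key := hS.rescue_le hA hG (N := N) (j := j + 1) (ρ := t.look ρ z j g) le_rfl
      (agree_look hag hv') (h3.look_tail h1.mem .refl) h1.mem'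
      (fun x hx hne i => by
        rw [by_contra fun h => hnB _ h hx]
        exact h1.fresh x hx hne i)
      (fun i => by
        rw [by_contra fun h => hnB _ h .refl]
        exact h1.off i)
      (fun i hi => by
        have e : j + 1 + (i : S) = j + ((i + 1 : ℕ) : S) := by push_cast; abel
        rw [look_eq_of_ne_slot (hslot i hi)]
        simp_rw [look_eq_of_ne_slot (b := (_, j + 1 + (i : S))) (hslot i hi), e]
        exact hgap (i + 1) (by omega) (by omega))
    refine key.trans ?_
    rw [List.length_cons, pow_succ, mul_comm _ (1 - a), mul_assoc]
    exact mul_le_mul_of_nonneg_right (by linarith [hS.a_le]) (hS.bound_nonneg _)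
  · exact hGx _ _ _ (agree_look hag hv') (hv.cross hz hzf fun h1 h2 => h ⟨h1, h2⟩)

omit [CharP S M] in
theorem Setting.guardedBound_of_afterBound (hS : Setting t M H n p q a y top c V ρ₀)
    (h : ∀ N, GuardedBound t H a y c V ρ₀ l N → AfterBound t H n a y c V ρ₀ l N) (N : ℕ) :
    GuardedBound t H a y c V ρ₀ l N := by
  have hVf := hS.failValue
  induction N with
  | zero =>
    intro ρ v j _ hv
    exact (hVf.zero ρ v j (hS.below.trans hv.below)).trans (hS.bound_nonneg _)
  | succ N ih =>
    intro ρ v j hag hv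
    have hvt := hS.below.trans hv.below
    rcases le_or_gt n (t.depth v) with hd | hd
    · exact (hVf.deep _ ρ v j hvt hd).trans (hS.bound_nonneg _)
    · exact hVf.le_of_step_le hS.p_nonneg hS.p_le_one hvt hd (hS.bound_nonneg _)
        (fun g => (h N ih ρ v j g hag hv hd).1) (fun g => (h N ih ρ v j g hag hv hd).2)

/-- Each escape opportunity on the way back to `c` lowers the failure probability by a factor
`1 - a`. -/
theorem Setting.guardedBound (hS : Setting t M H n p q a y top c V ρ₀) (l : List (α × α × α))
    (N : ℕ) : GuardedBound t H a y c V ρ₀ l N := by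
  suffices h : ∀ N, GuardedBound t H a y c V ρ₀ l N ∧ AfterBound t H n a y c V ρ₀ l N from (h N).1
  induction l with
  | nil =>
    have hG := hS.guardedBound_of_afterBound fun N => hS.afterBound_nil
    exact fun N => ⟨hG N, hS.afterBound_nil (hG N)⟩
  | cons x l ih =>
    have hA := fun N => hS.afterBound_cons (N := N) (x := x) (fun N => (ih N).2) fun N => (ih N).1
    have hG := hS.guardedBound_of_afterBound hA
    exact fun N => ⟨hG N, hA N (hG N)⟩

end Phase

end BranchTree

/-! ### The first turn of the meander through the time circle -/

namespace BranchTree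

/-- The status of a level of the tree during the first turn of the meander: not reached yet, being
visited for the first time, passed (the meander went on to a child of the first vertex visited in
this level and has stayed below it), or none of these. -/
inductive Status
  | ahead
  | here
  | passed
  | lost

/-- A lower bound for the probability, up to a constant factor, that the level at distance `i` from
the parent of the starting point ends up with the status `passed`, for the biased random walk that
is now at distance `r` from there. -/
noncomputable def Status.weight : Status → ℕ → ℕ → ℝ
  | ahead, _, r => 1 / 24 * (1 - (1 / 2) ^ r)
  | here, _, _ => 1 / 24
  | passed, i, r => 1 / 8 * (1 - (1 / 2) ^ (r - i))
  | lost, _, _ => 0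

/-- The status of the level `i` after a step from the level `r` to the parent. -/
def Status.down : Status → ℕ → ℕ → Status
  | ahead, _, _ => ahead
  | here, _, _ => lost
  | passed, i, r => if r = i + 1 then lost else passed
  | lost, _, _ => lost

/-- The status of the level `i` after a step from the level `r` to a child. -/
def Status.up : Status → ℕ → ℕ → Status
  | ahead, i, r => if r + 1 = i then here else ahead
  | here, _, _ => passed
  | passed, _, _ => passed
  | lost, _, _ => lost

theorem Status.weight_nonneg (σ : Status) (i r : ℕ) : 0 ≤ σ.weight i r := by
  have h : ∀ k, (1 / 2 : ℝ) ^ k ≤ 1 := fun k => pow_le_one₀ (by norm_num) (by norm_num)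
  cases σ <;> simp only [weight]
  · linarith [h r]
  · norm_num
  · linarith [h (r - i)]
  · exact le_rfl

theorem Status.weight_le (σ : Status) (i r : ℕ) : σ.weight i r ≤ 1 / 8 := by
  have h : ∀ k, (0 : ℝ) ≤ (1 / 2 : ℝ) ^ k := fun k => by positivity
  cases σ <;> simp only [weight]
  · linarith [h r]
  · norm_num
  · linarith [h (r - i)]
  · norm_num

/-- The relation between the status of the level `i` and the present level `r`. -/
def Status.Fits : Status → ℕ → ℕ → Prop
  | ahead, i, r => r < i
  | here, i, r => r = i
  | passed, i, r => i < r
  | lost, _, _ => True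

/-- The weights do not decrease when the walk moves away from the root. This is all that matters at
the starting point when the bit of its parent edge is already known, so that the step to the parent
is impossible. -/
theorem Status.weight_le_up {σ : Status} {i r : ℕ} (h : σ.Fits i r) :
    σ.weight i r ≤ (σ.up i r).weight i (r + 1) := by
  cases σ <;> simp only [Fits] at h <;> simp only [up, weight]
  · have h2 : (0 : ℝ) ≤ (1 / 2) ^ r := by positivity
    split_ifs
    · simp only; linarith
    · simp only [pow_succ]; linarith
  · subst h; simp; norm_num
  · obtain ⟨k, rfl⟩ := Nat.exists_eq_add_of_lt h
    rw [show i + k + 1 - i = k + 1 by omega, show i + k + 1 + 1 - i = k + 2 by omega, pow_succ,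
      pow_succ, pow_succ]
    have h2 : (0 : ℝ) ≤ (1 / 2) ^ k := by positivity
    linarith
  · exact le_rfl

/-- The weights are submartingales for a walk that has at least two children to choose from besides
the parent. -/
theorem Status.weight_step {σ : Status} {i r : ℕ} (h : σ.Fits i (r + 1)) {m : ℕ} (hm : 2 ≤ m) :
    (m + 1) * σ.weight i (r + 1) ≤
      (σ.down i (r + 1)).weight i r + m * (σ.up i (r + 1)).weight i (r + 2) := by
  have hm' : (2 : ℝ) ≤ m := by exact_mod_cast hm
  cases σ <;> simp only [Fits] at h <;> simp only [up, down, weight]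
  · have h2 : (0 : ℝ) ≤ (1 / 2) ^ r := by positivity
    split_ifs <;> simp only [pow_succ] <;> nlinarith
  · subst h
    simp
    norm_num
    linarith
  · obtain ⟨k, hk⟩ := Nat.exists_eq_add_of_lt h
    have h2 : (0 : ℝ) ≤ (1 / 2) ^ k := by positivity
    have e1 : r + 1 - i = k + 1 := by omega
    have e2 : r + 2 - i = k + 2 := by omega
    have e3 : r - i = k := by omega
    split_ifs with h3 <;> simp only [e1, e2, e3, pow_succ]
    · have : k = 0 := by omega
      subst this
      norm_num
      linarith
    · nlinarith
  · simp

variable {α : Type*} {D : ℕ} [DecidableEq α] {t : BranchTree α D}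
  {S : Type*} [DecidableEq S] [AddCommGroupWithOne S]

/-- During the first turn, which has lasted for `k` slots since the slot `s`, the meander was at
`u` exactly in the slots `s + e, …, s + f`, then went on to the child `w` of `u` and stayed below
`w`; the child `u'` of `u` was not visited. -/
structure Passed (t : BranchTree α D) (ρ : α × S → Option Bool) (s : S) (k : ℕ) (u w u' : α)
    (e f : ℕ) : Prop where
  mem : w ∈ t.ch u
  mem' : u' ∈ t.ch u
  ne : u' ≠ w
  one_le : 1 ≤ e
  le : e ≤ f
  lt : f < k
  fresh : ∀ z, t.Below u' z → z ≠ u' → ∀ j, ρ (z, j) = none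
  off : ∀ j, ρ (u', j) ≠ none → ρ (u', j) = some false ∧ ∃ i : ℕ, e ≤ i ∧ i ≤ f ∧ j = s + i
  bar : ∀ z ∈ t.edges u, ∀ j, ρ (z, j) = some true → j + 1 = s + e ∨ j = s + f
  wait : ∀ i : ℕ, e ≤ i → i < f → ρ (w, s + i) = some false
  seen : ∀ j, ρ (w, j) ≠ none → ∃ i : ℕ, e ≤ i ∧ i < k ∧ j = s + i

/-- What is known when the level at depth `h` below `c` has the given status, `k` slots after the
meander started at `c` in the slot `s`, and the meander is at `v`. -/
def LevelInv (t : BranchTree α D) (c : α) (s : S) (h : ℕ) (ρ : α × S → Option Bool) (k : ℕ)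
    (v : α) : Status → Prop
  | .ahead => t.depth v < h ∧ ∀ z, t.Below c z → (t.depth z = h → ∀ j, ρ (z, j) ≠ some true) ∧
      (h < t.depth z → ∀ j, ρ (z, j) = none)
  | .here => t.depth v = h ∧ ∃ e : ℕ, 1 ≤ e ∧ e ≤ k ∧ (∀ j, ρ (v, j) = some true → j + 1 = s + e) ∧
      (∀ z ∈ t.ch v, ∀ j, ρ (z, j) ≠ none →
        ρ (z, j) = some false ∧ ∃ i : ℕ, e ≤ i ∧ i < k ∧ j = s + i) ∧
      (∀ z ∈ t.ch v, ∀ i : ℕ, e ≤ i → i < k → ρ (z, s + i) = some false) ∧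
      ∀ z, t.Below v z → t.depth v + 1 < t.depth z → ∀ j, ρ (z, j) = none
  | .passed => ∃ u w u' e f, t.depth u = h ∧ t.Below w v ∧ t.Passed ρ s k u w u' e f
  | .lost => True

/-- What is known in general `k` slots after the start at `c` in the slot `s`. -/
structure TurnInv (t : BranchTree α D) (c : α) (s : S) (ρ : α × S → Option Bool) (k : ℕ) :
    Prop where
  slot : ∀ z, t.Below c z → z ≠ c → ∀ j, ρ (z, j) ≠ none → ∃ e : ℕ, e < k ∧ j = s + e
  bar : ∀ j, ρ (c, j) = some true → j + 1 = s

variable {ρ ρ' : α × S → Option Bool} {c u w u' v z : α} {s : S} {g : α → Bool} {k h e f : ℕ}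

omit [DecidableEq S] in
theorem Passed.congr (hP : t.Passed ρ s k u w u' e f)
    (hρ : ∀ b, ρ' b ≠ ρ b → b.1 ∉ t.edges u ∧ ¬ t.Below u' b.1) :
    t.Passed ρ' s k u w u' e f := by
  have hE : ∀ z ∈ t.edges u, ∀ j, ρ' (z, j) = ρ (z, j) := fun z hz j => by
    by_contra h'; exact (hρ _ h').1 hz
  have hB : ∀ z, t.Below u' z → ∀ j, ρ' (z, j) = ρ (z, j) := fun z hz j => by
    by_contra h'; exact (hρ _ h').2 hz
  have hw := hE w (mem_edges.2 (Or.inr hP.mem))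
  refine ⟨hP.mem, hP.mem', hP.ne, hP.one_le, hP.le, hP.lt, fun z hz hne j => ?_, fun j => ?_,
    fun z hz j => ?_, fun i => ?_, fun j => ?_⟩
  · rw [hB z hz]; exact hP.fresh z hz hne j
  · rw [hB u' .refl]; exact hP.off j
  · rw [hE z hz]; exact hP.bar z hz j
  · rw [hw]; exact hP.wait i
  · rw [hw]; exact hP.seen j

theorem Passed.look (hP : t.Passed ρ s k u w u' e f) (hv : t.Below w v)
    (hw : v = w → t.look ρ v (s + k) g (w, s + k) ≠ some true) :
    t.Passed (t.look ρ v (s + k) g) s (k + 1) u w u' e f := by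
  have hch : ∀ b, t.look ρ v (s + k) g b ≠ ρ b → ¬ t.Below u' b.1 ∧
      (b.1 ∈ t.edges u → b = (w, s + k) ∧ v = w) := fun b hb => by
    obtain ⟨h1, h2⟩ := mem_edges_of_look_ne hb
    have h3 := hv.of_mem_edges h1
    have e1 := depth_of_mem_ch hP.mem
    have e2 := depth_of_mem_ch hP.mem'
    refine ⟨fun h4 => hP.ne (h4.eq_of_depth_eq h3 (by omega)), fun h4 => ?_⟩
    have h5 : b.1 = w := by
      by_contra h5
      exact (not_mem_of_strictBelow hP.mem hP.mem' hP.ne h3 h5).1 h4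
    refine ⟨Prod.ext h5 h2, ?_⟩
    refine hv.eq_of_depth_le ?_
    have := le_depth_of_mem_edges h1
    rwa [h5] at this
  have hB : ∀ z, t.Below u' z → ∀ i, t.look ρ v (s + k) g (z, i) = ρ (z, i) := fun z hz i => by
    by_contra h'; exact (hch _ h').1 hz
  refine ⟨hP.mem, hP.mem', hP.ne, hP.one_le, hP.le, hP.lt.trans (Nat.lt_succ_self k),
    fun z hz hne j => ?_, fun j => ?_, fun z hz j hzj => ?_, fun i h1 h2 => ?_, fun j hj => ?_⟩
  · rw [hB z hz]; exact hP.fresh z hz hne j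
  · rw [hB u' .refl]; exact hP.off j
  · by_cases hzz : t.look ρ v (s + k) g (z, j) = ρ (z, j)
    · rw [hzz] at hzj; exact hP.bar z hz j hzj
    · obtain ⟨h5, h6⟩ := (hch _ hzz).2 hz
      rw [h5] at hzj; exact absurd hzj (hw h6)
  · rw [look_eq_of_ne_none (by rw [hP.wait i h1 h2]; simp)]; exact hP.wait i h1 h2
  · by_cases hzz : t.look ρ v (s + k) g (w, j) = ρ (w, j)
    · rw [hzz] at hj
      obtain ⟨i, h1, h2, h3⟩ := hP.seen j hj
      exact ⟨i, h1, by omega, h3⟩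
    · have := (mem_edges_of_look_ne hzz).2
      exact ⟨k, hP.le.trans hP.lt.le, Nat.lt_succ_self k, this⟩

theorem TurnInv.look (hT : t.TurnInv c s ρ k) (hv : t.Below c v)
    (hc : v = c → t.look ρ v (s + k) g (c, s + k) ≠ some true) :
    t.TurnInv c s (t.look ρ v (s + k) g) (k + 1) := by
  refine ⟨fun z hz hne j hj => ?_, fun j hj => ?_⟩
  · by_cases hzz : t.look ρ v (s + k) g (z, j) = ρ (z, j)
    · rw [hzz] at hj
      obtain ⟨e, h1, h2⟩ := hT.slot z hz hne j hj
      exact ⟨e, by omega, h2⟩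
    · exact ⟨k, Nat.lt_succ_self k, (mem_edges_of_look_ne hzz).2⟩
  · by_cases hzz : t.look ρ v (s + k) g (c, j) = ρ (c, j)
    · rw [hzz] at hj; exact hT.bar j hj
    · obtain ⟨h1, h2⟩ := mem_edges_of_look_ne hzz
      change j = s + k at h2
      subst h2
      refine absurd hj (hc (hv.eq_of_depth_le ?_))
      exact le_depth_of_mem_edges h1

theorem LevelInv.stay {σ : Status} (hL : t.LevelInv c s h ρ k v σ)
    (hf : ∀ z ∈ t.edges v, t.look ρ v (s + k) g (z, s + k) = some false) :
    t.LevelInv c s h (t.look ρ v (s + k) g) (k + 1) v σ := by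
  have hnt : ∀ z j, t.look ρ v (s + k) g (z, j) ≠ ρ (z, j) →
      j = s + k ∧ z ∈ t.edges v ∧ t.look ρ v (s + k) g (z, j) = some false := fun z j hne => by
    obtain ⟨h1, h2⟩ := mem_edges_of_look_ne hne
    change j = s + k at h2
    subst h2
    exact ⟨rfl, h1, hf z h1⟩
  cases σ with
  | ahead =>
    obtain ⟨h1, h2⟩ := hL
    refine ⟨h1, fun z hz => ⟨fun h3 j => ?_, fun h3 j => ?_⟩⟩
    · by_cases hzz : t.look ρ v (s + k) g (z, j) = ρ (z, j)
      · rw [hzz]; exact (h2 z hz).1 h3 j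
      · rw [(hnt z j hzz).2.2]; simp
    · rw [look_eq_of_notMem fun h4 => ?_]
      · exact (h2 z hz).2 h3 j
      · have := depth_le_of_mem_edges h4; simp only at this; omega
  | here =>
    obtain ⟨h1, e, h2, h3, h4, h5, h6, h7⟩ := hL
    refine ⟨h1, e, h2, by omega, fun j hj => ?_, fun z hz j hj => ?_, fun z hz i h8 h9 => ?_,
      fun z hz hd j => ?_⟩
    · by_cases hzz : t.look ρ v (s + k) g (v, j) = ρ (v, j)
      · rw [hzz] at hj; exact h4 j hj
      · rw [(hnt v j hzz).2.2] at hj; simp at hj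
    · by_cases hzz : t.look ρ v (s + k) g (z, j) = ρ (z, j)
      · rw [hzz] at hj ⊢
        obtain ⟨h8, i, h9, h10, h11⟩ := h5 z hz j hj
        exact ⟨h8, i, h9, by omega, h11⟩
      · exact ⟨(hnt z j hzz).2.2, k, h3, Nat.lt_succ_self k, (hnt z j hzz).1⟩
    · rcases Nat.lt_succ_iff_lt_or_eq.1 h9 with h10 | rfl
      · rw [look_eq_of_ne_none (by rw [h6 z hz i h8 h10]; simp)]; exact h6 z hz i h8 h10
      · exact hf z (mem_edges.2 (Or.inr hz))
    · rw [look_eq_of_notMem fun h4 => ?_]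
      · exact h7 z hz hd j
      · have := depth_le_of_mem_edges h4; simp only at this; omega
  | passed =>
    obtain ⟨u, w, u', e, f, h1, h2, h3⟩ := hL
    refine ⟨u, w, u', e, f, h1, h2, h3.look h2 ?_⟩
    rintro rfl
    rw [hf v (mem_edges.2 (Or.inl rfl))]; simp
  | lost => trivial

theorem LevelInv.up {σ : Status} (hL : t.LevelInv c s h ρ k v σ) (hv : t.Below c v)
    (hz : z ∈ t.ch v)
    (hf : ∀ z' ∈ t.edges v, z' ≠ z → t.look ρ v (s + k) g (z', s + k) = some false)
    {i r : ℕ} (hir : r + 1 = i ↔ t.depth v + 1 = h) :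
    t.LevelInv c s h (t.look ρ v (s + k) g) (k + 1) z (σ.up i r) := by
  have hdz := depth_of_mem_ch hz
  have hvz : v ≠ z := fun h' => by
    rw [h'] at hz; exact not_mem_ch_self z hz
  have hnt : ∀ x j, t.look ρ v (s + k) g (x, j) ≠ ρ (x, j) →
      j = s + k ∧ x ∈ t.edges v ∧ (x ≠ z → t.look ρ v (s + k) g (x, j) = some false) :=
    fun x j hne => by
    obtain ⟨h1, h2⟩ := mem_edges_of_look_ne hne
    change j = s + k at h2
    subst h2
    exact ⟨rfl, h1, hf x h1⟩
  have hdeep : ∀ x j, t.depth v + 1 < t.depth x → t.look ρ v (s + k) g (x, j) = ρ (x, j) :=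
    fun x j hd => look_eq_of_notMem fun h4 => by
      have := depth_le_of_mem_edges h4; simp only at this; omega
  cases σ with
  | ahead =>
    obtain ⟨h1, h2⟩ := hL
    simp only [Status.up]
    split_ifs with hi
    · have hi' := hir.1 hi
      have hzc : t.Below c z := hv.child hz
      have hnone : ∀ x, t.Below c x → h < t.depth x → ∀ j, t.look ρ v (s + k) g (x, j) = none :=
        fun x hx hd j => by rw [hdeep x j (by omega)]; exact (h2 x hx).2 hd j
      refine ⟨by omega, k + 1, by omega, le_rfl, fun j hj => ?_, fun x hx j hj => ?_,
        fun x _ i h3 h4 => ?_, fun x hx hd => hnone x (hzc.trans hx) (by omega)⟩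
      · by_cases hzz : t.look ρ v (s + k) g (z, j) = ρ (z, j)
        · rw [hzz] at hj
          exact absurd hj ((h2 z hzc).1 (by omega) j)
        · rw [(hnt z j hzz).1]; push_cast; abel
      · exact absurd (hnone x (hzc.child hx) (by have := depth_of_mem_ch hx; omega) j) hj
      · omega
    · have hi' : ¬ t.depth v + 1 = h := fun h' => hi (hir.2 h')
      refine ⟨by omega, fun x hx => ⟨fun hd j => ?_, fun hd j => ?_⟩⟩
      · rw [hdeep x j (by omega)]; exact (h2 x hx).1 hd j
      · rw [hdeep x j (by omega)]; exact (h2 x hx).2 hd j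
  | here =>
    obtain ⟨h1, e, h2, h3, h4, h5, h6, h7⟩ := hL
    obtain ⟨u', hu', hne⟩ := Finset.exists_mem_ne (t.two_le_card_ch v) z
    have hold : ∀ i : ℕ, e ≤ i → i < k → ∀ x ∈ t.ch v,
        t.look ρ v (s + k) g (x, s + i) = some false := fun i h8 h9 x hx => by
      rw [look_eq_of_ne_none (by rw [h6 x hx i h8 h9]; simp)]; exact h6 x hx i h8 h9
    refine ⟨v, z, u', e, k, h1, .refl, hz, hu', hne, h2, h3, Nat.lt_succ_self k,
      fun x hx hxu j => ?_, fun j hj => ?_, fun x hx j hj => ?_, fun i h8 h9 => hold i h8 h9 z hz,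
      fun j hj => ?_⟩
    · have hd : t.depth v + 1 < t.depth x := by
        have := hx.depth_lt hxu
        have := depth_of_mem_ch hu'
        omega
      rw [hdeep x j hd]
      exact h7 x ((below_of_mem_ch hu').trans hx) hd j
    · by_cases hzz : t.look ρ v (s + k) g (u', j) = ρ (u', j)
      · rw [hzz] at hj ⊢
        obtain ⟨h8, i, h9, h10, h11⟩ := h5 u' hu' j hj
        exact ⟨h8, i, h9, h10.le, h11⟩
      · exact ⟨(hnt u' j hzz).2.2 hne, k, h3, le_rfl, (hnt u' j hzz).1⟩
    · by_cases hzz : t.look ρ v (s + k) g (x, j) = ρ (x, j)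
      · rw [hzz] at hj
        rcases mem_edges.1 hx with rfl | hx
        · exact Or.inl (h4 j hj)
        · have := (h5 x hx j (by rw [hj]; simp)).1
          rw [hj] at this; simp at this
      · exact Or.inr (hnt x j hzz).1
    · by_cases hzz : t.look ρ v (s + k) g (z, j) = ρ (z, j)
      · rw [hzz] at hj
        obtain ⟨h8, i, h9, h10, h11⟩ := h5 z hz j hj
        exact ⟨i, h9, by omega, h11⟩
      · exact ⟨k, h3, Nat.lt_succ_self k, (hnt z j hzz).1⟩
  | passed =>
    obtain ⟨u, w, u', e, f, h1, h2, h3⟩ := hL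
    refine ⟨u, w, u', e, f, h1, h2.child hz, h3.look h2 ?_⟩
    rintro rfl
    rw [hf v (mem_edges.2 (Or.inl rfl)) hvz]; simp
  | lost => trivial

theorem LevelInv.down {σ : Status} (hL : t.LevelInv c s h ρ k v σ) (hv : t.Below c v)
    (hvc : v ≠ c)
    (hf : ∀ z' ∈ t.edges v, z' ≠ v → t.look ρ v (s + k) g (z', s + k) = some false)
    {i r : ℕ} (hir : r = i + 1 ↔ t.depth v = h + 1) :
    t.LevelInv c s h (t.look ρ v (s + k) g) (k + 1) (t.par v) (σ.down i r) := by
  have hdv := depth_of_mem_ch (hv.eq_or_par.resolve_left hvc).2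
  cases σ with
  | ahead =>
    obtain ⟨h1, h2⟩ := hL
    refine ⟨by omega, fun x hx => ⟨fun hd j => ?_, fun hd j => ?_⟩⟩
    · by_cases hzz : t.look ρ v (s + k) g (x, j) = ρ (x, j)
      · rw [hzz]; exact (h2 x hx).1 hd j
      · obtain ⟨h3, h4⟩ := mem_edges_of_look_ne hzz
        change j = s + k at h4
        subst h4
        rw [hf x h3 (by rintro rfl; omega)]; simp
    · rw [look_eq_of_notMem fun h4 => ?_]
      · exact (h2 x hx).2 hd j
      · have := depth_le_of_mem_edges h4; simp only at this; omega
  | here => trivial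
  | passed =>
    simp only [Status.down]
    split_ifs with hi
    · trivial
    · obtain ⟨u, w, u', e, f, h1, h2, h3⟩ := hL
      have hvw : v ≠ w := by
        rintro rfl
        exact hi (hir.2 (by rw [depth_of_mem_ch h3.mem, h1]))
      exact ⟨u, w, u', e, f, h1, (h2.eq_or_par.resolve_left hvw).1,
        h3.look h2 fun h => absurd h hvw⟩
  | lost => trivial

end BranchTree

namespace BranchTree

variable {α : Type*} {D : ℕ} [DecidableEq α] {t : BranchTree α D}
  {S : Type*} [DecidableEq S] [AddCommGroupWithOne S]

/-- The numerical requirements on the parameters: `H` is the number of slots for an escape attempt,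
`K` the number of slots after which the first turn is cut off, `L` the number of levels that are
examined during the first turn, and `a` the success probability of an escape attempt. -/
structure Params (D M H K L : ℕ) (p a : ℝ) : Prop where
  half : 1 / 2 ≤ (1 - p) ^ D
  window : 1 / 8 ≤ (1 - p) ^ (H + 1)
  add_lt : K + H + 3 ≤ M
  time : 3 / 4 * ((4 / 3) ^ (2 * L + 1) * (1 - p / 12) ^ K) ≤ 1 / 192
  one_le : 1 ≤ L
  pow_le : ∀ m : ℕ, (1 / 96 : ℝ) * L < m → (1 - a) ^ m ≤ 1 / 2

variable {M H K L n : ℕ} {p a y : ℝ} {ρ ρ' ρ₀ : α × S → Option Bool} {c u w u' v top : α} {s : S}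
  {k e f : ℕ} {V : ℕ → (α × S → Option Bool) → α → S → ℝ} {l : List (α × α × α)} [CharP S M]

omit [DecidableEq S] in
theorem natCast_inj_of_lt {M : ℕ} [CharP S M] {i j : ℕ} (hi : i < M) (hj : j < M)
    (h : (i : S) = j) : i = j := by
  rcases le_total i j with hij | hij
  · have h' : ((j - i : ℕ) : S) = 0 := by rw [Nat.cast_sub hij, h, sub_self]
    have := Nat.eq_zero_of_dvd_of_lt ((CharP.cast_eq_zero_iff S M _).1 h') (by omega)
    omega
  · have h' : ((i - j : ℕ) : S) = 0 := by rw [Nat.cast_sub hij, h, sub_self]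
    have := Nat.eq_zero_of_dvd_of_lt ((CharP.cast_eq_zero_iff S M _).1 h') (by omega)
    omega

omit [DecidableEq S] [CharP S M] in
theorem Guarded.of_below (h : t.Guarded H ρ c l v) (hu : t.Below u v)
    (hl : ∀ x ∈ l, t.depth x.2.1 ≤ t.depth u) (hc : t.depth c ≤ t.depth u) :
    t.Guarded H ρ c l u := by
  cases l with
  | nil => exact Below.below_of_depth_le h hu hc
  | cons x l =>
    obtain ⟨u₂, w, u'⟩ := x
    exact ⟨h.1, h.2.1.below_of_depth_le hu (hl (u₂, w, u') (by simp)), h.2.2⟩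

/-- The slots of the edge from `u` to `w` in which a bar would spoil the escape opportunity at `u`:
those in which the meander, having crossed the bar, would soon meet the bar through which it first
came to `u`. -/
def window (w : α) (s : S) (e H : ℕ) : Finset (α × S) :=
  (Finset.range (H + 1)).image fun i : ℕ => (w, s + e - 1 - i)

omit [CharP S M] in
theorem mem_window {b : α × S} : b ∈ window w s e H ↔
    b.1 = w ∧ ∃ i : ℕ, i ≤ H ∧ b.2 = s + e - 1 - i := by
  simp only [window, Finset.mem_image, Finset.mem_range, Nat.lt_succ_iff]
  constructor
  · rintro ⟨i, hi, rfl⟩; exact ⟨rfl, i, hi, rfl⟩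
  · rintro ⟨h1, i, hi, h2⟩; exact ⟨i, hi, Prod.ext h1.symm h2.symm⟩

theorem card_window (hH : H < M) : (window w s e H : Finset (α × S)).card = H + 1 := by
  rw [window, Finset.card_image_of_injOn, Finset.card_range]
  intro i hi j hj hij
  simp only [Finset.coe_range, Set.mem_Iio] at hi hj
  simp only [Prod.mk.injEq, true_and, sub_right_inj] at hij
  exact natCast_inj_of_lt (M := M) (by omega) (by omega) hij

theorem Passed.window_unknown (hP : t.Passed ρ s k u w u' e f) (hk : k + H < M) :
    ∀ b ∈ window w s e H, ρ b = none := by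
  rintro ⟨x, j⟩ hb
  obtain ⟨h1, i, hi, h2⟩ := mem_window.1 hb
  simp only at h1 h2
  subst h1
  by_contra hne
  obtain ⟨i', h3, h4, h5⟩ := hP.seen j hne
  have h6 : ((i' - e + 1 + i : ℕ) : S) = 0 := by
    rw [h2] at h5
    have h7 : (e : S) - 1 - i = i' := by
      have : s + ((e : S) - 1 - i) = s + i' := by rw [← h5]; abel
      exact add_left_cancel this
    push_cast [Nat.cast_sub h3]
    rw [← h7]; abel
  have := Nat.le_of_dvd (by omega) ((CharP.cast_eq_zero_iff S M _).1 h6)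
  omega

omit [CharP S M] in
/-- If the window carries no bars, then the passed level offers an escape opportunity. -/
theorem Passed.rescue (hP : t.Passed ρ s k u w u' e f) :
    t.Rescue H (reveal ρ (window w s e H) fun _ => false) u w u' := by
  have hne : ∀ b, b.1 ≠ w → reveal ρ (window w s e H) (fun _ => false) b = ρ b := fun b hb =>
    if_neg fun h => hb (mem_window.1 h).1
  have hww : ¬ t.Below u' w := fun h => by
    have h1 := depth_of_mem_ch hP.mem
    have h2 := depth_of_mem_ch hP.mem'
    exact hP.ne (h.eq_of_depth_le (by omega)).symm
  refine ⟨hP.mem, hP.mem', hP.ne, fun z hz hzu j => ?_, fun j => ?_, fun j => ?_⟩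
  · rw [hne _ fun h => hww (h ▸ hz)]; exact hP.fresh z hz hzu j
  · rw [hne _ hP.ne]
    intro h
    have := (hP.off j (by rw [h]; simp)).1
    rw [h] at this; simp at this
  · by_contra! hcon
    obtain ⟨h1, m, hm1, hmH, h2⟩ := hcon
    have hwin : ∀ i : ℕ, i ≤ H → j ≠ s + e - 1 - i := fun i hi h => by
      refine h1 ?_
      have : (w, j) ∈ window w s e H := mem_window.2 ⟨rfl, i, hi, h⟩
      rw [reveal, if_pos this]
    have hρw : ρ (w, j) ≠ some false := fun h => h1 (by
      by_cases hw : (w, j) ∈ window w s e H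
      · rw [reveal, if_pos hw]
      · rw [reveal, if_neg hw, h])
    -- a slot shortly after `j` in which the meander was at `u` forces `j` to be a waiting slot or
    -- in the window
    have key : ∀ i : ℕ, e ≤ i → i ≤ f → j + m ≠ s + i := fun i he hf hj => by
      rcases le_or_gt e (i - m) with h3 | h3
      · have hmi : m ≤ i := by have := hP.one_le; omega
        have : j = s + ((i - m : ℕ) : S) := by
          rw [Nat.cast_sub hmi]
          rw [eq_sub_of_add_eq hj]; abel
        refine hρw ?_
        rw [this]
        exact hP.wait _ h3 (by omega)
      · refine hwin (e - 1 + m - i) (by omega) ?_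
        rw [Nat.cast_sub (by have := hP.one_le; omega), Nat.cast_add, Nat.cast_sub hP.one_le]
        rw [eq_sub_of_add_eq hj]; push_cast; abel
    have hu' : ρ (u', j + m) = none := by
      by_contra h3
      obtain ⟨-, i, he, hf, hj⟩ := hP.off _ h3
      exact key i he hf hj
    rw [hne _ hP.ne] at h2
    obtain ⟨z, hz, hzt⟩ := h2 hu'
    have hzt' : ρ (z, j + m) = some true := by
      by_cases hw : (z, j + m) ∈ window w s e H
      · rw [reveal, if_pos hw] at hzt; simp at hzt
      · rwa [reveal, if_neg hw] at hzt
    rcases hP.bar z hz _ hzt' with h3 | h3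
    · refine hwin m hmH ?_
      rw [← h3]; abel
    · exact key f hP.le le_rfl h3

omit [DecidableEq S] [AddCommGroupWithOne S] [CharP S M] in
theorem reveal_window_ne [DecidableEq S] [AddCommGroupWithOne S] {g : α × S → Bool} {b : α × S}
    (h : reveal ρ (window w s e H) g b ≠ ρ b) : b.1 = w := by
  by_contra h'
  exact h (if_neg fun h => h' (mem_window.1 h).1)

variable {q : ℝ}

/-- Each passed level turns into an escape opportunity with probability at least `1 / 8`. -/
theorem Setting.window_le (hS : Setting t M H n p q a y top c V ρ₀) (hP : Params D M H K L p a)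
    (hd : t.depth v < n) (hk : k ≤ K) (A : ℕ → Prop) [DecidablePred A] {N : ℕ} {j : S}
    {m : ℕ} (hm : m ≤ L) (hl : l.length ≤ L - m)
    (hA : ∀ i, L - m ≤ i → i < L → A i →
      ∃ u w u' e f, t.depth u = t.depth c + (2 * i + 1) ∧ t.Below w v ∧ t.Passed ρ s k u w u' e f)
    (hag : ∀ b, ¬ t.Below c b.1 → ρ b = ρ₀ b) (hG : t.Guarded H ρ c l v)
    (hdl : ∀ x ∈ l, t.depth x.2.1 ≤ t.depth c + 2 * (L - m)) :
    V N ρ v j ≤ y * (1 + 1 / 192 - (l.length + 1 / 8 *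
      (((Finset.Ico (L - m) L).filter A).card : ℝ)) / (2 * L)) := by
  have hL : (1 : ℝ) ≤ L := by exact_mod_cast hP.one_le
  induction m generalizing ρ l with
  | zero =>
    refine (hS.guardedBound l N ρ v j hag hG).trans ?_
    rw [mul_comm]
    refine mul_le_mul_of_nonneg_left ?_ hS.y_nonneg
    simp only [Nat.sub_zero, Finset.Ico_self, Finset.filter_empty, Finset.card_empty]
    have hlL : (l.length : ℝ) ≤ L := by exact_mod_cast hl
    have e1 : (l.length : ℝ) / (2 * L) ≤ 1 / 2 := by
      rw [div_le_div_iff₀ (by linarith) (by norm_num)]; linarith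
    have ha : 0 ≤ a := by
      by_contra ha
      obtain ⟨m, hm⟩ := exists_nat_gt ((1 / 96 : ℝ) * L)
      have := hP.pow_le m hm
      have h1 : (1 : ℝ) ≤ (1 - a) ^ m := one_le_pow₀ (by linarith)
      linarith
    by_cases hc : (1 / 96 : ℝ) * L < l.length
    · have := hP.pow_le _ hc
      norm_num
      linarith
    · have e2 : (l.length : ℝ) / (2 * L) ≤ 1 / 192 := by
        rw [div_le_div_iff₀ (by linarith) (by norm_num)]; linarith
      have e3 : (1 - a) ^ l.length ≤ 1 := pow_le_one₀ (by linarith [hS.a_le_one]) (by linarith)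
      norm_num
      linarith
  | succ m ih =>
    set i := L - (m + 1) with hi
    have hi1 : L - m = i + 1 := by omega
    have hico : Finset.Ico i L = insert i (Finset.Ico (L - m) L) := by
      rw [hi1]; exact (Finset.insert_Ico_succ_left_eq_Ico (by omega)).symm
    have hni : i ∉ (Finset.Ico (L - m) L).filter A := by simp [hi1]
    rw [hico, Finset.filter_insert]
    set B := (Finset.Ico (L - m) L).filter A
    by_cases hAi : A i
    · rw [if_pos hAi, Finset.card_insert_of_notMem hni]
      obtain ⟨u, w, u', e, f, h1, h2, hPa⟩ := hA i le_rfl (by omega) hAi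
      have hwu := depth_of_mem_ch hPa.mem
      have huv : t.Below u v := (below_of_mem_ch hPa.mem).trans h2
      have hGu : t.Guarded H ρ c l u := hG.of_below huv
        (fun x hx => (hdl x hx).trans (by omega)) (by omega)
      have hcu := hGu.below
      have hadd := hP.add_lt
      have hlater : ∀ g, ∀ i', L - m ≤ i' → i' < L → A i' → ∃ u₂ w₂ u₂' e₂ f₂,
          t.depth u₂ = t.depth c + (2 * i' + 1) ∧ t.Below w₂ v ∧
          t.Passed (reveal ρ (window w s e H) g) s k u₂ w₂ u₂' e₂ f₂ := by
        intro g i' h3 h4 h5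
        obtain ⟨u₂, w₂, u₂', e₂, f₂, h6, h7, h8⟩ := hA i' (by omega) h4 h5
        refine ⟨u₂, w₂, u₂', e₂, f₂, h6, h7, h8.congr fun b hb => ?_⟩
        rw [reveal_window_ne hb]
        refine ⟨fun h => ?_, fun h => ?_⟩
        · have := le_depth_of_mem_edges h; omega
        · have := h.depth_le
          have := depth_of_mem_ch h8.mem'
          omega
      have hag' : ∀ g, ∀ b, ¬ t.Below c b.1 → reveal ρ (window w s e H) g b = ρ₀ b := by
        intro g b hb
        rw [← hag b hb]
        by_contra h
        refine hb ?_
        rw [reveal_window_ne h]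
        exact hcu.child hPa.mem
      have hG' : ∀ g, t.Guarded H (reveal ρ (window w s e H) g) c l u := fun g =>
        hGu.congr fun b hb => by
          rw [reveal_window_ne hb]
          refine ⟨below_of_mem_ch hPa.mem, fun h => ?_⟩
          rw [h] at hwu; omega
      have hlive : ∀ b ∈ window w s e H, t.Below top b.1 ∧ t.depth b.1 ≤ n := fun b hb => by
        rw [(mem_window.1 hb).1]
        refine ⟨hS.below.trans (hcu.child hPa.mem), ?_⟩
        have := h2.depth_le
        omega
      have hoff := ih (ρ := reveal ρ (window w s e H) fun _ => false) (l := (u, w, u') :: l)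
        (by omega) (by simp only [List.length_cons]; omega) (hlater _) (hag' _)
        ⟨hPa.rescue, h2, hG' _⟩ (by
          intro x hx
          rcases List.mem_cons.1 hx with rfl | hx
          · simp only; omega
          · exact (hdl x hx).trans (by omega))
      have hon := fun g => ih (ρ := reveal ρ (window w s e H) g) (l := l)
        (by omega) (by omega) (hlater g) (hag' g) ((hG' g).trans huv)
        (fun x hx => (hdl x hx).trans (by omega))
      have key := (hS.failValue.averaging N v j).le_of_reveal_false hS.p_nonneg hS.p_le_one hlive
        (hPa.window_unknown (H := H) (M := M) (by omega)) hoff fun g _ => hon g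
      rw [card_window (M := M) (by omega)] at key
      refine key.trans ?_
      have hw := hP.window
      rw [List.length_cons]
      push_cast
      have e1 : (l.length + 1 + 1 / 8 * (B.card : ℝ)) / (2 * L) =
        (l.length + 1 / 8 * (B.card : ℝ)) / (2 * L) + 1 / (2 * L) := by ring
      have e2 : (l.length + 1 / 8 * ((B.card : ℝ) + 1)) / (2 * L) =
        (l.length + 1 / 8 * (B.card : ℝ)) / (2 * L) + 1 / 8 * (1 / (2 * L)) := by ring
      rw [e1, e2]
      have e3 : 0 ≤ y * (1 / (2 * L)) := mul_nonneg hS.y_nonneg (by positivity)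
      have e4 := mul_le_mul_of_nonneg_right hw e3
      linarith
    · rw [if_neg hAi]
      exact ih (by omega) (by omega) (fun i' h1 h2 => hA i' (by omega) h2) hag hG
        (fun x hx => (hdl x hx).trans (by omega))

/-- The error term that accounts for a long duration of the first turn, at distance `r` from the
parent of the starting point and `k` slots before the cutoff. -/
noncomputable def turnError (L : ℕ) (p : ℝ) (r k : ℕ) : ℝ :=
  (3 / 4) ^ r * ((4 / 3) ^ (2 * L + 1) * (1 - p / 12) ^ k)

/-- The bound for the failure probability during the first turn, up to a factor, in terms of the
total weight `Ψ` of the levels, the distance `r` from the parent of the starting point, and the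
number `k` of slots before the cutoff. -/
noncomputable def turnBound (L : ℕ) (p Ψ : ℝ) (r k : ℕ) : ℝ :=
  1 + 1 / 192 - Ψ / (2 * L) + 1 / 2 * turnError L p r k

theorem turnError_nonneg (hp1 : p ≤ 1) (r k : ℕ) : 0 ≤ turnError L p r k := by
  have : 0 ≤ 1 - p / 12 := by linarith
  unfold turnError; positivity

theorem turnBound_step (hp : 0 ≤ p) (hp1 : p ≤ 1) (hhalf : 1 / 2 ≤ (1 - p) ^ D) {m : ℕ}
    (hm : 2 ≤ m) (hmD : m ≤ D) (hL : 1 ≤ L) {r : ℕ} {Ψ Ψd Ψu : ℝ} (hΨ : Ψ ≤ L * (1 / 8))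
    (h : (m + 1) * Ψ ≤ Ψd + m * Ψu) :
    (1 - p) ^ (m + 1) * turnBound L p Ψ (r + 1) k + (p * (1 - p) ^ m) *
      (turnBound L p Ψd r k + m * turnBound L p Ψu (r + 2) k) ≤
      turnBound L p Ψ (r + 1) (k + 1) := by
  have hL' : (1 : ℝ) ≤ L := by exact_mod_cast hL
  have hm' : (2 : ℝ) ≤ m := by exact_mod_cast hm
  have e1 := pow_add_mul_le_one hp hp1 (m + 1)
  rw [Nat.add_sub_cancel] at e1
  push_cast at e1
  have e2 : p * (1 / 2) ≤ p * (1 - p) ^ m := by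
    refine mul_le_mul_of_nonneg_left (hhalf.trans ?_) hp
    exact pow_le_pow_of_le_one (by linarith) (by linarith) hmD
  set W₀ := (1 - p) ^ (m + 1)
  set W₁ := p * (1 - p) ^ m
  have hE := turnError_nonneg (L := L) hp1 (r + 1) k
  set E := turnError L p (r + 1) k with hEdef
  have a1 : turnError L p (r + 1) (k + 1) = (1 - p / 12) * E := by
    rw [hEdef]; unfold turnError; ring
  have a2 : turnError L p r k = 4 / 3 * E := by
    rw [hEdef]; unfold turnError; ring
  have a3 : turnError L p (r + 2) k = 3 / 4 * E := by
    rw [hEdef]; unfold turnError; ring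
  unfold turnBound
  rw [a1, a2, a3, ← hEdef]
  have hs : Ψ / (2 * L) ≤ 1 := by rw [div_le_one (by linarith)]; linarith
  have hs' : (m + 1) * (Ψ / (2 * L)) ≤ Ψd / (2 * L) + m * (Ψu / (2 * L)) := by
    have := div_le_div_of_nonneg_right h (show (0 : ℝ) ≤ 2 * L by linarith)
    calc (m + 1) * (Ψ / (2 * L)) = (m + 1) * Ψ / (2 * L) := by ring
      _ ≤ _ := this
      _ = _ := by ring
  set x := Ψ / (2 * L)
  set xd := Ψd / (2 * L)
  set xu := Ψu / (2 * L)
  have hW₁ : 0 ≤ W₁ := le_trans (by positivity) e2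
  have b1 := mul_le_mul_of_nonneg_left hs' hW₁
  have b2 := mul_le_mul_of_nonneg_left e1 (show 0 ≤ 1 + 1 / 192 - x by linarith)
  have b3 : (W₀ + W₁ * (4 / 3 + 3 / 4 * m)) ≤ 1 - p / 12 := by
    have := mul_le_mul_of_nonneg_left hm' hW₁
    nlinarith
  have b4 := mul_le_mul_of_nonneg_left b3 hE
  nlinarith

/-- The variant of `turnBound_step` for the case in which there is certainly no bar to the
parent. -/
theorem turnBound_step' (hp : 0 ≤ p) (hp1 : p ≤ 1) (hhalf : 1 / 2 ≤ (1 - p) ^ D) {m : ℕ}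
    (hm : 2 ≤ m) (hmD : m ≤ D) (hL : 1 ≤ L) {r : ℕ} {Ψ Ψu : ℝ} (hΨ : Ψ ≤ L * (1 / 8))
    (h : Ψ ≤ Ψu) :
    (1 - p) ^ m * turnBound L p Ψ (r + 1) k + (p * (1 - p) ^ (m - 1)) *
      (m * turnBound L p Ψu (r + 2) k) ≤ turnBound L p Ψ (r + 1) (k + 1) := by
  have hL' : (1 : ℝ) ≤ L := by exact_mod_cast hL
  have hm' : (2 : ℝ) ≤ m := by exact_mod_cast hm
  have e1 := pow_add_mul_le_one hp hp1 m
  have e2 : p * (1 / 2) ≤ p * (1 - p) ^ (m - 1) := by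
    refine mul_le_mul_of_nonneg_left (hhalf.trans ?_) hp
    exact pow_le_pow_of_le_one (by linarith) (by linarith) (by omega)
  set W₀ := (1 - p) ^ m
  set W₁ := p * (1 - p) ^ (m - 1)
  have hE := turnError_nonneg (L := L) hp1 (r + 1) k
  set E := turnError L p (r + 1) k with hEdef
  have a1 : turnError L p (r + 1) (k + 1) = (1 - p / 12) * E := by
    rw [hEdef]; unfold turnError; ring
  have a3 : turnError L p (r + 2) k = 3 / 4 * E := by
    rw [hEdef]; unfold turnError; ring
  unfold turnBound
  rw [a1, a3, ← hEdef]
  have hs : Ψ / (2 * L) ≤ 1 := by rw [div_le_one (by linarith)]; linarith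
  have hs' : Ψ / (2 * L) ≤ Ψu / (2 * L) :=
    div_le_div_of_nonneg_right h (show (0 : ℝ) ≤ 2 * L by linarith)
  set x := Ψ / (2 * L)
  set xu := Ψu / (2 * L)
  have hW₁ : 0 ≤ W₁ := le_trans (by positivity) e2
  have b1 := mul_le_mul_of_nonneg_left hs' (show 0 ≤ W₁ * m by positivity)
  have b2 := mul_le_mul_of_nonneg_left e1 (show 0 ≤ 1 + 1 / 192 - x by linarith)
  have b3 : (W₀ + W₁ * (3 / 4 * m)) ≤ 1 - p / 12 := by
    have := mul_le_mul_of_nonneg_left hm' hW₁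
    nlinarith
  have b4 := mul_le_mul_of_nonneg_left b3 hE
  nlinarith

end BranchTree

namespace BranchTree

variable {α : Type*} {D : ℕ} [DecidableEq α] {t : BranchTree α D}
  {S : Type*} [DecidableEq S] [AddCommGroupWithOne S]

variable {M H K L n : ℕ} {p q a y : ℝ} {ρ ρ₀ : α × S → Option Bool} {c v z top : α} {s j : S}
  {k h i r : ℕ} {V : ℕ → (α × S → Option Bool) → α → S → ℝ}

omit [AddCommGroupWithOne S] in
theorem look_false (hnt : ∀ z ∈ t.edges v, ρ (z, j) ≠ some true) :
    ∀ z ∈ t.edges v, t.look ρ v j (fun _ => false) (z, j) = some false := by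
  intro z hz
  by_cases h : ρ (z, j) = none
  · exact look_eq_of_eq_none hz h
  · rw [look_eq_of_ne_none h]; exact eq_some_false_of_ne h (hnt z hz)

omit [AddCommGroupWithOne S] in
theorem look_single (hnt : ∀ z ∈ t.edges v, ρ (z, j) ≠ some true) :
    ∀ z' ∈ t.edges v, z' ≠ z → t.look ρ v j (fun c => decide (c = z)) (z', j) = some false := by
  intro z' hz' hne
  by_cases h : ρ (z', j) = none
  · rw [look_eq_of_eq_none hz' h]; simp [hne]
  · rw [look_eq_of_ne_none h]; exact eq_some_false_of_ne h (hnt z' hz')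

omit [DecidableEq S] in
theorem LevelInv.fits {σ : Status} (hL : t.LevelInv c s (t.depth c + (2 * i + 1)) ρ k v σ)
    (hr : t.depth v + 1 = t.depth c + r) : σ.Fits (2 * i + 2) r := by
  cases σ with
  | ahead => have := hL.1; simp only [Status.Fits]; omega
  | here => have := hL.1; simp only [Status.Fits]; omega
  | passed =>
    obtain ⟨u, w, u', e, f, h1, h2, h3⟩ := hL
    have := h2.depth_le
    have := depth_of_mem_ch h3.mem
    simp only [Status.Fits]; omega
  | lost => trivial

/-- The total weight of the levels. -/
noncomputable def totalWeight (L : ℕ) (st : ℕ → Status) (r : ℕ) : ℝ :=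
  ∑ i ∈ Finset.range L, (st i).weight (2 * i + 2) r

theorem totalWeight_le (st : ℕ → Status) : totalWeight L st r ≤ L * (1 / 8) := by
  refine (Finset.sum_le_card_nsmul _ _ _ fun i _ => Status.weight_le _ _ _).trans ?_
  simp

theorem half_le_turnBound (hp1 : p ≤ 1) (hL : 1 ≤ L) {Ψ : ℝ} (hΨ : Ψ ≤ L * (1 / 8)) :
    1 / 2 ≤ turnBound L p Ψ r k := by
  have hL' : (1 : ℝ) ≤ L := by exact_mod_cast hL
  have h1 := turnError_nonneg (L := L) hp1 r k
  have h2 : Ψ / (2 * L) ≤ 1 / 2 := by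
    rw [div_le_div_iff₀ (by linarith) (by norm_num)]; linarith
  unfold turnBound
  linarith

variable [CharP S M]

/-- The bound for the failure probability during the first turn. -/
theorem Setting.turn_le (hS : Setting t M H n p q a y top c V ρ₀) (hP : Params D M H K L p a)
    {N m : ℕ} {st : ℕ → Status} (hkm : k + m = K)
    (hag : ∀ b, ¬ t.Below c b.1 → ρ b = ρ₀ b) (hv : t.Below c v)
    (hT : t.TurnInv c s ρ k)
    (hL : ∀ i < L, t.LevelInv c s (t.depth c + (2 * i + 1)) ρ k v (st i))
    (hr : t.depth v + 1 = t.depth c + r) (hrL : r ≤ 2 * L + 1) :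
    V N ρ v (s + k) ≤ y * turnBound L p (totalWeight L st r) r m := by
  have hVf := hS.failValue
  have hp := hS.p_nonneg
  have hp1 := hS.p_le_one
  have hy := hS.y_nonneg
  have hM := hP.add_lt
  have hone := hP.one_le
  have hone' : (1 : ℝ) ≤ L := by exact_mod_cast hone
  induction m generalizing N ρ v st r k with
  | zero =>
    have h1 : V N ρ v (s + k) ≤ y := by
      simpa using hS.guardedBound [] N ρ v (s + k) hag hv
    refine h1.trans (le_mul_of_one_le_right hy ?_)
    have h2 : 1 ≤ turnError L p r 0 := by
      unfold turnError
      rw [pow_zero, mul_one]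
      have h3 : ((3 : ℝ) / 4) ^ (2 * L + 1) ≤ (3 / 4) ^ r :=
        pow_le_pow_of_le_one (by norm_num) (by norm_num) hrL
      have h4 : ((3 : ℝ) / 4) ^ (2 * L + 1) * (4 / 3) ^ (2 * L + 1) = 1 := by
        rw [← mul_pow]; norm_num
      calc (1 : ℝ) = (3 / 4) ^ (2 * L + 1) * (4 / 3) ^ (2 * L + 1) := h4.symm
        _ ≤ _ := mul_le_mul_of_nonneg_right h3 (by positivity)
    have h5 := totalWeight_le (L := L) (r := r) st
    have h6 : totalWeight L st r / (2 * L) ≤ 1 / 2 := by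
      rw [div_le_div_iff₀ (by linarith) (by norm_num)]; linarith
    unfold turnBound
    linarith
  | succ m ih =>
    have hvt := hS.below.trans hv
    have hnn : 0 ≤ y * turnBound L p (totalWeight L st r) r (m + 1) := mul_nonneg hy
      (le_trans (by norm_num) (half_le_turnBound hp1 hone (totalWeight_le st)))
    rcases le_or_gt n (t.depth v) with hd | hd
    · exact (hVf.deep N ρ v _ hvt hd).trans hnn
    rcases hrL.eq_or_lt with hrL' | hrL'
    · -- all levels have been reached
      classical
      have key := hS.window_le hP hd (k := k) (by omega) (s := s) (ρ := ρ)
        (fun i => st i = .passed) (N := N) (j := s + k) (m := L) (l := []) le_rfl (by simp)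
        (fun i _ hi hst => by have := hL i hi; rw [hst] at this; exact this) hag hv (by simp)
      refine key.trans (mul_le_mul_of_nonneg_left ?_ hy)
      have hE := turnError_nonneg (L := L) hp1 r (m + 1)
      have hw : totalWeight L st r ≤
          1 / 8 * (((Finset.Ico (L - L) L).filter fun i => st i = .passed).card : ℝ) := by
        rw [Nat.sub_self, ← Finset.range_eq_Ico, Finset.card_filter, Nat.cast_sum,
          Finset.mul_sum]
        refine Finset.sum_le_sum fun i hi => ?_
        have hi' := Finset.mem_range.1 hi
        have hfit := (hL i hi').fits hr
        have hle := Status.weight_le (st i) (2 * i + 2) r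
        cases hst : st i <;> rw [hst] at hfit hle <;> simp only [Status.Fits] at hfit
        · omega
        · omega
        · simpa using hle
        · simp [Status.weight]
      have hw' := div_le_div_of_nonneg_right hw (show (0 : ℝ) ≤ 2 * L by linarith)
      unfold turnBound
      simp only [List.length_nil, Nat.cast_zero, zero_add]
      linarith
    cases N with
    | zero => exact (hVf.zero ρ v _ hvt).trans hnn
    | succ N =>
    obtain ⟨r, rfl⟩ : ∃ r', r = r' + 1 := ⟨r - 1, by have := hv.depth_le; omega⟩
    have hslot : ∀ z ∈ t.edges v, z ≠ c → ρ (z, s + k) = none := fun z hz hne => by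
      by_contra h
      obtain ⟨e, h1, h2⟩ := hT.slot z (hv.of_mem_edges hz) hne _ h
      have := natCast_inj_of_lt (M := M) (by omega) (by omega) (add_left_cancel h2)
      omega
    have hbar : ρ (c, s + k) ≠ some true := fun h => by
      have h1 := hT.bar _ h
      have h2 : ((k + 1 : ℕ) : S) = 0 := by
        have : s + ((k : S) + 1) = s + 0 := by rw [add_zero, ← add_assoc]; exact h1
        push_cast; exact add_left_cancel this
      have := Nat.le_of_dvd (by omega) ((CharP.cast_eq_zero_iff S M _).1 h2)
      omega
    have hnt : ∀ z ∈ t.edges v, ρ (z, s + k) ≠ some true := fun z hz => by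
      by_cases hzc : z = c
      · rw [hzc]; exact hbar
      · rw [hslot z hz hzc]; simp
    have hcast : s + (k : S) + 1 = s + ((k + 1 : ℕ) : S) := by push_cast; abel
    have hchU : t.ch v ⊆ t.unseen ρ v (s + k) := fun z hz => by
      have hz' : z ∈ t.edges v := mem_edges.2 (Or.inr hz)
      refine Finset.mem_filter.2 ⟨hz', hslot z hz' fun h => ?_⟩
      have h1 := depth_of_mem_ch hz
      have h2 := hv.depth_le
      rw [h] at h1; omega
    set X₀ := turnBound L p (totalWeight L st (r + 1)) (r + 1) m with hX₀
    set Xd := turnBound L p (totalWeight L (fun i => (st i).down (2 * i + 2) (r + 1)) r) r m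
      with hXd
    set Xu := turnBound L p (totalWeight L (fun i => (st i).up (2 * i + 2) (r + 1)) (r + 2))
      (r + 2) m with hXu
    have hstep := hVf.step_le hp hp1 hvt hd hnt (N := N) (x₀ := y * X₀)
      (x := fun z => if z = v then y * Xd else y * Xu) (by
        rw [hcast]
        have hf := look_false hnt
        refine ih (by omega) (agree_look hag hv) hv (hT.look hv ?_)
          (fun i hi => (hL i hi).stay hf) hr hrL
        rintro rfl
        rw [hf v (mem_edges.2 (Or.inl rfl))]; simp) (by
        intro z hz
        have hz1 := (Finset.mem_filter.1 hz).1
        have hf := look_single (z := z) hnt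
        rw [hcast]
        by_cases hzv : z = v
        · subst hzv
          rw [if_pos rfl, other_self]
          by_cases hzc : z = c
          · -- the meander leaves the subtree of `c`
            subst hzc
            have hr0 : r = 0 := by omega
            refine (hS.exit N _ _ (agree_look hag hv)).trans (le_mul_of_one_le_right hy ?_)
            have hE := turnError_nonneg (L := L) hp1 r m
            have hw : totalWeight L (fun i => (st i).down (2 * i + 2) (r + 1)) r = 0 := by
              refine Finset.sum_eq_zero fun i hi => ?_
              have hfit := (hL i (Finset.mem_range.1 hi)).fits hr
              change ((st i).down _ _).weight _ _ = 0
              cases hst : st i <;> rw [hst] at hfit <;> simp only [Status.Fits] at hfit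
              · simp [Status.down, Status.weight, hr0]
              · omega
              · omega
              · simp [Status.down, Status.weight]
            rw [hXd, turnBound, hw, zero_div]
            linarith
          · have hpar := (hv.eq_or_par.resolve_left hzc)
            have hdz := depth_of_mem_ch hpar.2
            refine ih (by omega) (agree_look hag hv) hpar.1 (hT.look hv fun h => absurd h hzc)
              (fun i hi => (hL i hi).down hv hzc hf (by omega)) (by omega) (by omega)
        · have hzch : z ∈ t.ch v := (mem_edges.1 hz1).resolve_left hzv
          rw [if_neg hzv, other_of_mem_ch hzch]
          have hdz := depth_of_mem_ch hzch
          refine ih (by omega) (agree_look hag hv) (hv.child hzch) (hT.look hv ?_)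
            (fun i hi => (hL i hi).up hv hzch hf (by omega)) (by omega) (by omega)
          rintro rfl
          rw [hf v (mem_edges.2 (Or.inl rfl)) (Ne.symm hzv)]; simp)
    refine hstep.trans ?_
    have hfits := fun i (hi : i < L) => (hL i hi).fits hr
    have hsumch : ∀ B : ℝ, ∑ z ∈ t.ch v, B * (if z = v then y * Xd else y * Xu) =
        (t.ch v).card * (B * (y * Xu)) := fun B => by
      rw [Finset.sum_congr rfl (g := fun _ => B * (y * Xu)), Finset.sum_const, nsmul_eq_mul]
      intro z hz
      rw [if_neg]
      rintro rfl
      exact not_mem_ch_self z hz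
    by_cases hvU : v ∈ t.unseen ρ v (s + k)
    · have hU : t.unseen ρ v (s + k) = insert v (t.ch v) :=
        Finset.Subset.antisymm (Finset.filter_subset _ _) (Finset.insert_subset hvU hchU)
      rw [hU, Finset.sum_insert (not_mem_ch_self v), hsumch, if_pos rfl,
        Finset.card_insert_of_notMem (not_mem_ch_self v), Nat.add_sub_cancel]
      have key := turnBound_step (k := m) hp hp1 hP.half (t.two_le_card_ch v) (t.card_ch_le v)
        hone (r := r) (Ψ := totalWeight L st (r + 1))
        (Ψd := totalWeight L (fun i => (st i).down (2 * i + 2) (r + 1)) r)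
        (Ψu := totalWeight L (fun i => (st i).up (2 * i + 2) (r + 1)) (r + 2))
        (totalWeight_le st) (by
          unfold totalWeight
          rw [Finset.mul_sum, Finset.mul_sum, ← Finset.sum_add_distrib]
          exact Finset.sum_le_sum fun i hi =>
            Status.weight_step (hfits i (Finset.mem_range.1 hi)) (t.two_le_card_ch v))
      have := mul_le_mul_of_nonneg_left key hy
      rw [← hX₀, ← hXd, ← hXu] at this
      refine le_trans (le_of_eq ?_) this
      ring
    · have hU : t.unseen ρ v (s + k) = t.ch v := by
        refine Finset.Subset.antisymm (fun z hz => ?_) hchU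
        refine (mem_edges.1 (Finset.mem_filter.1 hz).1).resolve_left ?_
        rintro rfl
        exact hvU hz
      rw [hU, hsumch]
      have key := turnBound_step' (k := m) hp hp1 hP.half (t.two_le_card_ch v) (t.card_ch_le v)
        hone (r := r) (Ψ := totalWeight L st (r + 1))
        (Ψu := totalWeight L (fun i => (st i).up (2 * i + 2) (r + 1)) (r + 2))
        (totalWeight_le st) (by
          unfold totalWeight
          exact Finset.sum_le_sum fun i hi =>
            Status.weight_le_up (hfits i (Finset.mem_range.1 hi)))
      have := mul_le_mul_of_nonneg_left key hy
      rw [← hX₀, ← hXu] at this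
      refine le_trans (le_of_eq ?_) this
      ring

/-- With the right parameters, the meander escapes from every unexplored subtree with a
probability of at least `1 / 384`, uniformly in the depth `n` that it has to reach. -/
theorem FailValue.escapeBound (hV : FailValue t p n top V) (hP : Params D M H K L p a)
    (hp : 0 ≤ p) (hp1 : p ≤ 1) (ha1 : a ≤ 1) (ha : a ≤ rescueProb D p (1 / 384) H)
    (hc : t.Below top c) : EscapeBound t V (1 / 384) c := by
  induction hm : n - t.depth c using Nat.strong_induction_on generalizing c with
  | _ m ih =>
  intro N ρ s y hy hfresh hbar hexit
  rcases le_or_gt n (t.depth c) with hd | hd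
  · exact (hV.deep N ρ c s hc hd).trans (mul_nonneg (by norm_num) hy)
  have hS : Setting t M H n p (1 / 384) a y top c V ρ :=
    { failValue := hV
      p_nonneg := hp
      p_le_one := hp1
      q_nonneg := by norm_num
      q_le_one := by norm_num
      a_le_one := ha1
      y_nonneg := hy
      lt := by have := hP.add_lt; omega
      a_le := ha
      below := hc
      escape := fun c' h1 h2 => ih _ (by have := h1.depth_lt h2; omega) (hc.trans h1) rfl
      exit := hexit }
  have key := hS.turn_le hP (N := N) (m := K) (k := 0) (st := fun _ => .ahead) (s := s) (r := 1)
    (by omega) (fun _ _ => rfl) .refl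
    ⟨fun z hz hne j h => absurd (hfresh z hz hne j) h, hbar⟩
    (fun i hi => ⟨by omega, fun z hz => ⟨fun h j => by
      rw [hfresh z hz (by rintro rfl; omega)]; simp, fun h j =>
      hfresh z hz (by rintro rfl; omega) j⟩⟩) rfl (by omega)
  rw [Nat.cast_zero, add_zero] at key
  refine key.trans ?_
  rw [mul_comm]
  refine mul_le_mul_of_nonneg_right ?_ hy
  have hL' : (1 : ℝ) ≤ L := by exact_mod_cast hP.one_le
  have hw : totalWeight L (fun _ => .ahead) 1 / (2 * L) = 1 / 96 := by
    simp only [totalWeight, Status.weight, Finset.sum_const, Finset.card_range, nsmul_eq_mul]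
    field_simp
    norm_num
  have hE := hP.time
  unfold turnBound turnError
  rw [hw, pow_one]
  linarith

end BranchTree

/-! ### Choice of the parameters -/

theorem half_le_one_sub_exp_neg {δ : ℝ} (h0 : 0 ≤ δ) (h1 : δ ≤ 1) :
    δ / 2 ≤ 1 - Real.exp (-δ) := by
  have h2 := Real.add_one_le_exp δ
  have h3 : Real.exp (-δ) ≤ (δ + 1)⁻¹ := by
    rw [Real.exp_neg]
    exact inv_anti₀ (by linarith) h2
  have h4 : (δ + 1)⁻¹ ≤ 1 - δ / 2 := by
    rw [inv_le_iff_one_le_mul₀ (by linarith)]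
    nlinarith
  linarith

namespace BranchTree

/-- For a large time `T` and a fine discretisation into `M` slots, the parameters can be chosen as
required. -/
theorem exists_params (D : ℕ) : ∃ T₀ : ℝ, 0 < T₀ ∧ ∀ T : ℝ, T₀ ≤ T → ∃ M₀ : ℕ, ∀ M : ℕ, M₀ ≤ M →
    ∃ (H K L : ℕ) (a : ℝ), Params D M H K L (1 - Real.exp (-(T / M))) a ∧ a ≤ 1 ∧
      a ≤ rescueProb D (1 - Real.exp (-(T / M))) (1 / 384) H := by
  set a : ℝ := 1 / 384 * (1 / 4 * Real.exp (-(D + 1 : ℝ))) with ha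
  have hexp1 : Real.exp (-(D + 1 : ℝ)) ≤ 1 := Real.exp_le_one_iff.2 (by
    have : (0 : ℝ) ≤ D := Nat.cast_nonneg D
    linarith)
  have hexp0 := Real.exp_pos (-(D + 1 : ℝ))
  have ha0 : 0 < a := by positivity
  have ha1 : a ≤ 1 := by rw [ha]; linarith
  obtain ⟨m₀, hm₀⟩ := exists_pow_lt_of_lt_one (show (0 : ℝ) < 1 / 2 by norm_num)
    (show 1 - a < 1 by linarith)
  set L : ℕ := 96 * m₀ + 1 with hL
  set C : ℝ := 3 / 4 * (4 / 3) ^ (2 * L + 1) * 192 with hC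
  have hC0 : 0 < C := by positivity
  have hlim : Tendsto (fun T : ℝ => C * Real.exp (-((T - 3) / 24))) atTop (𝓝 0) := by
    have h1 : Tendsto (fun T : ℝ => (T - 3) / 24) atTop atTop :=
      (tendsto_atTop_add_const_right _ (-3) tendsto_id).atTop_div_const (by norm_num)
    simpa using (Real.tendsto_exp_neg_atTop_nhds_zero.comp h1).const_mul C
  obtain ⟨T₁, hT₁⟩ := eventually_atTop.1 (hlim.eventually (ge_mem_nhds zero_lt_one))
  refine ⟨max T₁ 4, by positivity, fun T hT => ?_⟩
  have hT1 := hT₁ T ((le_max_left _ _).trans hT)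
  have hT4 : 4 ≤ T := (le_max_right _ _).trans hT
  refine ⟨⌈2 * T * (D + 1)⌉₊ + 1, fun M hM => ?_⟩
  have hM1 : 2 * T * (D + 1) ≤ M := by
    have h1 := Nat.le_ceil (2 * T * (D + 1))
    have h2 : ((⌈2 * T * (D + 1)⌉₊ + 1 : ℕ) : ℝ) ≤ M := by exact_mod_cast hM
    push_cast at h2
    linarith
  have hM0 : (0 : ℝ) < M := by
    have : 0 < M := by omega
    exact_mod_cast this
  set δ := T / M with hδ
  have hδ0 : 0 < δ := by positivity
  have hδM : δ * M = T := by rw [hδ]; field_simp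
  have hδD : δ * (D + 1) ≤ 1 / 2 := by
    have : δ * (D + 1) * M ≤ 1 / 2 * M := by
      calc δ * (D + 1) * M = (δ * M) * (D + 1) := by ring
        _ = T * (D + 1) := by rw [hδM]
        _ ≤ _ := by linarith
    exact le_of_mul_le_mul_right this hM0
  have hD0 : (0 : ℝ) ≤ D := Nat.cast_nonneg D
  have hδ2 : δ ≤ 1 / 2 := by nlinarith
  have hp2 := half_le_one_sub_exp_neg hδ0.le (by linarith)
  have hpow : ∀ k : ℕ, (1 - (1 - Real.exp (-δ))) ^ k = Real.exp (-(δ * k)) := fun k => by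
    rw [sub_sub_cancel, ← Real.exp_nat_mul]; congr 1; ring
  set H := ⌊(M : ℝ) / T⌋₊ with hH
  have hH1 : δ * H ≤ 1 := by
    have h1 : (H : ℝ) ≤ M / T := Nat.floor_le (by positivity)
    calc δ * H ≤ δ * (M / T) := mul_le_mul_of_nonneg_left h1 hδ0.le
      _ = 1 := by rw [hδ]; field_simp
  have hH2 : 1 / 2 ≤ δ * H := by
    have h1 : (M : ℝ) / T ≤ H + 1 := (Nat.lt_floor_add_one _).le
    have h2 : (1 : ℝ) ≤ δ * (H + 1) := by
      calc (1 : ℝ) = δ * (M / T) := by rw [hδ]; field_simp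
        _ ≤ _ := mul_le_mul_of_nonneg_left h1 hδ0.le
    linarith
  have hHM : H + 3 ≤ M := by
    have h1 : δ * (H + 3) ≤ δ * M := by rw [hδM]; linarith
    exact_mod_cast le_of_mul_le_mul_left h1 hδ0
  refine ⟨H, M - (H + 3), L, a, ⟨?_, ?_, by omega, ?_, by omega, fun m hm => ?_⟩, ha1, ?_⟩
  · rw [hpow]
    have := Real.add_one_le_exp (-(δ * D))
    linarith
  · rw [hpow]
    have h1 : -(3 / 2 : ℝ) ≤ -(δ * (H + 1 : ℕ)) := by push_cast; linarith
    have h2 : (1 / 8 : ℝ) ≤ Real.exp (-(3 / 2)) := by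
      have h3 : Real.exp (-(1 / 2)) ^ 3 = Real.exp (-(3 / 2)) := by
        rw [← Real.exp_nat_mul]; norm_num
      have h4 := Real.add_one_le_exp (-(1 / 2) : ℝ)
      rw [← h3]
      calc (1 / 8 : ℝ) = (1 / 2) ^ 3 := by norm_num
        _ ≤ _ := pow_le_pow_left₀ (by norm_num) (by linarith) 3
    exact h2.trans (Real.exp_le_exp.2 h1)
  · set p := 1 - Real.exp (-δ)
    have hp1 : p ≤ 1 := by have := Real.exp_pos (-δ); linarith
    have h1 : (1 - p / 12) ^ (M - (H + 3)) ≤ Real.exp (-((T - 3) / 24)) := by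
      have h2 : 1 - p / 12 ≤ Real.exp (-(p / 12)) := by
        have := Real.add_one_le_exp (-(p / 12)); linarith
      refine (pow_le_pow_left₀ (by linarith) h2 _).trans ?_
      rw [← Real.exp_nat_mul, Real.exp_le_exp, Nat.cast_sub hHM]
      push_cast
      have h3 : T - 3 ≤ δ * (M - (H + 3)) := by
        rw [mul_sub, hδM]; linarith
      have h4 : (0 : ℝ) ≤ M - (H + 3) := by
        have : ((H + 3 : ℕ) : ℝ) ≤ M := by exact_mod_cast hHM
        push_cast at this; linarith
      nlinarith
    have h5 := mul_le_mul_of_nonneg_left h1 hC0.le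
    have h6 : C * (1 - p / 12) ^ (M - (H + 3)) ≤ 1 := h5.trans hT1
    rw [hC] at h6
    linarith
  · have h1 : (m₀ : ℝ) ≤ m := by
      rw [hL] at hm; push_cast at hm; linarith
    have h2 : m₀ ≤ m := by exact_mod_cast h1
    exact (pow_le_pow_of_le_one (by linarith) (by linarith) h2).trans hm₀.le
  · rw [rescueProb, hpow, ha]
    refine mul_le_mul_of_nonneg_left ?_ (by norm_num)
    have h1 : Real.exp (-(D + 1 : ℝ)) ≤ Real.exp (-(δ * ((D + 1) * H : ℕ))) := by
      rw [Real.exp_le_exp]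
      push_cast
      nlinarith
    have h2 : (1 / 4 : ℝ) ≤ H * (1 - Real.exp (-δ)) := by
      have := mul_le_mul_of_nonneg_left hp2 (Nat.cast_nonneg (α := ℝ) H)
      linarith
    calc 1 / 4 * Real.exp (-(D + 1 : ℝ)) ≤
        (H * (1 - Real.exp (-δ))) * Real.exp (-(δ * ((D + 1) * H : ℕ))) :=
          mul_le_mul h2 h1 hexp0.le (by linarith)
      _ = _ := by ring

end BranchTree

/-! ### Finitely many independent bits -/

/-- The weight of an outcome of a single bit. -/
def bitWeight (p : ℝ) (v : Bool) : ℝ := if v then p else 1 - p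

/-- The expectation of a function of independent bits that are `true` with probability `p`. -/
noncomputable def bitMean {ι : Type*} [Fintype ι] [DecidableEq ι] (p : ℝ) (F : (ι → Bool) → ℝ) :
    ℝ :=
  ∑ g : ι → Bool, (∏ b, bitWeight p (g b)) * F g

open Classical in
/-- The number `1` or `0`, according to whether `P` is true or false. -/
noncomputable def truthValue (P : Prop) : ℝ := if P then 1 else 0

theorem truthValue_nonneg (P : Prop) : 0 ≤ truthValue P := by
  unfold truthValue; split_ifs <;> norm_num

theorem truthValue_le_one (P : Prop) : truthValue P ≤ 1 := by
  unfold truthValue; split_ifs <;> norm_num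

theorem truthValue_mono {P Q : Prop} (h : P → Q) : truthValue P ≤ truthValue Q := by
  unfold truthValue
  by_cases hP : P
  · rw [if_pos hP, if_pos (h hP)]
  · rw [if_neg hP]; split_ifs <;> norm_num

section
variable {ι : Type*} [Fintype ι] [DecidableEq ι] {p : ℝ}

theorem bitMean_one : bitMean (ι := ι) p (fun _ => 1) = 1 := by
  have h := Finset.prod_univ_sum (fun _ : ι => (Finset.univ : Finset Bool))
    (fun _ v => bitWeight p v)
  simp only [Fintype.piFinset_univ] at h
  simp only [bitMean, mul_one]
  rw [← h]
  simp [bitWeight]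

theorem bitMean_mono (hp : 0 ≤ p) (hp1 : p ≤ 1) {F F' : (ι → Bool) → ℝ} (h : ∀ g, F g ≤ F' g) :
    bitMean p F ≤ bitMean p F' := by
  refine Finset.sum_le_sum fun g _ => mul_le_mul_of_nonneg_left (h g) ?_
  refine Finset.prod_nonneg fun b _ => ?_
  unfold bitWeight
  split_ifs <;> linarith

/-- Averaging over the value of a single bit. -/
theorem bitMean_update (b : ι) (F : (ι → Bool) → ℝ) :
    bitMean p F = p * bitMean p (fun g => F (Function.update g b true)) +
      (1 - p) * bitMean p (fun g => F (Function.update g b false)) := by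
  have hsplit : ∀ F : (ι → Bool) → ℝ, bitMean p F =
      ∑ h : {j // j ≠ b} → Bool, (∏ j, bitWeight p (h j)) *
        (p * F ((Equiv.funSplitAt b Bool).symm (true, h)) +
          (1 - p) * F ((Equiv.funSplitAt b Bool).symm (false, h))) := fun F => by
    have hW : ∀ v h, ∏ j, bitWeight p ((Equiv.funSplitAt b Bool).symm (v, h) j) =
        bitWeight p v * ∏ j, bitWeight p (h j) := fun v h => by
      rw [Fintype.prod_eq_mul_prod_subtype_ne _ b]
      congr 1
      · simp [Equiv.funSplitAt, Equiv.piSplitAt]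
      · refine Finset.prod_congr rfl fun j _ => ?_
        simp [Equiv.funSplitAt, Equiv.piSplitAt, j.2]
    rw [bitMean, ← (Equiv.funSplitAt b Bool).symm.sum_comp, Fintype.sum_prod_type_right]
    refine Finset.sum_congr rfl fun h _ => ?_
    rw [Fintype.sum_bool, hW, hW]
    simp only [bitWeight]
    simp
    ring
  have hupd : ∀ v w h, Function.update ((Equiv.funSplitAt b Bool).symm (w, h)) b v =
      (Equiv.funSplitAt b Bool).symm (v, h) := fun v w h => by
    funext j
    by_cases hj : j = b
    · subst hj; simp [Equiv.funSplitAt, Equiv.piSplitAt]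
    · simp [Equiv.funSplitAt, Equiv.piSplitAt, hj]
  rw [hsplit F, hsplit fun g => F (Function.update g b true),
    hsplit fun g => F (Function.update g b false), Finset.mul_sum, Finset.mul_sum,
    ← Finset.sum_add_distrib]
  refine Finset.sum_congr rfl fun h _ => ?_
  simp only [hupd]
  ring

end

namespace BranchTree

variable {α : Type*} {D : ℕ} [DecidableEq α] {t : BranchTree α D}
  {S : Type*} [DecidableEq S] [AddCommGroupWithOne S]

/-- The meander that is at `v` at the beginning of the slot `j` reaches the parent of `top` within
`N` steps, before it reaches the depth `n` and before it meets two simultaneous bars. -/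
def Fails (t : BranchTree α D) (n : ℕ) (top : α) (ω : α × S → Bool) : ℕ → α → S → Prop
  | 0, v, _ => v = t.par top
  | N + 1, v, j => v = t.par top ∨ (t.depth v < n ∧
      (((∀ z ∈ t.edges v, ω (z, j) = false) ∧ Fails t n top ω N v (j + 1)) ∨
        ∃ z ∈ t.edges v, ω (z, j) = true ∧ (∀ z' ∈ t.edges v, z' ≠ z → ω (z', j) = false) ∧
          Fails t n top ω N (t.other v z) (j + 1)))

/-- The values of all bits, if the partial information `ρ` is completed by the bits `g` in the
finite set `B`; the remaining bits are irrelevant. -/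
def fillIn (B : Finset (α × S)) (ρ : α × S → Option Bool) (g : B → Bool) : α × S → Bool :=
  fun b => (ρ b).getD (if h : b ∈ B then g ⟨b, h⟩ else false)

/-- The conditional failure probability of the meander, given the partial information `ρ`. -/
noncomputable def failProb (t : BranchTree α D) (p : ℝ) (n : ℕ) (top : α) (B : Finset (α × S))
    (N : ℕ) (ρ : α × S → Option Bool) (v : α) (j : S) : ℝ :=
  bitMean p fun g : B → Bool => truthValue (t.Fails n top (fillIn B ρ g) N v j)

variable {p : ℝ} {n : ℕ} {top : α} {B : Finset (α × S)}

omit [AddCommGroupWithOne S] in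
theorem fillIn_update {ρ : α × S → Option Bool} {b : α × S} (hb : b ∈ B) (hρ : ρ b = none)
    (g : B → Bool) (v : Bool) :
    fillIn B ρ (Function.update g ⟨b, hb⟩ v) = fillIn B (Function.update ρ b (some v)) g := by
  funext x
  by_cases hx : x = b
  · subst hx; simp [fillIn, hρ, hb]
  · simp only [fillIn, Function.update_of_ne hx]
    congr 1
    split_ifs with h
    · rw [Function.update_of_ne]
      intro h'
      exact hx (congrArg Subtype.val h')
    · rfl

omit [AddCommGroupWithOne S] in
theorem fillIn_of_eq_some {ρ : α × S → Option Bool} {b : α × S} {v : Bool} (h : ρ b = some v)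
    (g : B → Bool) : fillIn B ρ g b = v := by
  simp [fillIn, h]

/-- The failure probabilities of the meander driven by independent bits satisfy the rules, provided
that all bits it can look at are among those averaged over. -/
theorem failValue_failProb (hp : 0 ≤ p) (hp1 : p ≤ 1) (htop : top ∈ t.ch (t.par top))
    (hB : ∀ b : α × S, t.Below top b.1 → t.depth b.1 ≤ n → b ∈ B) :
    FailValue t p n top (t.failProb p n top B) := by
  have hne : ∀ v, t.Below top v → v ≠ t.par top := fun v hv h => by
    have h1 := hv.depth_le
    have h2 := depth_of_mem_ch htop
    rw [h] at h1; omega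
  have hzero : ∀ N ρ v (j : S), (∀ g, ¬ t.Fails n top (fillIn B ρ g) N v j) →
      t.failProb p n top B N ρ v j ≤ 0 := fun N ρ v j h => by
    unfold failProb bitMean
    simp [h, truthValue]
  have hmono : ∀ N ρ v (j : S) N' v' (j' : S), (∀ g, t.Fails n top (fillIn B ρ g) N v j →
      t.Fails n top (fillIn B ρ g) N' v' j') →
      t.failProb p n top B N ρ v j ≤ t.failProb p n top B N' ρ v' j' :=
    fun N ρ v j N' v' j' h => by
    exact bitMean_mono hp hp1 fun g => truthValue_mono (h g)
  refine ⟨fun N ρ v j => ?_, fun N ρ v j => ?_, fun N v j ρ b hb hρ => ?_, fun N ρ v j hv hd => ?_,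
    fun ρ v j hv => ?_, fun N ρ v j hv hd hf => ?_, fun N ρ v j hv hd z hz hzt hf => ?_,
    fun N ρ v j hv hd z hz z' hz' hzz ht ht' => ?_⟩
  · have : bitMean (ι := B) p (fun _ => 0) ≤ t.failProb p n top B N ρ v j :=
      bitMean_mono hp hp1 fun g => truthValue_nonneg _
    simpa [bitMean] using this
  · rw [← bitMean_one (ι := B) (p := p)]
    exact bitMean_mono hp hp1 fun g => truthValue_le_one _
  · have hbB := hB b hb.1 hb.2
    simp only [failProb]
    rw [bitMean_update ⟨b, hbB⟩]
    simp only [fillIn_update hbB hρ]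
  · refine hzero _ _ _ _ fun g h => ?_
    cases N with
    | zero => exact hne v hv h
    | succ N =>
      rcases h with h | h
      · exact hne v hv h
      · exact absurd h.1 (not_lt.2 hd)
  · exact hzero _ _ _ _ fun g h => hne v hv h
  · refine hmono _ _ _ _ _ _ _ fun g h => ?_
    rcases h with h | ⟨-, ⟨-, h⟩ | ⟨z, hz, hzt, -⟩⟩
    · exact absurd h (hne v hv)
    · exact h
    · rw [fillIn_of_eq_some (hf z hz)] at hzt; simp at hzt
  · refine hmono _ _ _ _ _ _ _ fun g h => ?_
    rcases h with h | ⟨-, ⟨h, -⟩ | ⟨z', hz', hzt', -, h⟩⟩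
    · exact absurd h (hne v hv)
    · have := h z hz
      rw [fillIn_of_eq_some hzt] at this; simp at this
    · by_cases hzz : z' = z
      · rwa [hzz] at h
      · rw [fillIn_of_eq_some (hf z' hz' hzz)] at hzt'; simp at hzt'
  · refine hzero _ _ _ _ fun g h => ?_
    rcases h with h | ⟨-, ⟨h, -⟩ | ⟨x, hx, hxt, h, -⟩⟩
    · exact hne v hv h
    · have := h z hz
      rw [fillIn_of_eq_some ht] at this; simp at this
    · by_cases hxz : x = z
      · have := h z' hz' (by rw [hxz]; exact hzz.symm)
        rw [fillIn_of_eq_some ht'] at this; simp at this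
      · have := h z hz (Ne.symm hxz)
        rw [fillIn_of_eq_some ht] at this; simp at this

end BranchTree

/-! ### Independent trials -/

section
variable {Ω ι : Type*} {mΩ : MeasurableSpace Ω} {μ : Measure Ω} {X : ι → Ω → Bool} {p : ℝ}

/-- Events that depend on disjoint finite sets of independent bits are independent. -/
theorem measureReal_forall_eq_prod {κ : Type*} [IsProbabilityMeasure μ] (hX : iIndepFun X μ)
    (hm : ∀ i, AEMeasurable (X i) μ) (B : κ → Finset ι) (E : ∀ c, Set (B c → Bool)) (F : Finset κ)
    (hd : (F : Set κ).PairwiseDisjoint B) :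
    μ.real {ω | ∀ c ∈ F, (fun b : B c => X b ω) ∈ E c} =
      ∏ c ∈ F, μ.real {ω | (fun b : B c => X b ω) ∈ E c} := by
  classical
  induction F using Finset.induction_on with
  | empty => simp
  | insert c F hc ih =>
    rw [Finset.prod_insert hc, ← ih (hd.subset (by simp))]
    have hdisj : Disjoint (B c) (F.biUnion B) := by
      rw [Finset.disjoint_biUnion_right]
      intro c' hc'
      exact hd (by simp) (by simp [hc']) fun h => hc (h ▸ hc')
    have h := (hX.indepFun_finset₀ (B c) (F.biUnion B) hdisj hm).measure_inter_preimage_eq_mul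
      (E c) {g | ∀ c', ∀ h : c' ∈ F, (fun b : B c' =>
        g ⟨b, Finset.mem_biUnion.2 ⟨c', h, b.2⟩⟩) ∈ E c'} (Set.toFinite _).measurableSet
      (Set.toFinite _).measurableSet
    rw [measureReal_def, measureReal_def, measureReal_def, ← ENNReal.toReal_mul]
    congr 1
    refine Eq.trans ?_ h
    congr 1
    ext ω
    simp only [Finset.mem_insert, forall_eq_or_imp]
    rfl

/-- The probability of an event that depends on finitely many independent bits. -/
theorem measureReal_eq_bitMean [Fintype ι] [DecidableEq ι] [IsProbabilityMeasure μ]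
    (hX : iIndepFun X μ)
    (hm : ∀ i, AEMeasurable (X i) μ) (hp : ∀ i, μ.real (X i ⁻¹' {true}) = p)
    (Q : (ι → Bool) → Prop) :
    μ.real {ω | Q fun i => X i ω} = bitMean p fun g => truthValue (Q g) := by
  classical
  have hf : ∀ i, μ.real (X i ⁻¹' {false}) = 1 - p := fun i => by
    rw [← hp i, ← probReal_compl_eq_one_sub₀ ((hm i).nullMeasurable (measurableSet_singleton _))]
    congr 1
    ext ω
    simp
  have hw : ∀ i v, μ.real (X i ⁻¹' {v}) = bitWeight p v := fun i v => by
    cases v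
    · simpa [bitWeight] using hf i
    · simpa [bitWeight] using hp i
  have hmv : AEMeasurable (fun ω i => X i ω) μ := aemeasurable_pi_lambda _ hm
  have hs := sum_measureReal_preimage_singleton (μ := μ.map fun ω i => X i ω)
    (Finset.univ.filter Q) (f := id) (fun y _ => (Set.toFinite _).measurableSet)
  have h1 : μ.real {ω | Q fun i => X i ω} = (μ.map fun ω i => X i ω).real
      (Finset.univ.filter Q : Finset (ι → Bool)) := by
    rw [map_measureReal_apply_of_aemeasurable hmv (Set.toFinite _).measurableSet]
    congr 1
    ext ω
    simp
  rw [h1]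
  simp only [Set.preimage_id] at hs
  rw [← hs, bitMean, Finset.sum_filter]
  refine Finset.sum_congr rfl fun g _ => ?_
  have h2 : (μ.map fun ω i => X i ω).real {g} = ∏ i, bitWeight p (g i) := by
    rw [map_measureReal_apply_of_aemeasurable hmv (Set.toFinite _).measurableSet, measureReal_def]
    have := hX.measure_inter_preimage_eq_mul Finset.univ (sets := fun i => {g i})
      (fun i _ => measurableSet_singleton _)
    have e : (fun ω i => X i ω) ⁻¹' {g} = ⋂ i ∈ Finset.univ, X i ⁻¹' {g i} := by
      ext ω; simp [funext_iff]
    rw [e, this, ENNReal.toReal_prod]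
    exact Finset.prod_congr rfl fun i _ => hw i _
  rw [truthValue]
  split_ifs
  · rw [h2, mul_one]
  · simp

end

namespace BranchTree

variable {α : Type*} {D : ℕ} [DecidableEq α] {t : BranchTree α D} {M : ℕ}

/-- The trial at `c` starts in the slot `0`, with the information that the edge above `c` has a bar
in the slot `-1`: the meander cannot return to its initial state without passing the parent. -/
def initial (c : α) : α × ZMod M → Option Bool := fun b => if b = (c, -1) then some true else none

variable {H K L n : ℕ} {p a : ℝ} {Ω : Type*} {mΩ : MeasurableSpace Ω} {μ : Measure Ω}

theorem failProb_initial_le (hP : Params D M H K L p a) (hp : 0 ≤ p) (hp1 : p ≤ 1) (ha1 : a ≤ 1)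
    (ha : a ≤ rescueProb D p (1 / 384) H) {c : α} (hc : c ∈ t.ch (t.par c))
    {B : Finset (α × ZMod M)}
    (hB : ∀ b : α × ZMod M, t.Below c b.1 → t.depth b.1 ≤ n → b ∈ B) (N : ℕ) :
    t.failProb p n c B N (initial c) c 0 ≤ 383 / 384 := by
  have hV := failValue_failProb hp hp1 hc hB
  have := hV.escapeBound hP hp hp1 ha1 ha Below.refl N (initial c) 0 1 zero_le_one
    (fun z hz hne j => if_neg fun h => hne (congrArg Prod.fst h)) (fun j hj => ?_)
    (fun N ρ j _ => hV.le_one N ρ _ j)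
  · refine this.trans (by norm_num)
  · by_contra h
    refine absurd hj ?_
    rw [initial, if_neg]
    · simp
    · intro h'
      have := congrArg Prod.snd h'
      simp only at this
      exact h (by rw [this]; ring)

/-- Trials at different vertices of the same depth fail independently. -/
theorem measureReal_forall_fails_le [IsProbabilityMeasure μ] (hP : Params D M H K L p a)
    (hp : 0 ≤ p) (hp1 : p ≤ 1) (ha1 : a ≤ 1) (ha : a ≤ rescueProb D p (1 / 384) H)
    {I : Set (α × ZMod M)} {X : α × ZMod M → Ω → Bool}
    (hX : iIndepFun (fun b : I => X b) μ) (hm : ∀ b ∈ I, AEMeasurable (X b) μ)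
    (hXp : ∀ b ∈ I, μ.real (X b ⁻¹' {true}) = p) {F : Finset α} {m : ℕ}
    (hF : ∀ c ∈ F, t.depth c = m ∧ c ∈ t.ch (t.par c)) (B : α → Finset (α × ZMod M))
    (hB : ∀ c b, b ∈ B c ↔ t.Below c b.1 ∧ t.depth b.1 ≤ n)
    (hI : ∀ c ∈ F, ∀ b ∈ B c, b ∈ I) (N : α → ℕ) :
    μ.real {ω | ∀ c ∈ F, t.Fails n c (fillIn (B c) (initial c) fun b => X b ω) (N c) c 0} ≤
      (383 / 384) ^ F.card := by
  classical
  have h := measureReal_forall_eq_prod hX (fun b => hm b b.2) (fun c => (B c).subtype (· ∈ I))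
    (fun c => {g | ∀ h : c ∈ F, t.Fails n c (fillIn (B c) (initial c) fun b =>
      g ⟨⟨b, hI c h b b.2⟩, by simp⟩) (N c) c 0}) F ?_
  · have e : {ω | ∀ c ∈ F, t.Fails n c (fillIn (B c) (initial c) fun b => X b ω) (N c) c 0} =
        {ω | ∀ c ∈ F, ∀ h : c ∈ F,
          t.Fails n c (fillIn (B c) (initial c) fun b => X b ω) (N c) c 0} := by
      ext ω
      exact ⟨fun h c hc _ => h c hc, fun h c hc => h c hc hc⟩
    rw [e]
    refine (le_of_eq h).trans ?_
    rw [← Finset.prod_const]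
    refine Finset.prod_le_prod (fun c _ => measureReal_nonneg) fun c hc => ?_
    have hb := measureReal_eq_bitMean (X := fun b : B c => X b)
      (hX.precomp (g := fun b : B c => (⟨b, hI c hc b b.2⟩ : I))
        fun b b' h => Subtype.ext (congrArg (fun x : I => x.1) h))
      (fun b => hm b (hI c hc b b.2)) (fun b => hXp b (hI c hc b b.2))
      (fun g => t.Fails n c (fillIn (B c) (initial c) g) (N c) c 0)
    refine le_trans (le_of_eq ?_) (hb.le.trans (failProb_initial_le hP hp hp1 ha1 ha (hF c hc).2
      (fun b h1 h2 => (hB c b).2 ⟨h1, h2⟩) (N c)))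
    congr 1
    ext ω
    exact ⟨fun h => h hc, fun h _ => h⟩
  · intro c hc c' hc' hne
    rw [Function.onFun, Finset.disjoint_left]
    intro b hb hb'
    rw [Finset.mem_subtype, hB] at hb hb'
    exact hne (hb.1.eq_of_depth_eq hb'.1 ((hF c hc).1.trans (hF c' hc').1.symm))

end BranchTree

/-! ### Trials that do not fail reach a great depth -/

namespace BranchTree

variable {α : Type*} {D : ℕ} [DecidableEq α] {t : BranchTree α D} {S : Type*}

/-- The meander moves from `v` to `w` in the slot `j`. -/
def Moves (t : BranchTree α D) (ω : α × S → Bool) (v : α) (j : S) (w : α) : Prop :=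
  ((∀ z ∈ t.edges v, ω (z, j) = false) ∧ w = v) ∨
    ∃ z ∈ t.edges v, ω (z, j) = true ∧ w = t.other v z

/-- In every slot there is at most one bar below `c` up to the depth `n`. -/
def Sparse (t : BranchTree α D) (ω : α × S → Bool) (c : α) (n : ℕ) : Prop :=
  ∀ j z z', t.Below c z → t.depth z ≤ n → t.Below c z' → t.depth z' ≤ n →
    ω (z, j) = true → ω (z', j) = true → z = z'

variable {ω : α × S → Bool} {c v v' w : α} {n : ℕ} {j : S}

/-- The meander is reversible: its position determines the previous one. -/
theorem Sparse.eq_of_moves (h : t.Sparse ω c n) (hc : c ∈ t.ch (t.par c)) (hv : t.Below c v)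
    (hv' : t.Below c v') (hd : t.depth v < n) (hd' : t.depth v' < n) (hw : t.Below c w)
    (hm : t.Moves ω v j w) (hm' : t.Moves ω v' j w) : v = v' := by
  have key : ∀ v z, t.Below c v → z ∈ t.edges v → t.Below c (t.other v z) →
      z ∈ t.edges (t.other v z) := fun v z hv hz hw => by
    rcases mem_edges.1 hz with rfl | hz
    · rw [other_self] at hw ⊢
      rcases hv.eq_or_par with rfl | h
      · have := hw.depth_le; have := depth_of_mem_ch hc; omega
      · exact mem_edges.2 (Or.inr h.2)
    · rw [other_of_mem_ch hz]; exact mem_edges.2 (Or.inl rfl)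
  rcases hm with ⟨h0, rfl⟩ | ⟨z, hz, hzt, rfl⟩ <;> rcases hm' with ⟨h0', h1⟩ | ⟨z', hz', hzt', h1⟩
  · exact h1
  · have := h0 z' (h1 ▸ key v' z' hv' hz' (h1 ▸ hw))
    rw [hzt'] at this; simp at this
  · have := h0' z (h1 ▸ key v z hv hz hw)
    rw [hzt] at this; simp at this
  · have := h j z z' (hv.of_mem_edges hz) ((depth_le_of_mem_edges hz).trans hd)
      (hv'.of_mem_edges hz') ((depth_le_of_mem_edges hz').trans hd') hzt hzt'
    subst this
    rcases mem_edges.1 hz with rfl | hz <;> rcases mem_edges.1 hz' with e | hz'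
    · exact e
    · rw [other_self, other_of_mem_ch hz', par_of_mem_ch hz'] at h1
      subst h1; exact absurd hz' (not_mem_ch_self _)
    · subst e
      rw [other_self, other_of_mem_ch hz, par_of_mem_ch hz] at h1
      subst h1; exact absurd hz (not_mem_ch_self _)
    · rw [← par_of_mem_ch hz, par_of_mem_ch hz']

variable [AddCommGroupWithOne S]

/-- A path of the meander that starts at `v` at the beginning of the slot `j`, and stays below `c`
and above the depth `n` until its last step. -/
structure IsPath (t : BranchTree α D) (ω : α × S → Bool) (c : α) (n : ℕ) (v : α) (j : S) (k : ℕ)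
    (x : ℕ → α) : Prop where
  zero : x 0 = v
  below : ∀ i ≤ k, t.Below c (x i)
  depth_lt : ∀ i < k, t.depth (x i) < n
  moves : ∀ i < k, t.Moves ω (x i) (j + i) (x (i + 1))

theorem exists_isPath_of_not_fails (h : t.Sparse ω c n) (N : ℕ) (hv : t.Below c v)
    (hf : ¬ t.Fails n c ω N v j) :
    ∃ k x, t.IsPath ω c n v j k x ∧ (k = N ∨ n ≤ t.depth (x k)) := by
  induction N generalizing v j with
  | zero =>
    exact ⟨0, fun _ => v, ⟨rfl, fun _ _ => hv, fun _ h => absurd h (by simp),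
      fun _ h => absurd h (by simp)⟩, Or.inl rfl⟩
  | succ N ih =>
    rcases le_or_gt n (t.depth v) with hd | hd
    · exact ⟨0, fun _ => v, ⟨rfl, fun _ _ => hv, fun _ h => absurd h (by simp),
        fun _ h => absurd h (by simp)⟩, Or.inr hd⟩
    have hne : v ≠ t.par c := fun h => hf (Or.inl h)
    have ext : ∀ w, t.Below c w → t.Moves ω v j w → ¬ t.Fails n c ω N w (j + 1) →
        ∃ k x, t.IsPath ω c n v j k x ∧ (k = N + 1 ∨ n ≤ t.depth (x k)) := fun w hw hm hf => by
      obtain ⟨k, x, hx, hk⟩ := ih hw hf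
      refine ⟨k + 1, fun i => if i = 0 then v else x (i - 1), ⟨by simp, fun i hi => ?_,
        fun i hi => ?_, fun i hi => ?_⟩, ?_⟩
      · cases i with
        | zero => simpa using hv
        | succ i => simpa using hx.below i (by omega)
      · cases i with
        | zero => simpa using hd
        | succ i => simpa using hx.depth_lt i (by omega)
      · cases i with
        | zero => simpa [hx.zero] using hm
        | succ i =>
          have := hx.moves i (by omega)
          simp only [Nat.add_eq_zero_iff, one_ne_zero, and_false, if_false, Nat.add_sub_cancel]
          convert this using 1
          push_cast; abel
      · rcases hk with rfl | hk
        · exact Or.inl rfl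
        · right; simpa using hk
    by_cases h0 : ∀ z ∈ t.edges v, ω (z, j) = false
    · exact ext v hv (Or.inl ⟨h0, rfl⟩) fun h' => hf (Or.inr ⟨hd, Or.inl ⟨h0, h'⟩⟩)
    · push Not at h0
      obtain ⟨z, hz, hzt⟩ := h0
      rw [ne_eq, Bool.not_eq_false] at hzt
      have hf' : ¬ t.Fails n c ω N (t.other v z) (j + 1) := fun h' => by
        refine hf (Or.inr ⟨hd, Or.inr ⟨z, hz, hzt, fun z' hz' hne => ?_, h'⟩⟩)
        by_contra hzt'
        rw [Bool.not_eq_false] at hzt'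
        exact hne (h j z' z (hv.of_mem_edges hz') ((depth_le_of_mem_edges hz').trans hd)
          (hv.of_mem_edges hz) ((depth_le_of_mem_edges hz).trans hd) hzt' hzt)
      have hnp : t.other v z ≠ t.par c := fun h' => by
        cases N <;> exact hf' (by simp [Fails, h'])
      refine ext _ (hv.other hz fun e => ?_) (Or.inr ⟨z, hz, hzt, rfl⟩) hf'
      rintro rfl
      rw [e, other_self] at hnp
      exact hnp rfl

variable {M : ℕ} {ω : α × ZMod M → Bool}

/-- A trial at `c` that does not fail, in an environment without simultaneous bars and without
bars in the last slot: the meander cannot run in a loop, because it would have to complete the loop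
by entering the subtree of `c` in the last slot. Hence it reaches the depth `n`. -/
theorem exists_isPath_le_depth (hc : c ∈ t.ch (t.par c)) {B : Finset (α × ZMod M)}
    (hB : ∀ b, b ∈ B ↔ t.Below c b.1 ∧ t.depth b.1 ≤ n) (h : t.Sparse ω c n)
    (hlast : ∀ z, t.Below c z → t.depth z ≤ n → ω (z, -1) = false)
    (hf : ¬ t.Fails n c (fillIn B (initial c) fun b => ω b) (B.card + 1) c 0) :
    ∃ k x, t.IsPath ω c n c 0 k x ∧ n ≤ t.depth (x k) := by
  set ω' := fillIn B (initial c) fun b => ω b with hω'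
  have hω : ∀ z j, t.Below c z → t.depth z ≤ n → (z, j) ≠ (c, -1) → ω' (z, j) = ω (z, j) :=
    fun z j hz hd hne => by
    simp [hω', fillIn, initial, hne, (hB (z, j)).2 ⟨hz, hd⟩]
  have hω1 : ω' (c, -1) = true := by simp [hω', fillIn, initial]
  have hω0 : ∀ z, t.Below c z → t.depth z ≤ n → z ≠ c → ω' (z, -1) = false := fun z hz hd hne => by
    rw [hω z _ hz hd (by simp [hne]), hlast z hz hd]
  have h' : t.Sparse ω' c n := fun j z z' hz hd hz' hd' ht ht' => by
    by_cases hj : j = -1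
    · subst hj
      have e : ∀ z, t.Below c z → t.depth z ≤ n → ω' (z, -1) = true → z = c :=
        fun z hz hd ht => by
        by_contra hne
        rw [hω0 z hz hd hne] at ht; simp at ht
      rw [e z hz hd ht, e z' hz' hd' ht']
    · rw [hω z j hz hd (by simp [hj])] at ht
      rw [hω z' j hz' hd' (by simp [hj])] at ht'
      exact h j z z' hz hd hz' hd' ht ht'
  obtain ⟨k, x, hx, hk⟩ := exists_isPath_of_not_fails h' _ Below.refl hf
  have hnc : ∀ i < k, (0 + i : ZMod M) = -1 → x i ≠ c := fun i hi hj e => by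
    have hm := hx.moves i hi
    have hd := hx.depth_lt i hi
    rw [hj, e] at hm
    rcases hm with ⟨h0, -⟩ | ⟨z, hz, hzt, hxz⟩
    · have := h0 c (mem_edges.2 (Or.inl rfl))
      rw [hω1] at this; simp at this
    · have hzc : z = c := by
        by_contra hne
        rw [hω0 z (Below.refl.of_mem_edges hz)
          ((depth_le_of_mem_edges hz).trans (by rw [e] at hd; omega)) hne] at hzt
        simp at hzt
      have h1 := (hx.below (i + 1) (by omega)).depth_le
      have h2 := depth_of_mem_ch hc
      rw [hxz, hzc, other_self] at h1
      omega
  have hback : ∀ i < k, (0 + i : ZMod M) = -1 → x (i + 1) ≠ c := fun i hi hj e => by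
    have hm := hx.moves i hi
    have hd := hx.depth_lt i hi
    rw [hj, e] at hm
    rcases hm with ⟨-, h1⟩ | ⟨z, hz, hzt, hxz⟩
    · exact hnc i hi hj h1.symm
    · have hzc : z = c := by
        by_contra hne
        rw [hω0 z ((hx.below i hi.le).of_mem_edges hz)
          ((depth_le_of_mem_edges hz).trans hd) hne] at hzt
        simp at hzt
      rcases mem_edges.1 hz with h1 | h1
      · exact hnc i hi hj (h1 ▸ hzc)
      · have h2 := (hx.below i hi.le).depth_le
        rw [hzc] at h1
        have := depth_of_mem_ch h1
        omega
  have hkd : n ≤ t.depth (x k) := by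
    rcases hk with hk | hk
    swap; · exact hk
    exfalso
    have hrep : ∃ i i', i < i' ∧ i' < k ∧ x i = x i' ∧ (i : ZMod M) = i' := by
      obtain ⟨i, hi, i', hi', hne, he⟩ := Finset.exists_ne_map_eq_of_card_lt_of_maps_to
        (s := Finset.range k) (t := B) (f := fun i => (x i, (i : ZMod M)))
        (by rw [Finset.card_range, hk]; omega) (fun i hi => by
          have hi := Finset.mem_range.1 hi
          exact (hB _).2 ⟨hx.below i hi.le, (hx.depth_lt i hi).le⟩)
      rw [Prod.mk.injEq] at he
      have hi := Finset.mem_range.1 hi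
      have hi' := Finset.mem_range.1 hi'
      rcases lt_or_gt_of_ne hne with hl | hl
      · exact ⟨i, i', hl, hi', he.1, he.2⟩
      · exact ⟨i', i, hl, hi, he.1.symm, he.2.symm⟩
    obtain ⟨i, i', hlt, hi', hxe, hje⟩ := hrep
    induction i generalizing i' with
    | zero =>
      obtain ⟨i', rfl⟩ : ∃ l, i' = l + 1 := ⟨i' - 1, by omega⟩
      refine hback i' (by omega) ?_ (hxe.symm.trans hx.zero)
      push_cast at hje
      rw [zero_add]
      exact eq_neg_of_add_eq_zero_left hje.symm
    | succ i ih =>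
      obtain ⟨i', rfl⟩ : ∃ l, i' = l + 1 := ⟨i' - 1, by omega⟩
      push_cast at hje
      have hje := add_right_cancel hje
      refine ih i' (by omega) (by omega) ?_ hje
      have hm := hx.moves i (by omega)
      have hm' := hx.moves i' (by omega)
      rw [hje, hxe] at hm
      exact h'.eq_of_moves hc (hx.below i (by omega)) (hx.below i' (by omega))
        (hx.depth_lt i (by omega)) (hx.depth_lt i' (by omega)) (hx.below _ (by omega)) hm hm'
  refine ⟨k, x, ⟨hx.zero, hx.below, hx.depth_lt, fun i hi => ?_⟩, hkd⟩
  have e : ∀ z ∈ t.edges (x i), ω' (z, 0 + (i : ZMod M)) = ω (z, 0 + (i : ZMod M)) := fun z hz => by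
    refine hω z _ ((hx.below i hi.le).of_mem_edges hz)
      ((depth_le_of_mem_edges hz).trans (hx.depth_lt i hi)) fun h1 => ?_
    obtain ⟨rfl, hj⟩ := Prod.mk.inj h1
    rcases mem_edges.1 hz with h2 | h2
    · exact hnc i hi hj h2.symm
    · have := depth_of_mem_ch h2
      have := (hx.below i hi.le).depth_le
      omega
  rcases hx.moves i hi with ⟨h1, h2⟩ | ⟨z, hz, h1, h2⟩
  · exact Or.inl ⟨fun z hz => (e z hz) ▸ h1 z hz, h2⟩
  · exact Or.inr ⟨z, hz, (e z hz) ▸ h1, h2⟩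

end BranchTree

/-! ### Rooted trees as graphs -/

namespace BranchTree

variable {V : Type*} {D : ℕ} {t : BranchTree V D} {G : SimpleGraph V} {φ : V}

/-- The edges of the graph `G` are the pairs of a child and its parent, and `φ` is the root. The
value of `par φ` is chosen such that the pair of `φ` and `par φ` is not an edge. -/
structure Encodes (t : BranchTree V D) (G : SimpleGraph V) (φ : V) : Prop where
  adj_iff : ∀ x y, G.Adj x y ↔ y ∈ t.ch x ∨ x ∈ t.ch y
  par_root : t.par φ = φ
  depth_root : t.depth φ = 0
  mem_ch_par : ∀ v, v ≠ φ → v ∈ t.ch (t.par v)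

theorem exists_encodes (hG : G.IsTree) (φ : V) {D : ℕ}
    (hdeg : ∀ v, (G.neighborSet v).encard ≤ D) (hoff : ∀ v, 2 ≤ (G.offspring φ v).encard) :
    ∃ t : BranchTree V D, t.Encodes G φ := by
  classical
  have hpar : ∀ w, ∃ v, (w = φ ∧ v = φ) ∨ (w ≠ φ ∧ G.Adj v w ∧ G.dist φ w = G.dist φ v + 1) := by
    intro w
    by_cases hw : w = φ
    · exact ⟨φ, Or.inl ⟨hw, rfl⟩⟩
    · obtain ⟨p, hp, hpl⟩ := hG.connected.exists_path_of_dist w φ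
      have hnn : ¬ p.Nil := fun h => hw h.eq
      refine ⟨p.snd, Or.inr ⟨hw, (p.adj_snd hnn).symm, ?_⟩⟩
      rcases hG.dist_eq_dist_add_one_of_adj φ (p.adj_snd hnn) with h | h
      · exact h
      · exfalso
        have h1 := G.dist_le p.tail
        have h2 := p.length_tail_add_one hnn
        rw [G.dist_comm] at h1
        rw [G.dist_comm] at hpl
        omega
  choose par hpar using hpar
  have huniq : ∀ v w, G.Adj v w → G.dist φ w = G.dist φ v + 1 → par w = v := by
    intro v w hvw hd
    have hw : w ≠ φ := by rintro rfl; simp at hd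
    obtain ⟨p, hp⟩ := (hG.existsUnique_path w φ).exists
    have key : ∀ v, G.Adj v w → G.dist φ w = G.dist φ v + 1 → v = p.snd := fun v hvw hd => by
      obtain ⟨q, hq⟩ := hG.connected.exists_walk_length_eq_dist v φ
      have hc : (SimpleGraph.Walk.cons hvw.symm q).IsPath := by
        apply SimpleGraph.Walk.isPath_of_length_eq_dist
        rw [SimpleGraph.Walk.length_cons, hq, G.dist_comm, ← hd, G.dist_comm]
      have := (hG.existsUnique_path w φ).unique hp hc
      rw [this, SimpleGraph.Walk.snd_cons]
    rcases hpar w with h | ⟨-, h1, h2⟩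
    · exact absurd h.1 hw
    · rw [key v hvw hd, key _ h1 h2]
  have hfin : ∀ v, (G.neighborSet v).Finite := fun v =>
    Set.finite_of_encard_le_coe (hdeg v)
  have hsub : ∀ v, G.offspring φ v ⊆ {w | G.Adj v w ∧ G.dist φ w = G.dist φ v + 1} := by
    rintro v w ⟨hw, p, hp, rfl⟩
    have hnn : ¬ p.Nil := fun h => hw h.eq
    refine ⟨(p.adj_snd hnn).symm, ?_⟩
    obtain ⟨q, hq, hql⟩ := hG.connected.exists_path_of_dist w φ
    have := (hG.existsUnique_path w φ).unique hp hq
    subst this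
    rcases hG.dist_eq_dist_add_one_of_adj φ (p.adj_snd hnn) with h | h
    · exact h
    · exfalso
      have h1 := G.dist_le p.tail
      have h2 := p.length_tail_add_one hnn
      rw [G.dist_comm] at h1
      rw [G.dist_comm] at hql
      omega
  have hfin' : ∀ v, {w | G.Adj v w ∧ G.dist φ w = G.dist φ v + 1}.Finite := fun v =>
    (hfin v).subset fun w hw => hw.1
  have hcard : ∀ v, ((hfin' v).toFinset.card : ℕ∞) =
      {w | G.Adj v w ∧ G.dist φ w = G.dist φ v + 1}.encard := fun v =>
    (hfin' v).encard_eq_coe_toFinset_card.symm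
  refine ⟨⟨par, G.dist φ, fun v => (hfin' v).toFinset, fun v w => ?_, fun v => ?_, fun v => ?_⟩,
    ⟨fun x y => ?_, ?_, ?_, fun v hv => ?_⟩⟩
  · rw [Set.Finite.mem_toFinset]
    constructor
    · rintro ⟨h1, h2⟩
      exact ⟨huniq v w h1 h2, h2⟩
    · rintro ⟨rfl, h2⟩
      rcases hpar w with ⟨h, h'⟩ | ⟨-, h, -⟩
      · rw [h', h] at h2; omega
      · exact ⟨h, h2⟩
  · have := (hoff v).trans (Set.encard_le_encard (hsub v))
    rw [← hcard] at this
    exact_mod_cast this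
  · have : {w | G.Adj v w ∧ G.dist φ w = G.dist φ v + 1}.encard ≤ D :=
      (Set.encard_le_encard fun w hw => hw.1).trans (hdeg v)
    rw [← hcard] at this
    exact_mod_cast this
  · simp only [Set.Finite.mem_toFinset, Set.mem_ofPred_eq]
    constructor
    · intro h
      rcases hG.dist_eq_dist_add_one_of_adj φ h with h' | h'
      · exact Or.inr ⟨h.symm, h'⟩
      · exact Or.inl ⟨h, h'⟩
    · rintro (h | h)
      · exact h.1
      · exact h.1.symm
  · rcases hpar φ with h | h
    · exact h.2
    · exact absurd rfl h.1
  · simp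
  · rcases hpar v with h | h
    · exact absurd h.1 hv
    · simpa using h.2

/-- The finite set of all vertices of depth `m`. -/
def level [DecidableEq V] (t : BranchTree V D) (φ : V) : ℕ → Finset V
  | 0 => {φ}
  | m + 1 => (level t φ m).biUnion t.ch

theorem ne_of_mem_ch (he : t.Encodes G φ) {v w : V} (h : w ∈ t.ch v) : w ≠ φ := by
  rintro rfl
  have := depth_of_mem_ch h
  rw [he.depth_root] at this
  omega

theorem Encodes.eq_of_depth_eq_zero (he : t.Encodes G φ) {v : V} (h : t.depth v = 0) : v = φ := by
  by_contra hv
  have := depth_of_mem_ch (he.mem_ch_par v hv)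
  omega

variable [DecidableEq V]

theorem mem_level (he : t.Encodes G φ) {m : ℕ} {v : V} : v ∈ t.level φ m ↔ t.depth v = m := by
  induction m generalizing v with
  | zero =>
    rw [level, Finset.mem_singleton]
    exact ⟨fun h => h ▸ he.depth_root, he.eq_of_depth_eq_zero⟩
  | succ m ih =>
    simp only [level, Finset.mem_biUnion, ih]
    constructor
    · rintro ⟨u, hu, hv⟩
      rw [depth_of_mem_ch hv, hu]
    · intro h
      have hv := he.mem_ch_par v (by rintro rfl; rw [he.depth_root] at h; omega)
      have := depth_of_mem_ch hv
      exact ⟨t.par v, by omega, hv⟩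

theorem two_pow_le_card_level (m : ℕ) : 2 ^ m ≤ (t.level φ m).card := by
  induction m with
  | zero => simp [level]
  | succ m ih =>
    rw [level, Finset.card_biUnion, pow_succ]
    · calc 2 ^ m * 2 ≤ (t.level φ m).card * 2 := by gcongr
        _ ≤ _ := by
          rw [← smul_eq_mul]
          exact Finset.card_nsmul_le_sum _ _ _ fun v _ => t.two_le_card_ch v
    · intro v _ w _ hne
      refine Finset.disjoint_left.2 ?_
      intro x hx hx'
      exact hne ((par_of_mem_ch hx).symm.trans (par_of_mem_ch hx'))

/-- The finite set of all vertices other than the root of depth at most `n`. -/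
def upTo (t : BranchTree V D) (φ : V) (n : ℕ) : Finset V :=
  (Finset.Icc 1 n).biUnion (t.level φ)

theorem mem_upTo (he : t.Encodes G φ) {n : ℕ} {v : V} :
    v ∈ t.upTo φ n ↔ v ≠ φ ∧ t.depth v ≤ n := by
  simp only [upTo, Finset.mem_biUnion, Finset.mem_Icc, mem_level he]
  constructor
  · rintro ⟨m, ⟨h1, h2⟩, h3⟩
    refine ⟨?_, h3 ▸ h2⟩
    rintro rfl
    rw [he.depth_root] at h3; omega
  · rintro ⟨h1, h2⟩
    refine ⟨t.depth v, ⟨?_, h2⟩, rfl⟩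
    by_contra h
    exact h1 (he.eq_of_depth_eq_zero (by omega))

theorem Encodes.countable (he : t.Encodes G φ) : Countable V := by
  rw [← Set.countable_univ_iff]
  refine (Set.countable_iUnion fun m => (t.level φ m).countable_toSet).mono fun v _ => ?_
  exact Set.mem_iUnion.2 ⟨t.depth v, (mem_level he).2 rfl⟩

theorem Encodes.finite_depth_le (he : t.Encodes G φ) (n : ℕ) : {v | t.depth v ≤ n}.Finite := by
  refine ((t.upTo φ n).finite_toSet.insert φ).subset fun v hv => ?_
  by_cases h : v = φ
  · exact Or.inl h
  · exact Or.inr ((mem_upTo he).2 ⟨h, hv⟩)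

end BranchTree

/-! ### Poisson bars in time slots -/

namespace BranchTree

variable {V : Type*} {D : ℕ} {t : BranchTree V D} {G : SimpleGraph V} {φ : V}

/-- The times of the bars on the edge from `w` to its parent. -/
def barTimes (t : BranchTree V D) (G : SimpleGraph V) (B : Set (G.edgeSet × ℝ≥0)) (w : V) :
    Set ℝ≥0 :=
  {τ | G.HasBar B τ w (t.par w)}

/-- The number of bars on the edge from `w` to its parent in the slot `(a, b]`. -/
noncomputable def barCount (t : BranchTree V D) (G : SimpleGraph V) (w : V) (a b : ℝ≥0)
    (B : Set (G.edgeSet × ℝ≥0)) : ℕ∞ :=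
  (t.barTimes G B w ∩ Set.Ioc a b).encard

theorem barCount_ne_zero_iff {w : V} {a b : ℝ≥0} {B : Set (G.edgeSet × ℝ≥0)} :
    t.barCount G w a b B ≠ 0 ↔ ∃ τ ∈ Set.Ioc a b, G.HasBar B τ w (t.par w) := by
  rw [barCount, Set.encard_ne_zero]
  exact ⟨fun ⟨τ, h, h'⟩ => ⟨τ, h', h⟩, fun ⟨τ, h, h'⟩ => ⟨τ, h', h⟩⟩

theorem adj_par (he : t.Encodes G φ) {w : V} (hw : w ≠ φ) : G.Adj w (t.par w) :=
  (he.adj_iff _ _).2 (Or.inr (he.mem_ch_par w hw))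

/-- The edge from `w` to its parent. -/
def upEdge (he : t.Encodes G φ) {w : V} (hw : w ≠ φ) : G.edgeSet :=
  ⟨s(w, t.par w), adj_par he hw⟩

theorem upEdge_injective (he : t.Encodes G φ) {w w' : V} (hw : w ≠ φ) (hw' : w' ≠ φ)
    (h : upEdge he hw = upEdge he hw') : w = w' := by
  have h1 : s(w, t.par w) = s(w', t.par w') := congrArg Subtype.val h
  rw [Sym2.eq_iff] at h1
  rcases h1 with h1 | ⟨h1, h2⟩
  · exact h1.1
  · have h3 := depth_of_mem_ch (he.mem_ch_par w hw)
    have h4 := depth_of_mem_ch (he.mem_ch_par w' hw')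
    rw [h2] at h3
    rw [← h1] at h4
    omega

theorem barCount_eq (he : t.Encodes G φ) {w : V} (hw : w ≠ φ) (a b : ℝ≥0)
    (B : Set (G.edgeSet × ℝ≥0)) :
    t.barCount G w a b B = (B ∩ {upEdge he hw} ×ˢ Set.Ioc a b).encard := by
  have hinj : Function.Injective fun τ : ℝ≥0 => (upEdge he hw, τ) := fun x y h =>
    congrArg Prod.snd h
  rw [barCount, ← hinj.encard_image]
  congr 1
  ext ⟨e, τ⟩
  simp only [Set.mem_image, Set.mem_inter_iff, Set.mem_prod, Set.mem_singleton_iff, Prod.mk.injEq]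
  constructor
  · rintro ⟨τ', ⟨⟨h1, h2⟩, h3⟩, rfl, rfl⟩
    exact ⟨h2, rfl, h3⟩
  · rintro ⟨h1, rfl, h3⟩
    exact ⟨τ, ⟨⟨adj_par he hw, h1⟩, h3⟩, rfl, rfl⟩

theorem barIntensity_slot (e : G.edgeSet) (a b : ℝ≥0) :
    G.barIntensity ({e} ×ˢ Set.Ioc a b) = ((b - a : ℝ≥0) : ℝ≥0∞) := by
  have hemb : MeasurableEmbedding NNReal.toReal :=
    MeasurableEmbedding.subtype_coe measurableSet_Ici
  have : IsFiniteMeasureOnCompacts ((volume : Measure ℝ).comap NNReal.toReal) :=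
    IsFiniteMeasureOnCompacts.comap' _ NNReal.continuous_coe hemb
  have : MeasurableSingletonClass G.edgeSet := ⟨fun _ => trivial⟩
  rw [SimpleGraph.barIntensity, Measure.prod_prod, Measure.count_singleton, one_mul,
    hemb.comap_apply]
  have : NNReal.toReal '' Set.Ioc a b = Set.Ioc (a : ℝ) b := by
    ext x
    constructor
    · rintro ⟨y, ⟨h1, h2⟩, rfl⟩
      exact ⟨by exact_mod_cast h1, by exact_mod_cast h2⟩
    · rintro ⟨h1, h2⟩
      exact ⟨⟨x, a.2.trans h1.le⟩, ⟨by exact_mod_cast h1, by exact_mod_cast h2⟩, rfl⟩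
  rw [this, Real.volume_Ioc]
  rcases le_total a b with h | h
  · rw [← NNReal.coe_sub h, ENNReal.ofReal_coe_nnreal]
  · rw [tsub_eq_zero_of_le h, ENNReal.ofReal_of_nonpos (by simpa using h), ENNReal.coe_zero]

variable {Ω : Type*} {mΩ : MeasurableSpace Ω} {μ : Measure Ω}
  {bars : Ω → Set (G.edgeSet × ℝ≥0)}

theorem measurableSet_slot (e : G.edgeSet) (a b : ℝ≥0) :
    MeasurableSet (({e} : Set G.edgeSet) ×ˢ Set.Ioc a b) :=
  MeasurableSet.prod trivial measurableSet_Ioc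

theorem hasLaw_barCount (hB : G.IsPoissonBars μ bars) (he : t.Encodes G φ) {w : V} (hw : w ≠ φ)
    (a b : ℝ≥0) : HasLaw (fun ω => t.barCount G w a b (bars ω))
      ((poissonMeasure (b - a)).map (Nat.cast : ℕ → ℕ∞)) μ := by
  have h := hB.hasLaw_count _ (measurableSet_slot (upEdge he hw) a b)
    (by rw [barIntensity_slot]; exact ENNReal.coe_ne_top)
  rw [barIntensity_slot, ENNReal.toNNReal_coe] at h
  simpa only [barCount_eq he hw] using h

theorem iIndepFun_barCount [IsProbabilityMeasure μ]
    (hB : G.IsPoissonBars μ bars) (he : t.Encodes G φ) {ι : Type*} {w : ι → V}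
    (hw : ∀ i, w i ≠ φ) {a b : ι → ℝ≥0}
    (hd : ∀ i j, i ≠ j → w i = w j → Disjoint (Set.Ioc (a i) (b i)) (Set.Ioc (a j) (b j))) :
    iIndepFun (fun i ω => t.barCount G (w i) (a i) (b i) (bars ω)) μ := by
  rw [iIndepFun_iff_finset]
  intro s
  have h := hB.iIndepFun_count s.card
    (fun k => {upEdge he (hw (s.equivFin.symm k))} ×ˢ
      Set.Ioc (a (s.equivFin.symm k)) (b (s.equivFin.symm k)))
    (fun k => measurableSet_slot _ _ _)
    (fun k => by rw [barIntensity_slot]; exact ENNReal.coe_ne_top) (fun k l hkl => ?_)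
  · have h' := h.precomp s.equivFin.injective
    convert h' using 2 with i
    funext ω
    simp [barCount_eq he (hw _)]
  · refine Set.disjoint_prod.2 ?_
    by_cases hwe : w (s.equivFin.symm k) = w (s.equivFin.symm l)
    · refine Or.inr (hd _ _ (fun h => hkl ?_) hwe)
      exact s.equivFin.symm.injective (Subtype.ext h)
    · refine Or.inl (Set.disjoint_singleton.2 fun h => hwe (upEdge_injective he _ _ h))

theorem measureReal_barCount [IsProbabilityMeasure μ]
    (hB : G.IsPoissonBars μ bars) (he : t.Encodes G φ) {w : V}
    (hw : w ≠ φ) (a b : ℝ≥0) (s : Set ℕ∞) :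
    μ.real {ω | t.barCount G w a b (bars ω) ∈ s} =
      (poissonMeasure (b - a)).real {k | (k : ℕ∞) ∈ s} := by
  have hs : MeasurableSet s := (Set.to_countable s).measurableSet
  have := (hasLaw_barCount hB he hw a b).measureReal_eq (p := (· ∈ s)) hs
  refine this.trans ?_
  exact map_measureReal_apply (measurable_of_countable _) hs

theorem measureReal_barCount_eq_zero [IsProbabilityMeasure μ]
    (hB : G.IsPoissonBars μ bars) (he : t.Encodes G φ) {w : V}
    (hw : w ≠ φ) (a b : ℝ≥0) :
    μ.real {ω | t.barCount G w a b (bars ω) = 0} = Real.exp (-(b - a : ℝ≥0)) := by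
  have := measureReal_barCount hB he hw a b {0}
  refine this.trans ?_
  have e : {k : ℕ | (k : ℕ∞) ∈ ({0} : Set ℕ∞)} = {0} := by ext; simp
  rw [e, poissonMeasure_real_singleton]
  simp

theorem measureReal_one_lt_barCount_le [IsProbabilityMeasure μ]
    (hB : G.IsPoissonBars μ bars) (he : t.Encodes G φ) {w : V}
    (hw : w ≠ φ) (a b : ℝ≥0) :
    μ.real {ω | 1 < t.barCount G w a b (bars ω)} ≤ ((b - a : ℝ≥0) : ℝ) ^ 2 := by
  have := measureReal_barCount hB he hw a b {k | 1 < k}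
  refine this.trans_le ?_
  have e : {k : ℕ | (k : ℕ∞) ∈ ({k | 1 < k} : Set ℕ∞)} = ({0, 1} : Set ℕ)ᶜ := by
    ext k
    simp only [Set.mem_compl_iff, Set.mem_insert_iff, Set.mem_singleton_iff]
    change (1 : ℕ∞) < k ↔ _
    rw [← Nat.cast_one, Nat.cast_lt]
    omega
  rw [e, probReal_compl_eq_one_sub (Set.toFinite _).measurableSet, Set.insert_eq,
    measureReal_union (by simp) (measurableSet_singleton _),
    poissonMeasure_real_singleton, poissonMeasure_real_singleton]
  have := Real.add_one_le_exp (-((b - a : ℝ≥0) : ℝ))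
  simp
  nlinarith [(b - a).2]

theorem ae_barCount_ne_top [IsProbabilityMeasure μ]
    (hB : G.IsPoissonBars μ bars) (he : t.Encodes G φ) {w : V}
    (hw : w ≠ φ) (a b : ℝ≥0) : ∀ᵐ ω ∂μ, t.barCount G w a b (bars ω) ≠ ⊤ := by
  have := measureReal_barCount hB he hw a b {⊤}
  have e : {k : ℕ | (k : ℕ∞) ∈ ({⊤} : Set ℕ∞)} = ∅ := by ext; simp
  rw [e, measureReal_empty, measureReal_def, ENNReal.toReal_eq_zero_iff] at this
  simpa [ae_iff] using this.resolve_right (measure_ne_top _ _)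

theorem measureReal_barCount_ne_zero [IsProbabilityMeasure μ]
    (hB : G.IsPoissonBars μ bars) (he : t.Encodes G φ) {w : V}
    (hw : w ≠ φ) (a b : ℝ≥0) :
    μ.real {ω | t.barCount G w a b (bars ω) ≠ 0} = 1 - Real.exp (-(b - a : ℝ≥0)) := by
  rw [← measureReal_barCount_eq_zero hB he hw a b, ← probReal_compl_eq_one_sub₀]
  · rfl
  · exact (hasLaw_barCount hB he hw a b).aemeasurable.nullMeasurable (measurableSet_singleton _)

theorem measureReal_barCount_ne_zero_le [IsProbabilityMeasure μ]
    (hB : G.IsPoissonBars μ bars) (he : t.Encodes G φ) {w : V}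
    (hw : w ≠ φ) (a b : ℝ≥0) :
    μ.real {ω | t.barCount G w a b (bars ω) ≠ 0} ≤ (b - a : ℝ≥0) := by
  rw [measureReal_barCount_ne_zero hB he hw]
  have := Real.add_one_le_exp (-((b - a : ℝ≥0) : ℝ))
  linarith

theorem measureReal_forall_barCount_ne_zero_le [IsProbabilityMeasure μ]
    (hB : G.IsPoissonBars μ bars) (he : t.Encodes G φ) {F : Finset V} (hF : ∀ w ∈ F, w ≠ φ)
    (a b : ℝ≥0) :
    μ.real {ω | ∀ w ∈ F, t.barCount G w a b (bars ω) ≠ 0} ≤ ((b - a : ℝ≥0) : ℝ) ^ F.card := by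
  have h := (iIndepFun_barCount (ι := F) hB he (w := Subtype.val) (fun i => hF i i.2)
    (a := fun _ => a) (b := fun _ => b)
    (fun i j hij h => absurd (Subtype.ext h) hij)).measure_inter_preimage_eq_mul
    Finset.univ (sets := fun _ => {0}ᶜ) fun _ _ => (Set.to_countable _).measurableSet
  have e : {ω | ∀ w ∈ F, t.barCount G w a b (bars ω) ≠ 0} =
      ⋂ i ∈ (Finset.univ : Finset F), (fun ω => t.barCount G i a b (bars ω)) ⁻¹' {0}ᶜ := by
    ext ω; simp
  rw [e, measureReal_def, h, ENNReal.toReal_prod]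
  calc _ ≤ ∏ _i : F, ((b - a : ℝ≥0) : ℝ) :=
        Finset.prod_le_prod (fun i _ => ENNReal.toReal_nonneg) fun i _ =>
          measureReal_barCount_ne_zero_le hB he (hF i i.2) a b
    _ = _ := by simp

end BranchTree

/-! ### Particles between bars -/

/-- Induction along an interval of real numbers. -/
theorem NNReal.interval_induction {P : ℝ≥0 → Prop} {a b : ℝ≥0} (ha : P a)
    (hr : ∀ s, a ≤ s → s < b → P s → ∀ᶠ r in 𝓝[>] s, P r)
    (hl : ∀ s, a < s → s ≤ b → (∀ r, a ≤ r → r < s → P r) → P s) :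
    ∀ s, a ≤ s → s ≤ b → P s := by
  by_contra! hcon
  obtain ⟨s₀, h1, h2, h3⟩ := hcon
  set S : Set ℝ≥0 := {s | a ≤ s ∧ ¬ P s} with hS
  have hbd : BddBelow S := ⟨a, fun s hs => hs.1⟩
  have hne : S.Nonempty := ⟨s₀, h1, h3⟩
  set c := sInf S with hc
  have hac : a ≤ c := le_csInf hne fun s hs => hs.1
  have hcs : c ≤ s₀ := csInf_le hbd ⟨h1, h3⟩
  have hlt : ∀ r, a ≤ r → r < c → P r := fun r har hrc => by
    by_contra h
    exact absurd (csInf_le hbd ⟨har, h⟩) (not_le.2 hrc)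
  have hPc : P c := by
    rcases hac.eq_or_lt with h | h
    · exact h ▸ ha
    · exact hl c h (hcs.trans h2) hlt
  have hcs' : c < s₀ := hcs.lt_of_ne fun h => h3 (h ▸ hPc)
  obtain ⟨u, hu, hsub⟩ := mem_nhdsGT_iff_exists_Ioo_subset.1 (hr c hac (hcs'.trans_le h2) hPc)
  obtain ⟨s, hs, hsu⟩ := exists_lt_of_csInf_lt hne hu
  have hcs := csInf_le hbd hs
  rcases hcs.eq_or_lt with h | h
  · exact hs.2 (h ▸ hPc)
  · exact hs.2 (hsub ⟨h, hsu⟩)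

namespace SimpleGraph

variable {V : Type*} {G : SimpleGraph V} {B : Set (G.edgeSet × ℝ≥0)} {f g : ℝ≥0 → V} {x y z : V}
  {a b τ : ℝ≥0}

theorem HasBar.symm (h : G.HasBar B τ x y) : G.HasBar B τ y x := by
  obtain ⟨h1, h2⟩ := h
  refine ⟨h1.symm, ?_⟩
  have : (⟨s(y, x), h1.symm⟩ : G.edgeSet) = ⟨s(x, y), h1⟩ := Subtype.ext Sym2.eq_swap
  rwa [this]

/-- The trajectory of a particle that crosses every bar it meets. -/
structure IsParticle (G : SimpleGraph V) (B : Set (G.edgeSet × ℝ≥0)) (f : ℝ≥0 → V) : Prop where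
  right_continuous : ∀ t, ∀ᶠ s in 𝓝[>] t, f s = f t
  update : ∀ t, ∀ᶠ s in 𝓝[<] t, G.StirStep B t (f s) (f t)

theorem IsStirring.isParticle {σ : ℝ≥0 → Equiv.Perm V} (h : G.IsStirring B σ) (v : V) :
    G.IsParticle B fun s => σ s v :=
  ⟨h.right_continuous v, h.update v⟩

theorem _root_.NNReal.exists_mem_Ico_of_eventually {a s : ℝ≥0} (h : a < s) {P : ℝ≥0 → Prop}
    (hP : ∀ᶠ r in 𝓝[<] s, P r) : ∃ r, a ≤ r ∧ r < s ∧ P r := by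
  have : (𝓝[<] s).NeBot := nhdsLT_neBot_of_exists_lt ⟨a, h⟩
  obtain ⟨r, h1, h2⟩ := (hP.and (Ico_mem_nhdsLT h)).exists
  exact ⟨r, h2.1, h2.2, h1⟩

theorem IsParticle.stirStep (hf : G.IsParticle B f) (h : a < τ)
    (hx : ∀ s, a ≤ s → s < τ → f s = x) : G.StirStep B τ x (f τ) := by
  obtain ⟨r, h1, h2, h3⟩ := NNReal.exists_mem_Ico_of_eventually h (hf.update τ)
  rwa [hx r h1 h2] at h3

/-- A particle stays put as long as there is no bar at its position. -/
theorem IsParticle.eq_of_forall_not_hasBar (hf : G.IsParticle B f) (ha : f a = x)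
    (h : ∀ s, a < s → s ≤ b → ∀ z, ¬ G.HasBar B s x z) : ∀ s, a ≤ s → s ≤ b → f s = x := by
  refine NNReal.interval_induction ha (fun s _ _ hs => ?_) fun s h1 h2 hs => ?_
  · filter_upwards [hf.right_continuous s] with r hr
    rw [hr, hs]
  · rcases hf.stirStep h1 hs with h' | h'
    · exact absurd h' (h s h1 h2 _)
    · exact h'.1

theorem IsParticle.eq_of_hasBar (hf : G.IsParticle B f) (ha : f a = x) (h1 : a < τ) (h2 : τ ≤ b)
    (hτ : G.HasBar B τ x y)
    (hx : ∀ s, a < s → s ≤ b → ∀ z, G.HasBar B s x z → s = τ ∧ z = y)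
    (hy : ∀ s, a < s → s ≤ b → ∀ z, G.HasBar B s y z → s = τ) : f b = y := by
  have hbefore : ∀ s, a ≤ s → s < τ → f s = x := fun s hs hsτ =>
    hf.eq_of_forall_not_hasBar (b := s) ha
      (fun r h3 h4 z hz => absurd (hx r h3 (h4.trans (hsτ.le.trans h2)) z hz).1
        (h4.trans_lt hsτ).ne) s hs le_rfl
  have hfτ : f τ = y := by
    rcases hf.stirStep h1 hbefore with h | h
    · exact (hx τ h1 h2 _ h).2
    · exact absurd hτ (h.2 y)
  exact hf.eq_of_forall_not_hasBar hfτ (fun s h3 h4 z hz =>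
    absurd (hy s (h1.trans h3) h4 z hz) h3.ne') b h2 le_rfl

/-- No two bars that share a vertex are simultaneous, except perhaps at the time zero, when no
transposition is performed. -/
def NoClash (G : SimpleGraph V) (B : Set (G.edgeSet × ℝ≥0)) : Prop :=
  ∀ τ x y z, 0 < τ → G.HasBar B τ x y → G.HasBar B τ x z → y = z

theorem StirStep.unique (hB : G.NoClash B) (hτ : 0 < τ) (hy : G.StirStep B τ x y)
    (hz : G.StirStep B τ x z) : y = z := by
  rcases hy with hy | hy <;> rcases hz with hz | hz
  · exact hB τ x y z hτ hy hz
  · exact absurd hy (hz.2 y)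
  · exact absurd hz (hy.2 z)
  · rw [hy.1, hz.1]

theorem StirStep.congr {B' : Set (G.edgeSet × ℝ≥0)}
    (h : ∀ z, G.HasBar B τ x z ↔ G.HasBar B' τ x z) (hy : G.StirStep B τ x y) :
    G.StirStep B' τ x y := by
  rcases hy with hy | hy
  · exact Or.inl ((h y).1 hy)
  · exact Or.inr ⟨hy.1, fun z hz => hy.2 z ((h z).2 hz)⟩

/-- The trajectory of a particle up to the time `b` is determined by the bars up to this time. -/
theorem IsParticle.eq_of_noClash {B' : Set (G.edgeSet × ℝ≥0)} (hB : G.NoClash B)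
    (hf : G.IsParticle B f) (hg : G.IsParticle B' g) (h : f 0 = g 0)
    (hBB : ∀ τ x y, 0 < τ → τ ≤ b → (G.HasBar B τ x y ↔ G.HasBar B' τ x y)) :
    ∀ s ≤ b, f s = g s := by
  intro s hs
  refine NNReal.interval_induction (P := fun s => f s = g s) (a := 0) (b := b) h
    (fun s _ _ hs => ?_) (fun s h1 h2 hs => ?_) s bot_le hs
  · filter_upwards [hf.right_continuous s, hg.right_continuous s] with r hr hr'
    rw [hr, hr', hs]
  · obtain ⟨r, h3, h4, h5, h6⟩ := NNReal.exists_mem_Ico_of_eventually h1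
      ((hf.update s).and (hg.update s))
    rw [hs r h3 h4] at h5
    exact h5.unique hB h1 (h6.congr fun z => (hBB s _ z h1 h2).symm)

/-- In a locally finite graph, the trajectory of a particle visits finitely many vertices in
bounded time. -/
theorem IsParticle.finite_image (hG : ∀ v, (G.neighborSet v).Finite) (hf : G.IsParticle B f)
    (b : ℝ≥0) : (f '' Set.Iic b).Finite := by
  refine NNReal.interval_induction (P := fun s => (f '' Set.Iic s).Finite) (a := 0) (b := b) ?_
    (fun s _ _ hs => ?_) (fun s h1 h2 hs => ?_) b bot_le le_rfl
  · have : Set.Iic (0 : ℝ≥0) = {0} := by ext; simp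
    rw [this, Set.image_singleton]
    exact Set.finite_singleton _
  · obtain ⟨u, hu, hsub⟩ := mem_nhdsGT_iff_exists_Ioo_subset.1 (hf.right_continuous s)
    filter_upwards [Ioo_mem_nhdsGT hu] with r hr
    refine hs.subset ?_
    rintro _ ⟨q, hq, rfl⟩
    rcases le_or_gt q s with h | h
    · exact ⟨q, h, rfl⟩
    · refine ⟨s, Set.mem_Iic.2 le_rfl, ?_⟩
      exact (hsub ⟨h, lt_of_le_of_lt hq hr.2⟩ : f q = f s).symm
  · have h3 := hf.update s
    rw [eventually_iff, mem_nhdsLT_iff_exists_Ioo_subset' h1] at h3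
    obtain ⟨l, hl, hsub⟩ := h3
    refine ((hs l bot_le hl).union ((hG (f s)).insert (f s))).subset ?_
    rintro _ ⟨q, hq, rfl⟩
    rcases le_or_gt q l with h | h
    · exact Or.inl ⟨q, h, rfl⟩
    · rcases (Set.mem_Iic.1 hq).eq_or_lt with h' | h'
      · right; left; rw [h']
      · right
        rcases hsub ⟨h, h'⟩ with h4 | h4
        · exact Or.inr h4.symm.1
        · exact Or.inl h4.1.symm

end SimpleGraph

/-- If the particles that start on the cycle of `v` travel arbitrarily far from the root, then this
cycle is infinite. -/
theorem SimpleGraph.IsStirring.infinite_sameCycle {V : Type*} {G : SimpleGraph V}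
    {B : Set (G.edgeSet × ℝ≥0)} (hG : ∀ v, (G.neighborSet v).Finite) {σ : ℝ≥0 → Equiv.Perm V}
    (hσ : G.IsStirring B σ) {T : ℝ≥0} {v : V} {d : V → ℕ}
    (h : ∀ n : ℕ, ∃ k : ℕ, ∃ s ≤ T, n ≤ d (σ s ((σ T ^ k) v))) :
    {w | (σ T).SameCycle v w}.Infinite := by
  intro hfin
  have h1 : (⋃ w ∈ {w | (σ T).SameCycle v w}, (fun s => σ s w) '' Set.Iic T).Finite :=
    hfin.biUnion fun w _ => (hσ.isParticle w).finite_image hG T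
  obtain ⟨N, hN⟩ := (h1.image d).bddAbove
  obtain ⟨k, s, hs, hk⟩ := h (N + 1)
  have := hN (Set.mem_image_of_mem d (Set.mem_biUnion (show (σ T ^ k) v ∈ _ from ?_)
    (Set.mem_image_of_mem _ hs)))
  · omega
  · exact ⟨k, by simp⟩

/-! ### Discretisation of time -/

namespace BranchTree

variable {V : Type*} [DecidableEq V] {D : ℕ} {t : BranchTree V D} {G : SimpleGraph V} {φ : V}
  {B : Set (G.edgeSet × ℝ≥0)} {τ a b δ : ℝ≥0} {x y z c : V} {n M : ℕ}

theorem hasBar_iff (he : t.Encodes G φ) : G.HasBar B τ x y ↔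
    ∃ z ∈ t.edges x, z ≠ φ ∧ y = t.other x z ∧ G.HasBar B τ z (t.par z) := by
  constructor
  · intro h
    rcases (he.adj_iff x y).1 h.1 with h' | h'
    · refine ⟨y, mem_edges.2 (Or.inr h'), ne_of_mem_ch he h', (other_of_mem_ch h').symm, ?_⟩
      rw [par_of_mem_ch h']
      exact h.symm
    · refine ⟨x, mem_edges.2 (Or.inl rfl), ne_of_mem_ch he h', ?_, ?_⟩
      · rw [other_self, par_of_mem_ch h']
      · rwa [par_of_mem_ch h']
  · rintro ⟨z, hz, -, rfl, h⟩
    rcases mem_edges.1 hz with rfl | hz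
    · rwa [other_self]
    · rw [other_of_mem_ch hz]
      rw [par_of_mem_ch hz] at h
      exact h.symm

/-- In the slots `(jδ, (j+1)δ]` with `j < M` there is at most one bar on the edges above the
vertices in `F`, and there is none in the last of these slots. -/
structure Separated (t : BranchTree V D) (G : SimpleGraph V) (B : Set (G.edgeSet × ℝ≥0))
    (F : Finset V) (δ : ℝ≥0) (M : ℕ) : Prop where
  count_le : ∀ j < M, ∀ w ∈ F, ¬ 1 < t.barCount G w (j * δ) ((j + 1) * δ) B
  eq_of_ne_zero : ∀ j < M, ∀ w ∈ F, ∀ w' ∈ F, t.barCount G w (j * δ) ((j + 1) * δ) B ≠ 0 →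
    t.barCount G w' (j * δ) ((j + 1) * δ) B ≠ 0 → w = w'
  last : ∀ j, j + 1 = M → ∀ w ∈ F, t.barCount G w (j * δ) ((j + 1) * δ) B = 0

/-- The bit of the vertex `z` and the slot `j` tells whether the edge from `z` to its parent has a
bar in this slot. -/
noncomputable def slotBit (t : BranchTree V D) (G : SimpleGraph V) (δ : ℝ≥0) (M : ℕ)
    (B : Set (G.edgeSet × ℝ≥0)) (b : V × ZMod M) : Bool :=
  !decide (t.barCount G b.1 (b.2.val * δ) ((b.2.val + 1) * δ) B = 0)

omit [DecidableEq V] in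
theorem slotBit_eq_true {b : V × ZMod M} : t.slotBit G δ M B b = true ↔
    t.barCount G b.1 (b.2.val * δ) ((b.2.val + 1) * δ) B ≠ 0 := by
  simp [slotBit]

omit [DecidableEq V] in
theorem slotBit_eq_false {b : V × ZMod M} : t.slotBit G δ M B b = false ↔
    t.barCount G b.1 (b.2.val * δ) ((b.2.val + 1) * δ) B = 0 := by
  simp [slotBit]

omit [DecidableEq V] in
theorem barCount_root (he : t.Encodes G φ) : t.barCount G φ a b B = 0 := by
  by_contra h
  obtain ⟨τ, -, h, -⟩ := barCount_ne_zero_iff.1 h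
  rw [he.par_root] at h
  exact G.loopless.irrefl _ h

variable [NeZero M]

theorem Separated.sparse (he : t.Encodes G φ) (h : t.Separated G B (t.upTo φ (n + 1)) δ M) :
    t.Sparse (t.slotBit G δ M B) c n := by
  intro j z z' _ hd _ hd' hz hz'
  rw [slotBit_eq_true] at hz hz'
  have key : ∀ z, t.depth z ≤ n → t.barCount G z (j.val * δ) ((j.val + 1) * δ) B ≠ 0 →
      z ∈ t.upTo φ (n + 1) := fun z hd hz => by
    refine (mem_upTo he).2 ⟨?_, by omega⟩
    rintro rfl
    exact hz (barCount_root he)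
  exact h.eq_of_ne_zero _ (ZMod.val_lt j) _ (key z hd hz) _ (key z' hd' hz') hz hz'

theorem Separated.eq_of_moves (he : t.Encodes G φ) (h : t.Separated G B (t.upTo φ (n + 1)) δ M)
    {f : ℝ≥0 → V} (hf : G.IsParticle B f) {j : ZMod M} (hx : f (j.val * δ) = x)
    (hd : t.depth x < n) (hm : t.Moves (t.slotBit G δ M B) x j y) :
    f ((j.val + 1) * δ) = y := by
  set a := j.val * δ with ha
  set b := (j.val + 1) * δ with hb
  have hab : a ≤ b := by rw [ha, hb]; gcongr; exact le_self_add
  rcases hm with ⟨h0, rfl⟩ | ⟨z, hz, hzt, rfl⟩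
  · refine hf.eq_of_forall_not_hasBar hx (fun s h1 h2 z' hz' => ?_) b hab le_rfl
    obtain ⟨z, hz, hzφ, -, h3⟩ := (hasBar_iff he).1 hz'
    exact barCount_ne_zero_iff.2 ⟨s, ⟨h1, h2⟩, h3⟩ (slotBit_eq_false.1 (h0 z hz))
  · rw [slotBit_eq_true] at hzt
    obtain ⟨τ, hτ, hbar⟩ := barCount_ne_zero_iff.1 hzt
    have hzφ : z ≠ φ := by
      rintro rfl
      exact hzt (barCount_root he)
    have hzF : z ∈ t.upTo φ (n + 1) :=
      (mem_upTo he).2 ⟨hzφ, by have := depth_le_of_mem_edges hz; omega⟩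
    have hy : t.depth (t.other x z) ≤ n := by
      rcases mem_edges.1 hz with rfl | hz'
      · rw [other_self]
        have := depth_of_mem_ch (he.mem_ch_par z hzφ)
        omega
      · rw [other_of_mem_ch hz', depth_of_mem_ch hz']
        omega
    have hone : ∀ s, a < s → s ≤ b → G.HasBar B s z (t.par z) → s = τ := fun s h1 h2 h3 => by
      have := h.count_le _ (ZMod.val_lt j) z hzF
      rw [barCount, not_lt, Set.encard_le_one_iff] at this
      exact this s τ ⟨h3, h1, h2⟩ ⟨hbar, hτ⟩
    have huniq : ∀ v z' s, t.depth v ≤ n → z' ∈ t.edges v → a < s → s ≤ b → z' ≠ φ →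
        G.HasBar B s z' (t.par z') → s = τ ∧ z' = z := fun v z' s hv hz' h1 h2 h3 h4 => by
      have : z' = z := h.eq_of_ne_zero _ (ZMod.val_lt j) z'
        ((mem_upTo he).2 ⟨h3, by have := depth_le_of_mem_edges hz'; omega⟩) z hzF
        (barCount_ne_zero_iff.2 ⟨s, ⟨h1, h2⟩, h4⟩) hzt
      exact ⟨hone s h1 h2 (this ▸ h4), this⟩
    refine hf.eq_of_hasBar hx hτ.1 hτ.2 ((hasBar_iff he).2 ⟨z, hz, hzφ, rfl, hbar⟩)
      (fun s h1 h2 v hv => ?_) (fun s h1 h2 v hv => ?_)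
    · obtain ⟨z', hz', h3, h4, h5⟩ := (hasBar_iff he).1 hv
      obtain ⟨h6, h7⟩ := huniq x z' s hd.le hz' h1 h2 h3 h5
      exact ⟨h6, by rw [h4, h7]⟩
    · obtain ⟨z', hz', h3, h4, h5⟩ := (hasBar_iff he).1 hv
      exact (huniq _ z' s hy hz' h1 h2 h3 h5).1

/-- The particles follow the paths of the meander: the meander walks along the cycle of the
permutation at the time `Mδ`. -/
theorem Separated.exists_le_depth (he : t.Encodes G φ)
    (h : t.Separated G B (t.upTo φ (n + 1)) δ M) {σ : ℝ≥0 → Equiv.Perm V} (hσ : G.IsStirring B σ)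
    {k : ℕ} {x : ℕ → V} (hx : t.IsPath (t.slotBit G δ M B) c n c 0 k x) (i : ℕ) (hi : i ≤ k) :
    ∃ q j : ℕ, j < M ∧ i = q * M + j ∧ σ (j * δ) ((σ (M * δ) ^ q) c) = x i := by
  induction i with
  | zero => exact ⟨0, 0, Nat.pos_of_ne_zero (NeZero.ne M), by simp, by simp [hσ.zero, hx.zero]⟩
  | succ i ih =>
    obtain ⟨q, j, hj, hij, hxi⟩ := ih (by omega)
    have hm := hx.moves i (by omega)
    have hji : (0 + i : ZMod M) = j := by rw [hij]; push_cast; simp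
    rw [hji] at hm
    have hval : (j : ZMod M).val = j := ZMod.val_cast_of_lt hj
    have := h.eq_of_moves he (hσ.isParticle ((σ (M * δ) ^ q) c)) (j := j) (x := x i)
      (y := x (i + 1))
      (by rw [hval]; exact hxi) (hx.depth_lt i (by omega)) hm
    rw [hval] at this
    rcases Nat.lt_or_ge (j + 1) M with hlt | hge
    · exact ⟨q, j + 1, hlt, by omega, by push_cast; exact this⟩
    · have hM : j + 1 = M := by omega
      refine ⟨q + 1, 0, by omega, by rw [add_mul]; omega, ?_⟩
      have hM' : ((j : ℝ≥0) + 1) = M := by exact_mod_cast congrArg (Nat.cast (R := ℝ≥0)) hM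
      rw [hM'] at this
      rw [Nat.cast_zero, zero_mul, hσ.zero, Equiv.Perm.one_apply, pow_succ', Equiv.Perm.mul_apply]
      exact this

theorem neg_one_val : (-1 : ZMod M).val + 1 = M := by
  have : M ≠ 0 := NeZero.ne M
  obtain ⟨m, rfl⟩ : ∃ m, M = m + 1 := ⟨M - 1, by omega⟩
  rw [ZMod.val_neg_one]

/-- A trial that does not fail makes a particle on the cycle of `c` reach the depth `n`. -/
theorem Separated.exists_le_depth_of_not_fails (he : t.Encodes G φ) (hc : c ∈ t.ch (t.par c))
    (h : t.Separated G B (t.upTo φ (n + 1)) δ M) {σ : ℝ≥0 → Equiv.Perm V} (hσ : G.IsStirring B σ)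
    {I : Finset (V × ZMod M)} (hI : ∀ b, b ∈ I ↔ t.Below c b.1 ∧ t.depth b.1 ≤ n)
    (hf : ¬ t.Fails n c (fillIn I (initial c) fun b => t.slotBit G δ M B b) (I.card + 1) c 0) :
    ∃ k : ℕ, ∃ s ≤ M * δ, n ≤ t.depth (σ s ((σ (M * δ) ^ k) c)) := by
  have hlast : ∀ z, t.Below c z → t.depth z ≤ n → t.slotBit G δ M B (z, -1) = false :=
    fun z _ hd => by
    rw [slotBit_eq_false]
    by_cases hz : z = φ
    · subst hz; exact barCount_root he
    · exact h.last _ neg_one_val z ((mem_upTo he).2 ⟨hz, by omega⟩)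
  obtain ⟨k, x, hx, hk⟩ := exists_isPath_le_depth hc hI (h.sparse he) hlast hf
  obtain ⟨q, j, hj, -, hq⟩ := h.exists_le_depth he hσ hx k le_rfl
  refine ⟨q, j * δ, ?_, ?_⟩
  · gcongr
  · rw [hq]; exact hk

end BranchTree

/-! ### Many independent trials -/

namespace BranchTree

variable {V : Type*} {D : ℕ} {t : BranchTree V D} {G : SimpleGraph V} {φ : V}
  {Ω : Type*} {mΩ : MeasurableSpace Ω} {μ : Measure Ω} [IsProbabilityMeasure μ]
  {bars : Ω → Set (G.edgeSet × ℝ≥0)} {δ : ℝ≥0} {M n : ℕ}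

theorem slot_length (j : ℕ) (δ : ℝ≥0) : (j + 1) * δ - j * δ = δ := by
  rw [add_mul, one_mul, add_tsub_cancel_left]

theorem disjoint_slots {i j : ℕ} (h : i ≠ j) (δ : ℝ≥0) :
    Disjoint (Set.Ioc (i * δ) ((i + 1) * δ)) (Set.Ioc (j * δ) ((j + 1) * δ)) := by
  wlog hij : i < j generalizing i j
  · exact (this h.symm (by omega)).symm
  rw [Set.disjoint_left]
  intro x hx hx'
  have : ((i : ℝ≥0) + 1) * δ ≤ j * δ := by
    gcongr
    exact_mod_cast hij
  exact absurd (hx.2.trans this) (not_le.2 hx'.1)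

theorem measureReal_not_separated_le (hB : G.IsPoissonBars μ bars) (he : t.Encodes G φ)
    {F : Finset V} (hF : ∀ w ∈ F, w ≠ φ) (δ : ℝ≥0) (M : ℕ) :
    μ.real {ω | ¬ t.Separated G (bars ω) F δ M} ≤
      M * (F.card * (δ : ℝ) ^ 2) + M * (F.card * F.card * (δ : ℝ) ^ 2) + F.card * δ := by
  classical
  set A₁ : Set Ω := ⋃ j ∈ Finset.range M, ⋃ w ∈ F,
    {ω | 1 < t.barCount G w (j * δ) ((j + 1) * δ) (bars ω)}
  set A₂ : Set Ω := ⋃ j ∈ Finset.range M, ⋃ e ∈ F.offDiag,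
    {ω | ∀ w ∈ ({e.1, e.2} : Finset V), t.barCount G w (j * δ) ((j + 1) * δ) (bars ω) ≠ 0}
  set A₃ : Set Ω := ⋃ w ∈ F,
    {ω | t.barCount G w ((M - 1 : ℕ) * δ) (((M - 1 : ℕ) + 1) * δ) (bars ω) ≠ 0}
  have hsub : {ω | ¬ t.Separated G (bars ω) F δ M} ⊆ A₁ ∪ A₂ ∪ A₃ := by
    intro ω hω
    by_contra hcon
    simp only [A₁, A₂, A₃, Set.mem_union, Set.mem_iUnion, Finset.mem_range, not_or, not_exists]
      at hcon
    obtain ⟨⟨h1, h2⟩, h3⟩ := hcon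
    refine hω ⟨fun j hj w hw => h1 j hj w hw, fun j hj w hw w' hw' h h' => ?_, fun j hj w hw => ?_⟩
    · by_contra hne
      refine h2 j hj (w, w') (Finset.mem_offDiag.2 ⟨hw, hw', hne⟩) ?_
      intro v hv
      rcases Finset.mem_insert.1 hv with rfl | hv
      · exact h
      · rw [Finset.mem_singleton.1 hv]; exact h'
    · have := h3 w hw
      subst hj
      simpa using this
  have hA₁ : μ.real A₁ ≤ M * (F.card * (δ : ℝ) ^ 2) := by
    refine (measureReal_biUnion_finset_le _ _).trans ?_
    refine (Finset.sum_le_card_nsmul _ _ (F.card * (δ : ℝ) ^ 2) fun j _ => ?_).trans ?_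
    · refine (measureReal_biUnion_finset_le _ _).trans ?_
      refine (Finset.sum_le_card_nsmul _ _ ((δ : ℝ) ^ 2) fun w hw => ?_).trans (by simp)
      have := measureReal_one_lt_barCount_le hB he (hF w hw) (j * δ) ((j + 1) * δ)
      rwa [slot_length] at this
    · simp
  have hA₂ : μ.real A₂ ≤ M * (F.card * F.card * (δ : ℝ) ^ 2) := by
    refine (measureReal_biUnion_finset_le _ _).trans ?_
    refine (Finset.sum_le_card_nsmul _ _ (F.card * F.card * (δ : ℝ) ^ 2) fun j _ => ?_).trans ?_
    · refine (measureReal_biUnion_finset_le _ _).trans ?_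
      refine (Finset.sum_le_card_nsmul _ _ ((δ : ℝ) ^ 2) fun e hE => ?_).trans ?_
      · obtain ⟨h1, h2, h3⟩ := Finset.mem_offDiag.1 hE
        have := measureReal_forall_barCount_ne_zero_le hB he (F := {e.1, e.2})
          (fun w hw => by
            rcases Finset.mem_insert.1 hw with rfl | hw
            · exact hF _ h1
            · rw [Finset.mem_singleton.1 hw]; exact hF _ h2) (j * δ) ((j + 1) * δ)
        rwa [slot_length, Finset.card_pair h3] at this
      · rw [nsmul_eq_mul]
        gcongr
        have : F.offDiag.card ≤ F.card * F.card := by rw [Finset.offDiag_card]; omega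
        exact_mod_cast this
    · simp
  have hA₃ : μ.real A₃ ≤ F.card * δ := by
    refine (measureReal_biUnion_finset_le _ _).trans ?_
    refine (Finset.sum_le_card_nsmul _ _ (δ : ℝ) fun w hw => ?_).trans (by simp)
    have := measureReal_barCount_ne_zero_le hB he (hF w hw) ((M - 1 : ℕ) * δ)
      (((M - 1 : ℕ) + 1) * δ)
    rwa [slot_length] at this
  calc _ ≤ μ.real (A₁ ∪ A₂ ∪ A₃) := measureReal_mono hsub
    _ ≤ μ.real A₁ + μ.real A₂ + μ.real A₃ :=
      (measureReal_union_le _ _).trans (by gcongr; exact measureReal_union_le _ _)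
    _ ≤ _ := by gcongr

variable [DecidableEq V]

/-- With high probability, from one of the vertices of depth `m` the particles on its cycle reach
the depth `n`, whatever `n` is. -/
theorem measureReal_forall_depth_lt_le (hB : G.IsPoissonBars μ bars) (he : t.Encodes G φ) {T : ℝ≥0}
    {M₀ : ℕ} (hT : ∀ M ≥ M₀, ∃ H K L a, Params D M H K L (1 - Real.exp (-(T / M))) a ∧ a ≤ 1 ∧
      a ≤ rescueProb D (1 - Real.exp (-(T / M))) (1 / 384) H) {m : ℕ} (hm : m ≠ 0) (n : ℕ) :
    μ.real {ω | ∃ σ, G.IsStirring (bars ω) σ ∧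
      ∀ c ∈ t.level φ m, ∀ k : ℕ, ∀ s ≤ T, t.depth (σ s ((σ T ^ k) c)) < n} ≤
        (383 / 384) ^ 2 ^ m := by
  classical
  set F := t.upTo φ (n + 1) with hFdef
  have hF : ∀ w ∈ F, w ≠ φ := fun w hw => ((mem_upTo he).1 hw).1
  have hlevel : ∀ c ∈ t.level φ m, t.depth c = m ∧ c ∈ t.ch (t.par c) := fun c hc => by
    have h1 := (mem_level he).1 hc
    refine ⟨h1, he.mem_ch_par c ?_⟩
    rintro rfl
    exact hm (h1.symm.trans he.depth_root)
  have key : ∀ M : ℕ, max M₀ 1 ≤ M → μ.real {ω | ∃ σ, G.IsStirring (bars ω) σ ∧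
      ∀ c ∈ t.level φ m, ∀ k : ℕ, ∀ s ≤ T, t.depth (σ s ((σ T ^ k) c)) < n} ≤
      (F.card * (T : ℝ) ^ 2 + F.card * F.card * (T : ℝ) ^ 2 + F.card * T) / M +
        (383 / 384) ^ 2 ^ m := by
    intro M hM
    obtain ⟨H, K, L, a, hP, ha1, ha⟩ := hT M ((le_max_left _ _).trans hM)
    have hM1 : 1 ≤ M := (le_max_right _ _).trans hM
    have : NeZero M := ⟨by omega⟩
    set δ : ℝ≥0 := T / M with hδ
    have hMδ : M * δ = T := by
      rw [hδ, mul_div_cancel₀]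
      exact_mod_cast (NeZero.ne M)
    have hδr : (δ : ℝ) = T / M := by rw [hδ]; simp
    rw [← hδr] at hP ha
    have hexp : Real.exp (-(δ : ℝ)) ≤ 1 := Real.exp_le_one_iff.2 (by simp)
    have hexp0 := Real.exp_pos (-(δ : ℝ))
    have hfin : ∀ c, {b : V × ZMod M | t.Below c b.1 ∧ t.depth b.1 ≤ n}.Finite := fun c =>
      ((he.finite_depth_le n).prod Set.finite_univ).subset fun b hb => ⟨hb.2, trivial⟩
    set I : V → Finset (V × ZMod M) := fun c => (hfin c).toFinset
    have hI : ∀ c b, b ∈ I c ↔ t.Below c b.1 ∧ t.depth b.1 ≤ n := fun c b => by simp [I]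
    have hindep := iIndepFun_barCount hB he (ι := {b : V × ZMod M | b.1 ≠ φ}) (w := fun b => b.1.1)
      (fun b => b.2) (a := fun b => b.1.2.val * δ) (b := fun b => (b.1.2.val + 1) * δ)
      (fun b b' hne h => disjoint_slots (fun h' => hne (Subtype.ext (Prod.ext h
        (ZMod.val_injective M h')))) δ)
    have hX : iIndepFun (fun (b : {b : V × ZMod M | b.1 ≠ φ}) ω => t.slotBit G δ M (bars ω) b) μ :=
      hindep.comp (fun _ k => !decide (k = 0)) fun _ => measurable_of_countable _
    have htrials := measureReal_forall_fails_le (I := {b : V × ZMod M | b.1 ≠ φ})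
      (X := fun b ω => t.slotBit G δ M (bars ω) b) (n := n) hP (by linarith) (by linarith) ha1 ha hX
      (fun b hb => (measurable_of_countable (fun k : ℕ∞ => !decide (k = 0))).comp_aemeasurable
        (hasLaw_barCount hB he hb _ _).aemeasurable) (fun b hb => ?_) hlevel I hI
      (fun c hc b hb => ?_) (fun c => (I c).card + 1)
    · replace htrials := htrials.trans (pow_le_pow_of_le_one (by norm_num) (by norm_num)
        (two_pow_le_card_level m))
      refine (measureReal_mono (fun ω hω => ?_)).trans
        ((measureReal_union_le {ω | ¬ t.Separated G (bars ω) F δ M} _).trans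
          (add_le_add (measureReal_not_separated_le hB he hF δ M) htrials)) |>.trans ?_
      · by_contra hcon
        simp only [Set.mem_union, not_or] at hcon
        obtain ⟨h1, h2⟩ := hcon
        have h1 : t.Separated G (bars ω) F δ M := by_contra h1
        obtain ⟨σ, hσ, hlt⟩ := hω
        refine h2 fun c hc => ?_
        by_contra hf
        obtain ⟨k, s, hs, hk⟩ := h1.exists_le_depth_of_not_fails he (hlevel c hc).2 hσ (hI c) hf
        rw [hMδ] at hs hk
        exact absurd (hlt c hc k s hs) (not_lt.2 hk)
      · have hM0 : (M : ℝ) ≠ 0 := by exact_mod_cast NeZero.ne M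
        refine le_of_eq ?_
        rw [hδr]
        field_simp
    · have hs : (fun ω => t.slotBit G δ M (bars ω) b) ⁻¹' {true} = {ω | t.barCount G b.1
          (b.2.val * δ) ((b.2.val + 1) * δ) (bars ω) ≠ 0} := by
        ext ω
        exact slotBit_eq_true
      rw [hs, measureReal_barCount_ne_zero hB he hb, slot_length]
    · have hb' := (hI c b).1 hb
      have h1 := hb'.1.depth_le
      rw [(hlevel c hc).1] at h1
      rintro h2
      rw [h2, he.depth_root] at h1
      omega
  have hlim : Tendsto (fun M : ℕ => (F.card * (T : ℝ) ^ 2 + F.card * F.card * (T : ℝ) ^ 2 +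
      F.card * T) / M + (383 / 384 : ℝ) ^ 2 ^ m) atTop (𝓝 (0 + (383 / 384) ^ 2 ^ m)) :=
    (tendsto_const_div_atTop_nhds_zero_nat _).add_const _
  rw [zero_add] at hlim
  refine ge_of_tendsto hlim ?_
  filter_upwards [eventually_ge_atTop (max M₀ 1)] with M hM using key M hM

end BranchTree

/-! ### Infinite cycles -/

namespace BranchTree

variable {V : Type*} {D : ℕ} {t : BranchTree V D} {G : SimpleGraph V} {φ : V}
  {Ω : Type*} {mΩ : MeasurableSpace Ω} {μ : Measure Ω} [IsProbabilityMeasure μ]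
  {bars : Ω → Set (G.edgeSet × ℝ≥0)}

theorem ae_hasInfiniteCycle (hB : G.IsPoissonBars μ bars) (he : t.Encodes G φ)
    (hG : ∀ v, (G.neighborSet v).Finite) {T : ℝ≥0}
    {M₀ : ℕ} (hT : ∀ M ≥ M₀, ∃ H K L a, Params D M H K L (1 - Real.exp (-(T / M))) a ∧ a ≤ 1 ∧
      a ≤ rescueProb D (1 - Real.exp (-(T / M))) (1 / 384) H) :
    ∀ᵐ ω ∂μ, ∀ σ, G.IsStirring (bars ω) σ → (σ T).HasInfiniteCycle := by
  classical
  have key : ∀ m : ℕ, μ {ω | ¬ ∀ σ, G.IsStirring (bars ω) σ → (σ T).HasInfiniteCycle} ≤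
      ENNReal.ofReal ((383 / 384) ^ 2 ^ (m + 1)) := by
    intro m
    set U : ℕ → Set Ω := fun n => {ω | ∃ σ, G.IsStirring (bars ω) σ ∧
      ∀ c ∈ t.level φ (m + 1), ∀ k : ℕ, ∀ s ≤ T, t.depth (σ s ((σ T ^ k) c)) < n}
    have hmono : Monotone U := fun n n' hnn => by
      rintro ω ⟨σ, hσ, h⟩
      exact ⟨σ, hσ, fun c hc k s hs => (h c hc k s hs).trans_le hnn⟩
    have hsub : {ω | ¬ ∀ σ, G.IsStirring (bars ω) σ → (σ T).HasInfiniteCycle} ⊆ ⋃ n, U n := by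
      intro ω hω
      have hω : ¬ ∀ σ, G.IsStirring (bars ω) σ → (σ T).HasInfiniteCycle := hω
      push Not at hω
      obtain ⟨σ, hσ, hinf⟩ := hω
      have hbd : ∀ c, ∃ n, ∀ k : ℕ, ∀ s ≤ T, t.depth (σ s ((σ T ^ k) c)) < n := by
        intro c
        by_contra! hcon
        exact hinf ⟨c, hσ.infinite_sameCycle hG hcon⟩
      choose b hb using hbd
      refine Set.mem_iUnion.2 ⟨(t.level φ (m + 1)).sup b, σ, hσ, fun c hc k s hs => ?_⟩
      exact (hb c k s hs).trans_le (Finset.le_sup hc)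
    refine (measure_mono hsub).trans ?_
    rw [hmono.measure_iUnion]
    refine iSup_le fun n => ?_
    rw [ENNReal.le_ofReal_iff_toReal_le (measure_ne_top _ _) (by positivity)]
    exact measureReal_forall_depth_lt_le hB he hT m.succ_ne_zero n
  have hlim : Tendsto (fun m : ℕ => ENNReal.ofReal ((383 / 384) ^ 2 ^ (m + 1))) atTop (𝓝 0) := by
    rw [← ENNReal.ofReal_zero]
    refine ENNReal.tendsto_ofReal ?_
    refine (tendsto_pow_atTop_nhds_zero_of_lt_one (by norm_num) (by norm_num)).comp ?_
    exact (tendsto_pow_atTop_atTop_of_one_lt (by norm_num)).comp (tendsto_add_atTop_nat 1)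
  rw [ae_iff]
  exact le_antisymm (ge_of_tendsto' hlim key) zero_le

end BranchTree

/-! ### Construction of the stirring process -/

theorem NNReal.nhdsLT_zero : 𝓝[<] (0 : ℝ≥0) = ⊥ := by
  have : Set.Iio (0 : ℝ≥0) = ∅ := by ext; simp
  rw [this, nhdsWithin_empty]

namespace SimpleGraph

variable {V : Type*} {G : SimpleGraph V} {B : Set (G.edgeSet × ℝ≥0)} {f g : ℝ≥0 → V} {x y z : V}
  {a b τ : ℝ≥0} {P Q : ℝ≥0 → Prop} {σ σ' : ℝ≥0 → Equiv.Perm V}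

/-- The bars at the times that satisfy `P`. -/
def barsAt (G : SimpleGraph V) (B : Set (G.edgeSet × ℝ≥0)) (P : ℝ≥0 → Prop) :
    Set (G.edgeSet × ℝ≥0) :=
  {b | b ∈ B ∧ P b.2}

theorem hasBar_barsAt : G.HasBar (G.barsAt B P) τ x y ↔ G.HasBar B τ x y ∧ P τ :=
  ⟨fun ⟨h, h1, h2⟩ => ⟨⟨h, h1⟩, h2⟩, fun ⟨⟨h, h1⟩, h2⟩ => ⟨h, h1, h2⟩⟩

theorem NoClash.barsAt (hB : G.NoClash B) (P : ℝ≥0 → Prop) : G.NoClash (G.barsAt B P) :=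
  fun τ x y z hτ h h' => hB τ x y z hτ (hasBar_barsAt.1 h).1 (hasBar_barsAt.1 h').1

theorem IsStirring.mul (hσ : G.IsStirring (G.barsAt B P) σ) (hσ' : G.IsStirring (G.barsAt B Q) σ')
    (hP : ∀ τ, P τ → τ ≤ a) (hQ : ∀ τ, Q τ → a < τ) :
    G.IsStirring (G.barsAt B fun τ => P τ ∨ Q τ) fun s => σ' s * σ s := by
  have h1 : ∀ v s, a ≤ s → σ s v = σ a v := fun v s hs =>
    (hσ.isParticle v).eq_of_forall_not_hasBar (b := s) rfl
      (fun r hr _ z hz => absurd (hP r (hasBar_barsAt.1 hz).2) (not_le.2 hr)) s hs le_rfl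
  have h2 : ∀ v s, s ≤ a → σ' s v = v := fun v s hs =>
    (hσ'.isParticle v).eq_of_forall_not_hasBar (a := 0) (b := s) (by simp [hσ'.zero])
      (fun r _ hr z hz => absurd (hQ r (hasBar_barsAt.1 hz).2) (not_lt.2 (hr.trans hs))) s bot_le
      le_rfl
  refine ⟨by simp [hσ.zero, hσ'.zero], fun v t => ?_, fun v t => ?_⟩
  · rcases lt_or_ge t a with h | h
    · filter_upwards [hσ.right_continuous v t, Ioo_mem_nhdsGT h] with s hs hsa
      simp only [Equiv.Perm.mul_apply]
      rw [h2 _ _ hsa.2.le, h2 _ _ h.le, hs]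
    · filter_upwards [hσ'.right_continuous (σ a v) t, self_mem_nhdsWithin] with s hs hst
      simp only [Equiv.Perm.mul_apply]
      rw [h1 v s (h.trans (le_of_lt hst)), h1 v t h, hs]
  · rcases le_or_gt t a with h | h
    · filter_upwards [hσ.update v t, self_mem_nhdsWithin] with s hs hst
      simp only [Equiv.Perm.mul_apply]
      rw [h2 _ _ ((le_of_lt hst).trans h), h2 _ _ h]
      refine hs.congr fun z => ?_
      rw [hasBar_barsAt, hasBar_barsAt, or_iff_left fun hq => absurd (hQ t hq) (not_lt.2 h)]
    · filter_upwards [hσ'.update (σ a v) t, Ioo_mem_nhdsLT h] with s hs hst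
      simp only [Equiv.Perm.mul_apply]
      rw [h1 v s hst.1.le, h1 v t h.le]
      refine hs.congr fun z => ?_
      rw [hasBar_barsAt, hasBar_barsAt, or_iff_right fun hp => absurd (hP t hp) (not_le.2 h)]

theorem exists_isStirring_at (hB : G.NoClash B) (hτ : 0 < τ) :
    ∃ σ, G.IsStirring (G.barsAt B (· = τ)) σ := by
  classical
  have hp : ∀ x, ∃ y, G.StirStep B τ x y := fun x => by
    by_cases h : ∃ y, G.HasBar B τ x y
    · exact ⟨h.choose, Or.inl h.choose_spec⟩
    · exact ⟨x, Or.inr ⟨rfl, fun z hz => h ⟨z, hz⟩⟩⟩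
  choose p hp using hp
  have hinv : Function.Involutive p := fun x => by
    refine (hp (p x)).unique hB hτ ?_
    rcases hp x with h | h
    · exact Or.inl h.symm
    · rw [h.1]; exact Or.inr ⟨rfl, h.2⟩
  refine ⟨fun s => if τ ≤ s then hinv.toPerm p else 1, by simp [hτ.ne'], fun v t => ?_,
    fun v t => ?_⟩
  · rcases lt_or_ge t τ with h | h
    · filter_upwards [Ioo_mem_nhdsGT h] with s hs
      rw [if_neg (not_le.2 hs.2), if_neg (not_le.2 h)]
    · filter_upwards [self_mem_nhdsWithin] with s hs
      rw [if_pos h, if_pos (h.trans (le_of_lt hs))]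
  · rcases lt_trichotomy t τ with h | rfl | h
    · filter_upwards [self_mem_nhdsWithin] with s hs
      rw [if_neg (not_le.2 (lt_trans hs h)), if_neg (not_le.2 h)]
      exact Or.inr ⟨rfl, fun z hz => h.ne (hasBar_barsAt.1 hz).2⟩
    · filter_upwards [self_mem_nhdsWithin] with s hs
      rw [if_neg (not_le.2 hs), if_pos le_rfl]
      exact (hp v).congr fun z => by rw [hasBar_barsAt]; simp
    · filter_upwards [Ioo_mem_nhdsLT h] with s hs
      rw [if_pos hs.1.le, if_pos h.le]
      exact Or.inr ⟨rfl, fun z hz => h.ne' (hasBar_barsAt.1 hz).2⟩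

/-- Finitely many transpositions can be composed in the order of their times. -/
theorem exists_isStirring_finset (hB : G.NoClash B) (Θ : Finset ℝ≥0) (hΘ : ∀ τ ∈ Θ, 0 < τ) :
    ∃ σ, G.IsStirring (G.barsAt B (· ∈ Θ)) σ := by
  induction Θ using Finset.induction_on_max with
  | empty =>
    refine ⟨fun _ => 1, rfl, fun v t => Eventually.of_forall fun s => rfl, fun v t =>
      Eventually.of_forall fun s => Or.inr ⟨rfl, fun z hz => ?_⟩⟩
    exact absurd (hasBar_barsAt.1 hz).2 (by simp)
  | insert a s hs ih =>
    obtain ⟨σ, hσ⟩ := ih fun τ hτ => hΘ τ (Finset.mem_insert_of_mem hτ)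
    have ha := hΘ a (Finset.mem_insert_self _ _)
    obtain ⟨σ', hσ'⟩ := exists_isStirring_at hB ha
    have h := hσ.mul hσ' (a := s.sup id) (fun τ hτ => Finset.le_sup (f := id) hτ) (by
      rintro τ rfl
      exact (Finset.sup_lt_iff ha).2 hs)
    refine ⟨fun s => σ' s * σ s, ?_⟩
    convert h using 2
    funext τ
    rw [Finset.mem_insert, or_comm]

/-- A set of vertices that is not connected by bars to its complement, and such that the bars at
its vertices have times in `Θ`. -/
structure Enclosed (G : SimpleGraph V) (B : Set (G.edgeSet × ℝ≥0)) (S : Set V)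
    (Θ : Finset ℝ≥0) : Prop where
  mem : ∀ τ x y, x ∈ S → 0 < τ → G.HasBar B τ x y → y ∈ S
  time : ∀ τ x y, x ∈ S → 0 < τ → G.HasBar B τ x y → τ ∈ Θ

variable {S : Set V} {Θ Θ' : Finset ℝ≥0}

theorem IsParticle.mem_of_closed (hf : G.IsParticle B f)
    (hS : ∀ τ x y, x ∈ S → 0 < τ → G.HasBar B τ x y → y ∈ S) (h : f 0 ∈ S) (t : ℝ≥0) :
    f t ∈ S := by
  refine NNReal.interval_induction (P := fun s => f s ∈ S) (a := 0) (b := t) h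
    (fun s _ _ hs => ?_) (fun s h1 h2 hs => ?_) t bot_le le_rfl
  · filter_upwards [hf.right_continuous s] with r hr
    rwa [hr]
  · obtain ⟨r, h3, h4, h5⟩ := NNReal.exists_mem_Ico_of_eventually h1 (hf.update s)
    rcases h5 with h5 | h5
    · exact hS s _ _ (hs r h3 h4) h1 h5
    · rw [h5.1]; exact hs r h3 h4

theorem Enclosed.isParticle (hS : G.Enclosed B S Θ) (hΘ : Θ ⊆ Θ')
    (hf : G.IsParticle (G.barsAt B (· ∈ Θ')) f) (h : f 0 ∈ S) : G.IsParticle B f := by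
  refine ⟨hf.right_continuous, fun t => ?_⟩
  rcases eq_zero_or_pos t with rfl | ht
  · rw [NNReal.nhdsLT_zero]
    exact eventually_bot
  · filter_upwards [hf.update t] with s hs
    refine hs.congr fun z => ?_
    rw [hasBar_barsAt, and_iff_left_iff_imp]
    intro hz
    exact hΘ (hS.time t _ z (hf.mem_of_closed (fun τ x y hx hτ hxy => hS.mem τ x y hx hτ
      (hasBar_barsAt.1 hxy).1) h s) ht hz)

/-- If every vertex belongs to an enclosed set, then the transpositions can be performed
separately in each of them. -/
theorem exists_isStirring_of_enclosed (hB : G.NoClash B)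
    (h : ∀ v, ∃ S Θ, v ∈ S ∧ (∀ τ ∈ Θ, 0 < τ) ∧ G.Enclosed B S Θ) : ∃ σ, G.IsStirring B σ := by
  classical
  choose S Θ hvS hΘ hS using h
  have hst : ∀ Θ : Finset ℝ≥0, ∃ σ, (∀ τ ∈ Θ, 0 < τ) → G.IsStirring (G.barsAt B (· ∈ Θ)) σ :=
    fun Θ => by
    by_cases h : ∀ τ ∈ Θ, 0 < τ
    · obtain ⟨σ, hσ⟩ := exists_isStirring_finset hB Θ h
      exact ⟨σ, fun _ => hσ⟩
    · exact ⟨fun _ => 1, fun h' => absurd h' h⟩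
  choose σ hσ using hst
  have hpart : ∀ w v Θ', v ∈ S w → Θ w ⊆ Θ' → (∀ τ ∈ Θ', 0 < τ) →
      G.IsParticle B fun s => σ Θ' s v := fun w v Θ' hv hsub hΘ' =>
    (hS w).isParticle hsub ((hσ Θ' hΘ').isParticle v) (by simpa [(hσ Θ' hΘ').zero] using hv)
  have huniq : ∀ w v Θ', v ∈ S w → Θ w ⊆ Θ' → (∀ τ ∈ Θ', 0 < τ) → ∀ t,
      σ Θ' t v = σ (Θ v) t v := fun w v Θ' hv hsub hΘ' t =>
    (hpart w v Θ' hv hsub hΘ').eq_of_noClash hB (hpart v v (Θ v) (hvS v) subset_rfl (hΘ v))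
      (by simp [(hσ Θ' hΘ').zero, (hσ (Θ v) (hΘ v)).zero]) (fun _ _ _ _ _ => Iff.rfl) t le_rfl
  have hbij : ∀ t, Function.Bijective fun v => σ (Θ v) t v := fun t => by
    constructor
    · intro v w hvw
      have hpos : ∀ τ ∈ Θ v ∪ Θ w, 0 < τ := fun τ hτ => by
        rcases Finset.mem_union.1 hτ with hτ | hτ
        · exact hΘ v τ hτ
        · exact hΘ w τ hτ
      have h1 := huniq v v (Θ v ∪ Θ w) (hvS v) Finset.subset_union_left hpos t
      have h2 := huniq w w (Θ v ∪ Θ w) (hvS w) Finset.subset_union_right hpos t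
      refine (σ (Θ v ∪ Θ w) t).injective ?_
      rw [h1, h2]
      exact hvw
    · intro y
      refine ⟨(σ (Θ y) t).symm y, ?_⟩
      have hx : (σ (Θ y) t).symm y ∈ S y := by
        by_contra hx
        have h0 := (hσ (Θ y) (hΘ y)).isParticle ((σ (Θ y) t).symm y)
        have := h0.mem_of_closed (S := (S y)ᶜ) (fun τ x z hx hτ hxz hz => hx ((hS y).mem τ z x hz hτ
          (hasBar_barsAt.1 hxz).1.symm)) (by simpa [(hσ (Θ y) (hΘ y)).zero] using hx) t
        simp only [Equiv.apply_symm_apply] at this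
        exact this (hvS y)
      have := huniq y _ (Θ y) hx subset_rfl (hΘ y) t
      rw [Equiv.apply_symm_apply] at this
      exact this.symm
  have hp : ∀ v, G.IsParticle B fun t => σ (Θ v) t v := fun v =>
    hpart v v (Θ v) (hvS v) subset_rfl (hΘ v)
  refine ⟨fun t => Equiv.ofBijective _ (hbij t), ?_, fun v t => (hp v).right_continuous t,
    fun v t => (hp v).update t⟩
  ext v
  simp [(hσ (Θ v) (hΘ v)).zero]

/-- Stirring processes on successive short time intervals can be put together. -/
theorem exists_isStirring_of_forall_slot (hB : G.NoClash B) {ε : ℝ≥0} (hε : 0 < ε)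
    (h : ∀ k : ℕ, ∃ σ, G.IsStirring (G.barsAt B (· ∈ Set.Ioc (k * ε) ((k + 1) * ε))) σ) :
    ∃ σ, G.IsStirring B σ := by
  have hk : ∀ k : ℕ, ∃ σ, G.IsStirring (G.barsAt B fun τ => 0 < τ ∧ τ ≤ k * ε) σ := by
    intro k
    induction k with
    | zero =>
      refine ⟨fun _ => 1, rfl, fun v t => Eventually.of_forall fun s => rfl, fun v t =>
        Eventually.of_forall fun s => Or.inr ⟨rfl, fun z hz => ?_⟩⟩
      have := (hasBar_barsAt.1 hz).2
      rw [Nat.cast_zero, zero_mul] at this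
      exact absurd this.1 (not_lt.2 this.2)
    | succ k ih =>
      obtain ⟨σ, hσ⟩ := ih
      obtain ⟨σ', hσ'⟩ := h k
      refine ⟨fun s => σ' s * σ s, ?_⟩
      · convert hσ.mul hσ' (a := k * ε) (fun τ hτ => hτ.2) (fun τ hτ => hτ.1) using 2
        funext τ
        have h1 : (k : ℝ≥0) * ε ≤ (k + 1) * ε := by gcongr; exact le_self_add
        push_cast
        apply propext
        constructor
        · rintro ⟨h2, h3⟩
          rcases le_or_gt τ (k * ε) with h4 | h4
          · exact Or.inl ⟨h2, h4⟩
          · exact Or.inr ⟨h4, h3⟩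
        · rintro (⟨h2, h3⟩ | ⟨h2, h3⟩)
          · exact ⟨h2, h3.trans h1⟩
          · exact ⟨lt_of_le_of_lt zero_le h2, h3⟩
  choose ρ hρ using hk
  have hcons : ∀ (k l : ℕ) t v, t ≤ k * ε → t ≤ l * ε → ρ k t v = ρ l t v := fun k l t v h1 h2 => by
    refine ((hρ k).isParticle v).eq_of_noClash (hB.barsAt _) ((hρ l).isParticle v)
      (by simp [(hρ k).zero, (hρ l).zero]) (b := t) (fun τ x y h3 h4 => ?_) t le_rfl
    rw [hasBar_barsAt, hasBar_barsAt]
    simp [h3, h4.trans h1, h4.trans h2]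
  have hex : ∀ t : ℝ≥0, ∃ k : ℕ, t < k * ε := fun t => by
    obtain ⟨k, hk⟩ := exists_nat_gt (t / ε)
    exact ⟨k, (div_lt_iff₀ hε).1 hk⟩
  choose κ hκ using hex
  refine ⟨fun t => ρ (κ t) t, (hρ _).zero, fun v t => ?_, fun v t => ?_⟩
  · filter_upwards [(hρ (κ t)).right_continuous v t, Ioo_mem_nhdsGT (hκ t)] with s hs hst
    rw [← hs]
    exact hcons _ _ _ _ (hκ s).le hst.2.le
  · rcases eq_zero_or_pos t with rfl | ht
    · rw [NNReal.nhdsLT_zero]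
      exact eventually_bot
    · filter_upwards [(hρ (κ t)).update v t, self_mem_nhdsWithin] with s hs hst
      rw [hcons _ (κ t) s v (hκ s).le ((le_of_lt hst).trans (hκ t).le)]
      refine hs.congr fun z => ?_
      rw [hasBar_barsAt]
      simp [ht, (hκ t).le]

end SimpleGraph

/-! ### Almost sure existence and uniqueness of the stirring process -/

namespace BranchTree

variable {V : Type*} {D : ℕ} {t : BranchTree V D} {G : SimpleGraph V} {φ : V}
  {Ω : Type*} {mΩ : MeasurableSpace Ω} {μ : Measure Ω} {B : Set (G.edgeSet × ℝ≥0)}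
  {bars : Ω → Set (G.edgeSet × ℝ≥0)} {P : V → Prop} {w x y v : V} {n : ℕ}

/-- `t.OpenBelow P w x`: the vertex `x` is `w` or a descendant of `w` such that all vertices on the
path from `w` to `x`, with the possible exception of `w`, satisfy `P`. -/
inductive OpenBelow (t : BranchTree V D) (P : V → Prop) (w : V) : V → Prop
  | refl : OpenBelow t P w w
  | child {x y : V} : OpenBelow t P w x → y ∈ t.ch x → P y → OpenBelow t P w y

/-- The finite set of the descendants of `w` that are `n` levels below `w`. -/
def descendants [DecidableEq V] (t : BranchTree V D) (w : V) : ℕ → Finset V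
  | 0 => {w}
  | n + 1 => (descendants t w n).biUnion t.ch

theorem card_descendants_le [DecidableEq V] (w : V) (n : ℕ) :
    (t.descendants w n).card ≤ D ^ n := by
  induction n with
  | zero => simp [descendants]
  | succ n ih =>
    rw [descendants, pow_succ]
    exact (Finset.card_biUnion_le_card_mul _ _ D fun v _ => t.card_ch_le v).trans (by gcongr)

theorem OpenBelow.mem_descendants [DecidableEq V] (h : t.OpenBelow P w x)
    (hx : t.depth x = t.depth w + n) : x ∈ t.descendants w n := by
  induction n generalizing x with
  | zero =>
    cases h with
    | refl => simp [descendants]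
    | child h hy hP =>
      exfalso
      have h1 : ∀ {x}, t.OpenBelow P w x → t.depth w ≤ t.depth x := fun h => by
        induction h with
        | refl => exact le_rfl
        | child _ hy _ ih => have := depth_of_mem_ch hy; omega
      have := h1 h
      have := depth_of_mem_ch hy
      omega
  | succ n ih =>
    cases h with
    | refl => omega
    | child h hy hP =>
      have := depth_of_mem_ch hy
      exact Finset.mem_biUnion.2 ⟨_, ih h (by omega), hy⟩

theorem depth_of_mem_descendants [DecidableEq V] (hx : x ∈ t.descendants w n) :
    t.depth x = t.depth w + n := by
  induction n generalizing x with
  | zero => rw [Finset.mem_singleton.1 hx]; rfl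
  | succ n ih =>
    obtain ⟨u, hu, hxu⟩ := Finset.mem_biUnion.1 hx
    rw [depth_of_mem_ch hxu, ih hu, add_assoc]

/-- The path from `w` to a descendant `n` levels below, without `w`, has `n` vertices. -/
theorem exists_path_finset [DecidableEq V] (he : t.Encodes G φ) (hx : x ∈ t.descendants w n) :
    ∃ F : Finset V, F.card = n ∧ (∀ z ∈ F, z ≠ φ ∧ t.depth z ≤ t.depth x) ∧
      ∀ P, t.OpenBelow P w x → ∀ z ∈ F, P z := by
  induction n generalizing x with
  | zero => exact ⟨∅, by simp⟩
  | succ n ih =>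
    obtain ⟨u, hu, hxu⟩ := Finset.mem_biUnion.1 hx
    obtain ⟨F, hF, hF', hP⟩ := ih hu
    have hd := depth_of_mem_ch hxu
    have hxF : x ∉ F := fun h => by
      have := (hF' x h).2
      omega
    refine ⟨insert x F, by rw [Finset.card_insert_of_notMem hxF, hF], fun z hz => ?_,
      fun P h z hz => ?_⟩
    · rcases Finset.mem_insert.1 hz with rfl | hz
      · exact ⟨ne_of_mem_ch he hxu, le_rfl⟩
      · exact ⟨(hF' z hz).1, by have := (hF' z hz).2; omega⟩
    · cases h with
      | refl =>
        have := depth_of_mem_descendants hx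
        omega
      | child h hy hPx =>
        rw [← par_of_mem_ch hy, par_of_mem_ch hxu] at h
        rcases Finset.mem_insert.1 hz with rfl | hz
        · exact hPx
        · exact hP P h z hz

theorem OpenBelow.finite (he : t.Encodes G φ) (h : ∀ x, t.OpenBelow P w x →
    t.depth x ≠ t.depth w + n) : {x | t.OpenBelow P w x}.Finite := by
  classical
  refine (he.finite_depth_le (t.depth w + n)).subset fun x hx => ?_
  have key : t.depth x < t.depth w + n := by
    induction hx with
    | refl =>
      have := h w .refl
      omega
    | child hx hy hP ih =>
      have := h _ (hx.child hy hP)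
      have := depth_of_mem_ch hy
      omega
  exact key.le

/-- If all downward clusters are finite, then every vertex belongs to an enclosed set: from a
vertex, one can only reach the downward clusters of its ancestors. -/
theorem exists_enclosed [DecidableEq V] (he : t.Encodes G φ)
    (hpos : ∀ τ x y, G.HasBar B τ x y → 0 < τ)
    (hfin : ∀ w, {x | t.OpenBelow (fun z => ∃ τ, G.HasBar B τ z (t.par z)) w x}.Finite)
    (htime : ∀ z, {τ | G.HasBar B τ z (t.par z)}.Finite) (v : V) :
    ∃ S Θ, v ∈ S ∧ (∀ τ ∈ Θ, 0 < τ) ∧ G.Enclosed B S Θ := by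
  set P : V → Prop := fun z => ∃ τ, G.HasBar B τ z (t.par z) with hP
  set S : Set V := {x | ∃ a, t.Below a v ∧ t.OpenBelow P a x} with hS
  have hSfin : S.Finite := by
    have : S ⊆ ⋃ a ∈ {a | t.depth a ≤ t.depth v}, {x | t.OpenBelow P a x} := by
      rintro x ⟨a, ha, hx⟩
      exact Set.mem_biUnion (show a ∈ {a | t.depth a ≤ t.depth v} from ha.depth_le) hx
    exact ((he.finite_depth_le _).biUnion fun a _ => hfin a).subset this
  have hΘ : (⋃ x ∈ S, ⋃ z ∈ t.edges x, {τ | G.HasBar B τ z (t.par z)}).Finite :=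
    hSfin.biUnion fun x _ => (t.edges x).finite_toSet.biUnion fun z _ => htime z
  refine ⟨S, hΘ.toFinset, ⟨v, .refl, .refl⟩, fun τ hτ => ?_, ⟨fun τ x y hx _ hxy => ?_,
    fun τ x y hx _ hxy => ?_⟩⟩
  · rw [Set.Finite.mem_toFinset] at hτ
    simp only [Set.mem_iUnion] at hτ
    obtain ⟨x, -, z, -, hz⟩ := hτ
    exact hpos _ _ _ hz
  · obtain ⟨z, hz, hzφ, rfl, hbar⟩ := (hasBar_iff he).1 hxy
    obtain ⟨a, ha, hax⟩ := hx
    rcases mem_edges.1 hz with rfl | hz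
    · rw [other_self]
      cases hax with
      | refl => exact ⟨t.par z, (below_of_mem_ch (he.mem_ch_par z hzφ)).trans ha, .refl⟩
      | child h hy _ => exact ⟨a, ha, by rwa [par_of_mem_ch hy]⟩
    · rw [other_of_mem_ch hz]
      exact ⟨a, ha, hax.child hz ⟨τ, hbar⟩⟩
  · obtain ⟨z, hz, hzφ, rfl, hbar⟩ := (hasBar_iff he).1 hxy
    rw [Set.Finite.mem_toFinset]
    exact Set.mem_biUnion hx
      (Set.mem_biUnion (t := fun z => {τ | G.HasBar B τ z (t.par z)}) hz hbar)

variable [IsProbabilityMeasure μ]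

/-- Almost surely, no two bars are simultaneous. -/
theorem ae_noClash (hB : G.IsPoissonBars μ bars) (he : t.Encodes G φ) :
    ∀ᵐ ω ∂μ, G.NoClash (bars ω) := by
  classical
  have := he.countable
  have hpair : ∀ (N : ℕ) (w w' : V), w ≠ φ → w' ≠ φ → w ≠ w' → ∀ᵐ ω ∂μ, ∀ τ : ℝ≥0, 0 < τ → τ ≤ N →
      G.HasBar (bars ω) τ w (t.par w) → ¬ G.HasBar (bars ω) τ w' (t.par w') := by
    intro N w w' hw hw' hne
    set F : Finset V := {w, w'} with hFdef
    have hF : ∀ z ∈ F, z ≠ φ := fun z hz => by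
      rcases Finset.mem_insert.1 hz with rfl | hz
      · exact hw
      · rw [Finset.mem_singleton.1 hz]; exact hw'
    have key : ∀ M : ℕ, 1 ≤ M → μ.real {ω | ¬ ∀ τ : ℝ≥0, 0 < τ → τ ≤ N →
        G.HasBar (bars ω) τ w (t.par w) → ¬ G.HasBar (bars ω) τ w' (t.par w')} ≤
        (F.card * (N : ℝ) ^ 2 + F.card * F.card * (N : ℝ) ^ 2 + F.card * N) / M := by
      intro M hM
      have hM0 : (M : ℝ≥0) ≠ 0 := by exact_mod_cast (by omega : M ≠ 0)
      set δ : ℝ≥0 := N / M with hδ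
      refine (measureReal_mono fun ω hω => ?_).trans
        ((measureReal_not_separated_le hB he hF δ M).trans (le_of_eq ?_))
      · intro hsep
        refine hω fun τ h0 hN hτ hτ' => ?_
        have hδ0 : 0 < δ := by
          refine div_pos (h0.trans_le hN) (by positivity)
        set j := ⌈τ / δ⌉₊ - 1 with hj
        have hc : 0 < ⌈τ / δ⌉₊ := Nat.ceil_pos.2 (by positivity)
        have hj1 : ((j : ℝ≥0) + 1) = ⌈τ / δ⌉₊ := by
          have : j + 1 = ⌈τ / δ⌉₊ := by omega
          exact_mod_cast this
        have h1 : τ ≤ (j + 1) * δ := by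
          rw [hj1, ← div_le_iff₀ hδ0]
          exact Nat.le_ceil _
        have h2 : j * δ < τ := by
          rw [← lt_div_iff₀ hδ0]
          exact Nat.lt_ceil.1 (by omega)
        have hjM : j < M := by
          have h3 : τ / δ ≤ M := by
            rw [div_le_iff₀ hδ0, hδ, mul_div_cancel₀ _ hM0]
            exact hN
          have := Nat.ceil_le.2 h3
          omega
        exact hne (hsep.eq_of_ne_zero j hjM w (by simp [F]) w' (by simp [F])
          (barCount_ne_zero_iff.2 ⟨τ, ⟨h2, h1⟩, hτ⟩) (barCount_ne_zero_iff.2 ⟨τ, ⟨h2, h1⟩, hτ'⟩))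
      · have hδr : (δ : ℝ) = N / M := by rw [hδ]; simp
        have hM0' : (M : ℝ) ≠ 0 := by exact_mod_cast (by omega : M ≠ 0)
        rw [hδr]
        field_simp
    have hlim := tendsto_const_div_atTop_nhds_zero_nat
      (F.card * (N : ℝ) ^ 2 + F.card * F.card * (N : ℝ) ^ 2 + F.card * N)
    have h0 := ge_of_tendsto hlim ((eventually_ge_atTop 1).mono key)
    have h1 := le_antisymm h0 measureReal_nonneg
    rw [measureReal_def, ENNReal.toReal_eq_zero_iff] at h1
    exact h1.resolve_right (measure_ne_top _ _)
  have hall : ∀ᵐ ω ∂μ, ∀ (N : ℕ) (w w' : V), w ≠ φ → w' ≠ φ → w ≠ w' → ∀ τ : ℝ≥0, 0 < τ → τ ≤ N →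
      G.HasBar (bars ω) τ w (t.par w) → ¬ G.HasBar (bars ω) τ w' (t.par w') := by
    rw [ae_all_iff]; intro N
    rw [ae_all_iff]; intro w
    rw [ae_all_iff]; intro w'
    by_cases h : w ≠ φ ∧ w' ≠ φ ∧ w ≠ w'
    · filter_upwards [hpair N w w' h.1 h.2.1 h.2.2] with ω hω _ _ _ using hω
    · exact Eventually.of_forall fun ω h1 h2 h3 => absurd ⟨h1, h2, h3⟩ h
  filter_upwards [hall] with ω hω τ x y z hτ hy hz
  obtain ⟨e, -, heφ, rfl, he1⟩ := (hasBar_iff he).1 hy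
  obtain ⟨e', -, heφ', rfl, he2⟩ := (hasBar_iff he).1 hz
  by_cases h : e = e'
  · rw [h]
  · obtain ⟨N, hN⟩ := exists_nat_ge τ
    exact absurd he2 (hω N e e' heφ heφ' h τ hτ hN he1)

/-- In a short time interval, downward clusters are almost surely finite, because their expected
sizes are finite. -/
theorem ae_openBelow_finite (hB : G.IsPoissonBars μ bars) (he : t.Encodes G φ) {a b : ℝ≥0}
    (hab : D * ((b - a : ℝ≥0) : ℝ) ≤ 1 / 2) (w : V) :
    ∀ᵐ ω ∂μ, {x | t.OpenBelow (fun z => t.barCount G z a b (bars ω) ≠ 0) w x}.Finite := by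
  classical
  have key : ∀ n : ℕ, μ.real {ω | ¬ {x | t.OpenBelow (fun z => t.barCount G z a b (bars ω) ≠ 0)
      w x}.Finite} ≤ (1 / 2) ^ n := by
    intro n
    choose! F hF using fun x (hx : x ∈ t.descendants w n) => exists_path_finset he hx
    have hsub : {ω | ¬ {x | t.OpenBelow (fun z => t.barCount G z a b (bars ω) ≠ 0) w x}.Finite} ⊆
        ⋃ x ∈ t.descendants w n, {ω | ∀ z ∈ F x, t.barCount G z a b (bars ω) ≠ 0} := by
      intro ω hω
      by_contra hcon
      simp only [Set.mem_iUnion, not_exists] at hcon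
      refine hω (OpenBelow.finite (n := n) he fun x hx hd => ?_)
      have hx' := hx.mem_descendants hd
      exact hcon x hx' ((hF x hx').2.2 _ hx)
    refine (measureReal_mono hsub (measure_ne_top _ _)).trans
      ((measureReal_biUnion_finset_le _ _).trans ?_)
    refine (Finset.sum_le_card_nsmul _ _ (((b - a : ℝ≥0) : ℝ) ^ n) fun x hx => ?_).trans ?_
    · have := measureReal_forall_barCount_ne_zero_le hB he (F := F x)
        (fun z hz => ((hF x hx).2.1 z hz).1) a b
      rwa [(hF x hx).1] at this
    · rw [nsmul_eq_mul]
      calc ((t.descendants w n).card : ℝ) * ((b - a : ℝ≥0) : ℝ) ^ n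
          ≤ (D : ℝ) ^ n * ((b - a : ℝ≥0) : ℝ) ^ n := by
            gcongr
            exact_mod_cast card_descendants_le w n
        _ = (D * ((b - a : ℝ≥0) : ℝ)) ^ n := (mul_pow _ _ _).symm
        _ ≤ (1 / 2) ^ n := by gcongr
  have h0 := ge_of_tendsto' (tendsto_pow_atTop_nhds_zero_of_lt_one (by norm_num : (0 : ℝ) ≤ 1 / 2)
    (by norm_num)) key
  have h1 := le_antisymm h0 measureReal_nonneg
  rw [measureReal_def, ENNReal.toReal_eq_zero_iff] at h1
  exact h1.resolve_right (measure_ne_top _ _)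

theorem ae_existsUnique_isStirring (hB : G.IsPoissonBars μ bars) (he : t.Encodes G φ) :
    ∀ᵐ ω ∂μ, ∃! σ, G.IsStirring (bars ω) σ := by
  classical
  have := he.countable
  set ε : ℝ≥0 := 1 / (2 * (D + 1)) with hε
  have hε0 : 0 < ε := by positivity
  have hDε : (D : ℝ) * ε ≤ 1 / 2 := by
    rw [hε]
    push_cast
    rw [mul_one_div, div_le_div_iff₀ (by positivity) (by norm_num)]
    linarith
  have h1 : ∀ᵐ ω ∂μ, ∀ (k : ℕ) (w : V), {x | t.OpenBelow (fun z =>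
      t.barCount G z (k * ε) ((k + 1) * ε) (bars ω) ≠ 0) w x}.Finite := by
    rw [ae_all_iff]; intro k
    rw [ae_all_iff]; intro w
    exact ae_openBelow_finite hB he (by rw [slot_length]; exact hDε) w
  have h2 : ∀ᵐ ω ∂μ, ∀ (k : ℕ) (w : V), t.barCount G w (k * ε) ((k + 1) * ε) (bars ω) ≠ ⊤ := by
    rw [ae_all_iff]; intro k
    rw [ae_all_iff]; intro w
    by_cases hw : w = φ
    · subst hw
      exact Eventually.of_forall fun ω => by rw [barCount_root he]; simp
    · exact ae_barCount_ne_top hB he hw _ _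
  filter_upwards [ae_noClash hB he, h1, h2] with ω hω h1 h2
  have hex : ∃ σ, G.IsStirring (bars ω) σ := by
    refine SimpleGraph.exists_isStirring_of_forall_slot hω hε0 fun k => ?_
    refine SimpleGraph.exists_isStirring_of_enclosed (hω.barsAt _) (exists_enclosed he
      (fun τ x y h => ?_) (fun w => ?_) fun z => ?_)
    · exact lt_of_le_of_lt zero_le (SimpleGraph.hasBar_barsAt.1 h).2.1
    · convert h1 k w using 4 with x
      funext z
      rw [barCount_ne_zero_iff]
      simp only [SimpleGraph.hasBar_barsAt, and_comm]
    · have := h2 k z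
      rw [barCount, Set.encard_ne_top_iff] at this
      exact this.subset fun τ hτ => SimpleGraph.hasBar_barsAt.1 hτ
  obtain ⟨σ, hσ⟩ := hex
  refine ⟨σ, hσ, fun σ' hσ' => ?_⟩
  funext s
  ext v
  exact (hσ'.isParticle v).eq_of_noClash hω (hσ.isParticle v) (by simp [hσ.zero, hσ'.zero])
    (fun _ _ _ _ _ => Iff.rfl) s le_rfl

end BranchTree

theorem theorem1 {V : Type*} [Infinite V] (G : SimpleGraph V) (hG : G.IsTree) (φ : V)
    (hdeg : ∃ Δ : ℕ, ∀ v, (G.neighborSet v).encard ≤ Δ)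
    (hoff : ∀ v, 2 ≤ (G.offspring φ v).encard) :
    ∃ T₀ : ℝ≥0, 0 < T₀ ∧ ∀ T : ℝ≥0, T₀ ≤ T →
      ∀ (Ω : Type*) [MeasurableSpace Ω] (μ : Measure Ω) [IsProbabilityMeasure μ]
        (bars : Ω → Set (G.edgeSet × ℝ≥0)), G.IsPoissonBars μ bars →
        ∀ᵐ ω ∂μ, (∃! σ : ℝ≥0 → Equiv.Perm V, G.IsStirring (bars ω) σ) ∧
          ∀ σ : ℝ≥0 → Equiv.Perm V, G.IsStirring (bars ω) σ →
            (σ T).HasInfiniteCycle := by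
  obtain ⟨Δ, hΔ⟩ := hdeg
  obtain ⟨t, he⟩ := BranchTree.exists_encodes hG φ hΔ hoff
  obtain ⟨T₀, hT₀, h⟩ := BranchTree.exists_params Δ
  refine ⟨⟨T₀, hT₀.le⟩, hT₀, fun T hT Ω _ μ _ bars hB => ?_⟩
  obtain ⟨M₀, hM₀⟩ := h T hT
  filter_upwards [BranchTree.ae_existsUnique_isStirring hB he, BranchTree.ae_hasInfiniteCycle hB he
    (fun v => Set.finite_of_encard_le_coe (hΔ v)) hM₀] with ω h1 h2
  exact ⟨h1, h2⟩
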